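/- **Setting.** Let $d\ge 2$, $d_z\ge 1$, $m\ge 0$. Let $k$ be a positive semidefinite kernel on $\mathbb R^d$ with RKHS $\mathcal H_0$, let $p$ be a positive probability density on $\mathbb R^d$ with score $s_p=\nabla\log p$, and let $q$ be a probability measure on $\mathbb R^{d_z}$. For $\phi\in\mathbb R^m$ let $q_\phi(x)=\int q_\phi(x|z)\,q(dz)$, where $q_\phi(\cdot|z)=\mathcal N(\mu(z;\phi),\mathrm{diag}(\sigma(z;\phi)^2))$ and $\mu,\sigma$ take values in $\mathbb R^d$ and are measurable in $z$. The loss is $$\mathcal L(\phi)=\mathrm{KSD}(q_\phi\|p)^2=\Big\|\int k(\cdot,y)\,\nabla\log\tfrac{p}{q_\phi}(y)\,q_\phi(y)\,dy\Big\|^2_{\mathcal H_0^d}.$$ For $u=(z,\xi)$ put $x=\mu(z;\phi)+\sigma(z;\phi)\odot\xi$ and $f=s_p(x)+\xi/\sigma(z;\phi)$ (entrywise quotient), and $h_\phi(u,u')=k(x,x')\langle f,f'\rangle$. With $u_{ri},u_i$ i.i.d. of law $q\otimes\mathcal N(0,I_d)$, the gradient estimators are $$\hat g_{\rm vanilla}(\phi)=\frac1{N^2}\sum_{i,j=1}^N\nabla_\phi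 h_\phi(u_{1i},u_{2j})\ (N\ge1),\qquad \hat g_{\rm u\text{-}stat}(\phi)=\frac{2}{N(N-1)}\sum_{1\le i<j\le N}\nabla_\phi h_\phi(u_i,u_j)\ (N\ge2).$$ **Assumptions.** All norms are Euclidean or operator norms. 1. $k$ is $C^2$ and $k,\|\nabla_1k\|,\|\nabla_{11}k\|,\|\nabla_{12}k\|\le B^2$ everywhere, $B>0$. 2. $\log p$ is $C^3$ with $\|\nabla^2\log p\|\le L$ and $\|\nabla^3\log p\|\le M$. 3. For some $G\ge1$, $\mu(z;\cdot)$ and $\sigma(z;\cdot)$ are $C^2$ with first and second $\phi$-derivatives bounded by $G(1+\|z\|)$, and every entry of $\sigma(z;\phi)$ is at least $1/\sqrt L$, $L>0$. 4. $\mathbb E_q\|z\|^4\le K d_z^2$, and $\mathbb E_{q_\phi}\|x\|^4\le s^4$ for all $\phi$. Let $x^*$ be any zero of $s_p$ and $C=L^2(s^4+\|x^*\|^4)^{1/2}$. **Theorem.** There is a constant $c>0$, depending only on $K$, such that in every such situation the following hold for $\hat g=\hat g_{\rm vanilla}$ with any $N\ge1$ and for $\hat g=\hat g_{\rm u\text{-}stat}$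 with any $N\ge 2$. (a) $\mathcal L$ is differentiable and $\nabla\mathcal L$ is Lipschitz with constant $c\,B^2G^2d_z\log d\,[(1\vee L)^3+Ld+M^2+C]$. The estimator $\hat g(\phi)$ is integrable, $\mathbb E\hat g(\phi)=\nabla\mathcal L(\phi)$, and $\mathbb E\|\hat g(\phi)-\mathbb E\hat g(\phi)\|^2\le \frac cN B^4G^2d_z\log d\,[Ld+L^2+C][Ld+C]$ for all $\phi$. (b) Let $L_\phi,\Sigma_0\ge0$ be any constants such that $\mathcal L$ is $L_\phi$-smooth and $\hat g$ has variance at most $\Sigma_0/N$ at every $\phi$. For all $\phi_0\in\mathbb R^m$, $\varepsilon>0$ and integers $T\ge1$ with $$T\ \ge\ c\,\frac{L_\phi\mathcal L_0}{\varepsilon^2}\Big(1+\frac{\Sigma_0}{N\varepsilon^2}\Big),\qquad \mathcal L_0=\mathcal L(\phi_0)-\inf_\phi\mathcal L,$$ there is a step size $\eta>0$ such that the SGD iterates $\phi_{t+1}=\phi_t-\eta\hat g_t$ started at $\phi_0$, where $\hat g_t$ is the estimator $\hat g(\phi_t)$ on a fresh independent batch of samples, include an iterate $\hat\phi=\phi_t$,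 $0\le t<T$, with $\mathbb E\|\nabla\mathcal L(\hat\phi)\|\le\varepsilon$. (c) The conclusion of (b) also holds with the explicit values $L_\phi=B^2G^2d_z\log d\,[(1\vee L)^3+Ld+M^2+C]$ and $\Sigma_0=B^4G^2d_z\log d\,[L^3d+L^2d^2+C^2]$. -/

import Mathlib

open MeasureTheory ProbabilityTheory

universe u v

namespace KSIVI

noncomputable section

/-- `ℝⁿ` with the Euclidean norm. -/
abbrev Euc (n : ℕ) : Type := EuclideanSpace ℝ (Fin n)

/-- The data of kernel semi-implicit variational inference with a diagonal Gaussian conditional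
layer: parameters `φ ∈ ℝᵐ`, latent variable `z ∈ ℝ^dz`, state `x ∈ ℝᵈ`. -/
structure Model (m dz d : ℕ) where
  /-- the kernel -/
  k : Euc d → Euc d → ℝ
  /-- the target density -/
  p : Euc d → ℝ
  /-- mean `μ(z; φ)` of the conditional layer -/
  mean : Euc dz → Euc m → Euc d
  /-- standard deviation `σ(z; φ)` of the conditional layer, entrywise -/
  std : Euc dz → Euc m → Euc d
  /-- the mixing distribution `q(z)` -/
  mix : Measure (Euc dz)

/-! ### Kernel Stein discrepancy -/

section KSD

variable {d : ℕ} (H₀ : Type v) [NormedAddCommGroup H₀] [InnerProductSpace ℝ H₀]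
  [CompleteSpace H₀] [RKHS ℝ H₀ (Euc d) ℝ]

/-- `H₀` is the reproducing kernel Hilbert space of the scalar kernel `k`. -/
def IsRKHSOf (k : Euc d → Euc d → ℝ) : Prop :=
  ∀ x y, RKHS.kernel H₀ x y 1 = k x y

/-- The integral operator `S_{q,k} f = ∫ k(·, y) f(y) dq(y)`, with values in `H₀`. The element
`k(·, y)` of `H₀` is `RKHS.kerFun H₀ y 1`. -/
def integralOp (q : Measure (Euc d)) (f : Euc d → ℝ) : H₀ :=
  ∫ y, f y • RKHS.kerFun H₀ y (1 : ℝ) ∂q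

/-- The measure on `ℝᵈ` with density `q`. -/
def densMeasure (q : Euc d → ℝ) : Measure (Euc d) :=
  volume.withDensity fun x => ENNReal.ofReal (q x)

/-- `KSD(q ‖ p) = ‖S_{q,k} ∇ log (p / q)‖` in the Hilbert space `H₀ᵈ`, where the operator acts
entrywise. -/
def KSD (q p : Euc d → ℝ) : ℝ :=
  ‖(WithLp.toLp 2 fun i : Fin d =>
      integralOp H₀ (densMeasure q)
        (fun y => gradient (fun x => Real.log (p x / q x)) y i) : PiLp 2 fun _ : Fin d => H₀)‖

end KSD

namespace Model

variable {m dz d : ℕ} (S : Model m dz d)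

/-! ### The variational family and the loss -/

/-- The density of `q_φ(· | z) = N(μ(z; φ), diag(σ(z; φ)²))`. -/
def condDensity (φ : Euc m) (z : Euc dz) (x : Euc d) : ℝ :=
  ∏ i, gaussianPDFReal (S.mean z φ i) (S.std z φ i ^ 2).toNNReal (x i)

/-- The semi-implicit density `q_φ(x) = ∫ q_φ(x | z) q(dz)`. -/
def varDensity (φ : Euc m) (x : Euc d) : ℝ :=
  ∫ z, S.condDensity φ z x ∂S.mix

/-- The loss `𝓛(φ) = KSD(q_φ ‖ p)²`. -/
def loss (H₀ : Type v) [NormedAddCommGroup H₀] [InnerProductSpace ℝ H₀] [CompleteSpace H₀]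
    [RKHS ℝ H₀ (Euc d) ℝ] (φ : Euc m) : ℝ :=
  KSD H₀ (S.varDensity φ) S.p ^ 2

/-! ### The stochastic gradients -/

/-- The score `s_p = ∇ log p`. -/
def score (x : Euc d) : Euc d := gradient (fun y => Real.log (S.p y)) x

/-- The reparameterization `x = μ(z; φ) + σ(z; φ) ⊙ ξ` for `u = (z, ξ)`. -/
def reparam (φ : Euc m) (u : Euc dz × Euc d) : Euc d :=
  WithLp.toLp 2 fun i => S.mean u.1 φ i + S.std u.1 φ i * u.2 i

/-- `f = s_p(x) - s_{q_φ(·|z)}(x) = s_p(x) + ξ / σ(z; φ)` at `x = μ(z; φ) + σ(z; φ) ⊙ ξ`. -/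
def scoreDiff (φ : Euc m) (u : Euc dz × Euc d) : Euc d :=
  S.score (S.reparam φ u) + WithLp.toLp 2 fun i => u.2 i / S.std u.1 φ i

/-- `k(x, x') ⟨f, f'⟩` as a function of `φ` and of the noise `u = (z, ξ)`, `u' = (z', ξ')`. -/
def pairLoss (φ : Euc m) (u u' : Euc dz × Euc d) : ℝ :=
  S.k (S.reparam φ u) (S.reparam φ u') * inner ℝ (S.scoreDiff φ u) (S.scoreDiff φ u')

/-- The law of one sample `u = (z, ξ)`: independent `z ∼ q(z)` and `ξ ∼ N(0, I)`. -/
def noise : Measure (Euc dz × Euc d) := S.mix.prod (stdGaussian (Euc d))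

/-- The law of a family of i.i.d. samples indexed by `ι`. -/
def batch (ι : Type) [Fintype ι] : Measure (ι → Euc dz × Euc d) :=
  Measure.pi fun _ => S.noise

/-- The vanilla gradient estimator, from two batches of `N` samples. -/
def gradVanilla (N : ℕ) (φ : Euc m) (u : Fin 2 × Fin N → Euc dz × Euc d) : Euc m :=
  (1 / (N : ℝ) ^ 2) • ∑ i : Fin N, ∑ j : Fin N,
    gradient (fun ψ => S.pairLoss ψ (u (0, i)) (u (1, j))) φ

/-- The U-statistic gradient estimator, from one batch of `N` samples. -/
def gradUStat (N : ℕ) (φ : Euc m) (u : Fin N → Euc dz × Euc d) : Euc m :=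
  (2 / ((N : ℝ) * ((N : ℝ) - 1))) • ∑ ij : Fin N × Fin N with ij.1 < ij.2,
    gradient (fun ψ => S.pairLoss ψ (u ij.1) (u ij.2)) φ

/-- The estimator `g`, on samples indexed by `ι`, is integrable with mean `∇f(φ)`. -/
def Unbiased (f : Euc m → ℝ) {ι : Type} [Fintype ι]
    (g : Euc m → (ι → Euc dz × Euc d) → Euc m) : Prop :=
  ∀ φ, Integrable (g φ) (S.batch ι) ∧ ∫ u, g φ u ∂S.batch ι = gradient f φ

/-- The estimator `g` has variance `𝔼 ‖g - 𝔼 g‖²` at most `V` at every parameter. -/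
def VarianceLE {ι : Type} [Fintype ι]
    (g : Euc m → (ι → Euc dz × Euc d) → Euc m) (V : ℝ) : Prop :=
  ∀ φ, ∫⁻ u, ‖g φ u - ∫ u', g φ u' ∂S.batch ι‖ₑ ^ 2 ∂S.batch ι ≤ ENNReal.ofReal V

/-! ### Stochastic gradient descent -/

/-- `f` is `ℓ`-smooth. -/
def Smooth (f : Euc m → ℝ) (ℓ : ℝ) : Prop :=
  Differentiable ℝ f ∧ ∀ φ ψ, ‖gradient f φ - gradient f ψ‖ ≤ ℓ * ‖φ - ψ‖

/-- The SGD iterates `φ_{t+1} = φ_t - η g(φ_t, w_t)` driven by the batches `w_0, w_1, …`. -/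
def sgd {β : Type} (η : ℝ) (g : Euc m → β → Euc m) (φ₀ : Euc m) (w : ℕ → β) : ℕ → Euc m
  | 0 => φ₀
  | t + 1 => sgd η g φ₀ w t - η • g (sgd η g φ₀ w t) (w t)

/-- The convergence guarantee for SGD on `f` with the estimator `g` and fresh i.i.d. batches of
size parameter `N`: for every starting point, every `ε > 0` and every number `T ≥ 1` of iterations
with `T ≥ c (ℓ f₀ / ε²) (1 + σ₀ / (N ε²))`, where `f₀ = f(φ₀) - inf f`, some step size `η > 0`
makes one of the iterates `φ_0, …, φ_{T-1}` satisfy `𝔼 ‖∇f(φ_t)‖ ≤ ε`. -/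
def SGDConverges (f : Euc m → ℝ) {ι : Type} [Fintype ι]
    (g : Euc m → (ι → Euc dz × Euc d) → Euc m) (N : ℕ) (c ℓ σ₀ : ℝ) : Prop :=
  ∀ (φ₀ : Euc m) (ε : ℝ) (T : ℕ), 0 < ε → 1 ≤ T →
    c * (ℓ * (f φ₀ - ⨅ φ, f φ) / ε ^ 2) * (1 + σ₀ / (N * ε ^ 2)) ≤ T →
    ∃ η : ℝ, 0 < η ∧
      ∀ (Ω : Type u) [MeasurableSpace Ω] (P : Measure Ω) [IsProbabilityMeasure P]
        (w : ℕ → Ω → ι → Euc dz × Euc d),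
        (∀ t, Measurable (w t)) → (∀ t, P.map (w t) = S.batch ι) → iIndepFun w P →
        ∃ t < T,
          Integrable (fun ω => ‖gradient f (sgd η g φ₀ (fun s => w s ω) t)‖) P ∧
          ∫ ω, ‖gradient f (sgd η g φ₀ (fun s => w s ω) t)‖ ∂P ≤ ε

/-! ### The assumptions -/

/-- The kernel and its derivatives up to order two are bounded by `B²`. -/
structure KernelAssumption (B : ℝ) : Prop where
  pos : 0 < B
  contDiff : ContDiff ℝ 2 fun xy : Euc d × Euc d => S.k xy.1 xy.2
  le : ∀ x y, S.k x y ≤ B ^ 2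
  grad₁ : ∀ x y, ‖fderiv ℝ (fun x' => S.k x' y) x‖ ≤ B ^ 2
  grad₁₁ : ∀ x y, ‖iteratedFDeriv ℝ 2 (fun x' => S.k x' y) x‖ ≤ B ^ 2
  grad₁₂ : ∀ x y, ‖fderiv ℝ (fun y' => fderiv ℝ (fun x' => S.k x' y') x) y‖ ≤ B ^ 2

/-- `p` is a positive probability density, `log p` is `C³`, with second and third derivatives
bounded by `L` and `M`. -/
structure TargetAssumption (L M : ℝ) : Prop where
  pos : ∀ x, 0 < S.p x
  lintegral_eq_one : ∫⁻ x, ENNReal.ofReal (S.p x) = 1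
  contDiff : ContDiff ℝ 3 fun x => Real.log (S.p x)
  hess : ∀ x, ‖iteratedFDeriv ℝ 2 (fun y => Real.log (S.p y)) x‖ ≤ L
  third : ∀ x, ‖iteratedFDeriv ℝ 3 (fun y => Real.log (S.p y)) x‖ ≤ M

/-- `h(z; φ)` is measurable in `z`, `C²` in `φ`, with first and second `φ`-derivatives bounded by
`G (1 + ‖z‖)`. -/
structure LayerRegular (h : Euc dz → Euc m → Euc d) (G : ℝ) : Prop where
  measurable : ∀ φ, Measurable fun z => h z φ
  contDiff : ∀ z, ContDiff ℝ 2 (h z)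
  grad : ∀ z φ, ‖fderiv ℝ (h z) φ‖ ≤ G * (1 + ‖z‖)
  hess : ∀ z φ, ‖iteratedFDeriv ℝ 2 (h z) φ‖ ≤ G * (1 + ‖z‖)

/-- Regularity of the conditional layer and the lower bound `1 / √L` on the standard deviation. -/
structure LayerAssumption (G L : ℝ) : Prop where
  one_le : 1 ≤ G
  L_pos : 0 < L
  mean : LayerRegular S.mean G
  std : LayerRegular S.std G
  std_ge : ∀ z φ i, 1 / √L ≤ S.std z φ i

/-- The mixing distribution is a probability measure with `𝔼 ‖z‖⁴ ≤ K dz²`, and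
`𝔼_{q_φ} ‖x‖⁴ ≤ s⁴` for all `φ`. -/
structure MomentAssumption (K s : ℝ) : Prop where
  isProb : IsProbabilityMeasure S.mix
  mix : ∫⁻ z, ‖z‖ₑ ^ 4 ∂S.mix ≤ ENNReal.ofReal (K * (dz : ℝ) ^ 2)
  var : ∀ φ, ∫⁻ x, ‖x‖ₑ ^ 4 ∂densMeasure (S.varDensity φ) ≤ ENNReal.ofReal (s ^ 4)

end Model

/-! ### The explicit constants -/

/-- `C`, where `C² = L⁴ (s⁴ + ‖x⋆‖⁴)`. -/
def scoreConst (L s : ℝ) {d : ℕ} (xstar : Euc d) : ℝ :=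
  √(L ^ 4 * (s ^ 4 + ‖xstar‖ ^ 4))

/-- `B² G² dz log d [(1 ∨ L)³ + L d + M² + C]`. -/
def smoothConst (dz d : ℕ) (B G L M C : ℝ) : ℝ :=
  B ^ 2 * G ^ 2 * dz * Real.log d * (max 1 L ^ 3 + L * d + M ^ 2 + C)

/-- `B⁴ G² dz log d [L³ d + L² d² + C²]`. -/
def varConst (dz d : ℕ) (B G L C : ℝ) : ℝ :=
  B ^ 4 * G ^ 2 * dz * Real.log d * (L ^ 3 * d + L ^ 2 * (d : ℝ) ^ 2 + C ^ 2)

/-- `B⁴ G² dz log d [L d + L² + C] [L d + C]`. -/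
def varConstFull (dz d : ℕ) (B G L C : ℝ) : ℝ :=
  B ^ 4 * G ^ 2 * dz * Real.log d * ((L * d + L ^ 2 + C) * (L * d + C))

end

end KSIVI

/-! Write f for the score difference `scoreDiff`. The mixture satisfies q_φ ∇log q_φ = ∫ q_φ(·|z)
∇log q_φ(·|z) q(dz), so under the Stein operator its intractable score may be replaced by the score
of the Gaussian layer (`integralOp_eq`). Expanding the squared RKHS norm with the reproducing
property then gives 𝓛(φ) = 𝔼 k(x,x')⟨f,f'⟩ over two independent samples (`loss_eq`). From there on 𝓛
is the mean of the explicit C² function `pairLoss`, and part (a) is a matter of pointwise bounds and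
moments.

Pointwise, the φ-derivatives of x and f are controlled by X = G(1+‖z‖)(1+‖ξ‖_∞) and X². The sup norm
enters because ξ acts by entrywise multiplication, and it is the origin of log d: the squared
maximum of d Gaussians has size log d. The fourth moments satisfy 𝔼X⁴ ≤ a² and 𝔼‖f‖⁴ ≤ b² with a of
order G² dz log d and b of order Ld + C. Splitting products by AM-GM, the Hessian bound integrates
to order B²a(b + (L+L√L+M)√b + L²) and the squared gradient bound to order B⁴ab(b+L²).
Differentiation under the integral (`smooth_integral`) turns the first into smoothness and yields
unbiasedness.

Both estimators are normalized sums of one kernel over pairs of distinct sample indices. Centred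
terms of disjoint pairs are uncorrelated, and a pair meets only O(N) others, hence the rate 1/N
(`pairStatistic_mean_variance`).

For part (b), the descent inequality is averaged over a batch independent of the current iterate
(`sgd_step`), telescoped and compared with inf 𝓛 (`exists_sgd_gradient_le`).

Part (c) needs one more observation. Its Σ₀ does not dominate the variance factor of (a), which
contains the term L²C. But the iteration count sees the variance only multiplied by the smoothness
constant, and the stated smoothness constant is larger than the one actually proved. The slack pays
for the missing term (`smoothness_mul_variance_factor_le`). -/

namespace KSIVI

noncomputable section

/-! ### Quadratic bounds for functions with Lipschitz gradient. -/

section Descent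

variable {E : Type*} [NormedAddCommGroup E] [InnerProductSpace ℝ E] [CompleteSpace E]
  {f : E → ℝ} {ℓ : ℝ}

lemma norm_fderiv_sub_eq_norm_gradient_sub (f : E → ℝ) (x y : E) :
    ‖fderiv ℝ f x - fderiv ℝ f y‖ = ‖gradient f x - gradient f y‖ := by
  rw [← toDual_gradient, ← toDual_gradient, ← map_sub, LinearIsometryEquiv.norm_map]

/-- On the ball of radius ‖y - x‖ around x the gradient moves by at most ℓ‖y - x‖, so the mean value
inequality applies. It yields ℓ instead of the sharp ℓ/2; the lost factor goes into the final
constant. -/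
lemma abs_sub_inner_gradient_le (hf : Differentiable ℝ f) (hℓ : 0 ≤ ℓ)
    (hl : ∀ x y, ‖gradient f x - gradient f y‖ ≤ ℓ * ‖x - y‖) (x y : E) :
    |f y - f x - inner ℝ (gradient f x) (y - x)| ≤ ℓ * ‖y - x‖ ^ 2 := by
  have h := (convex_closedBall x ‖y - x‖).norm_image_sub_le_of_norm_fderiv_le' (𝕜 := ℝ)
    (f := f) (φ := fderiv ℝ f x) (C := ℓ * ‖y - x‖) (x := x) (y := y)
    (fun z _ => hf z) (fun z hz => ?_) (by simp) (by simp [dist_eq_norm])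
  · rw [Real.norm_eq_abs, ← inner_gradient_left] at h
    calc _ ≤ _ := h
      _ = _ := by ring
  · rw [norm_fderiv_sub_eq_norm_gradient_sub]
    refine (hl z x).trans ?_
    gcongr
    simpa [dist_eq_norm] using hz

/-- Growth at most quadratic is what makes f integrable along square integrable iterates. -/
lemma abs_le_of_smooth (hf : Differentiable ℝ f) (hℓ : 0 ≤ ℓ)
    (hl : ∀ x y, ‖gradient f x - gradient f y‖ ≤ ℓ * ‖x - y‖) (x : E) :
    |f x| ≤ |f 0| + ‖gradient f 0‖ * ‖x‖ + ℓ * ‖x‖ ^ 2 := by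
  have h := abs_sub_inner_gradient_le hf hℓ hl 0 x
  have h2 := abs_real_inner_le_norm (gradient f 0) x
  rw [sub_zero] at h
  have : f x = (f x - f 0 - inner ℝ (gradient f 0) x) + f 0 + inner ℝ (gradient f 0) x := by ring
  rw [this]
  refine (abs_add_le _ _).trans ?_
  have := abs_add_le (f x - f 0 - inner ℝ (gradient f 0) x) (f 0)
  linarith

end Descent

/-! ### One stochastic gradient step. -/

section Step

lemma continuous_of_lipschitz_bound {E F : Type*} [NormedAddCommGroup E]
    [NormedAddCommGroup F] {G : E → F} {ℓ : ℝ}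
    (hℓ : 0 ≤ ℓ) (hl : ∀ x y, ‖G x - G y‖ ≤ ℓ * ‖x - y‖) : Continuous G := by
  refine (LipschitzWith.of_dist_le_mul (K := ⟨ℓ, hℓ⟩) fun x y => ?_).continuous
  rw [dist_eq_norm, dist_eq_norm]
  exact hl x y

variable {E : Type*} [NormedAddCommGroup E] [InnerProductSpace ℝ E] [CompleteSpace E]
  {β : Type*} [MeasurableSpace β] {ν : Measure β} [IsProbabilityMeasure ν]
  {Ω : Type*} [MeasurableSpace Ω] {P : Measure Ω} [IsProbabilityMeasure P]
  {f : E → ℝ} {ℓ V η : ℝ} {g : E → β → E} {X : Ω → E} {W : Ω → β}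

lemma integrable_comp_of_smooth (hf : Differentiable ℝ f) (hℓ : 0 ≤ ℓ)
    (hl : ∀ x y, ‖gradient f x - gradient f y‖ ≤ ℓ * ‖x - y‖) (hX : MemLp X 2 P) :
    Integrable (fun ω => f (X ω)) P := by
  refine Integrable.mono' (g := fun ω => |f 0| + ‖gradient f 0‖ * ‖X ω‖ + ℓ * ‖X ω‖ ^ 2) ?_
    (hf.continuous.comp_aestronglyMeasurable hX.1)
    (.of_forall fun ω => abs_le_of_smooth hf hℓ hl _)
  exact ((integrable_const _).add ((hX.integrable one_le_two).norm.const_mul _)).add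
    (hX.norm.integrable_sq.const_mul _)

variable [SecondCountableTopology E] [MeasurableSpace E] [BorelSpace E]

lemma memLp_comp_of_lipschitz {F : Type*} [NormedAddCommGroup F] {G : E → F}
    (hℓ : 0 ≤ ℓ) (hl : ∀ x y, ‖G x - G y‖ ≤ ℓ * ‖x - y‖) (hX : MemLp X 2 P) :
    MemLp (fun ω => G (X ω)) 2 P := by
  have hc : Continuous G := continuous_of_lipschitz_bound hℓ hl
  have hb : MemLp (fun ω => ‖G 0‖ + ℓ * ‖X ω‖) 2 P :=
    (memLp_const (‖G 0‖)).add (hX.norm.const_mul ℓ)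
  refine hb.mono' (hc.comp_aestronglyMeasurable hX.1) (.of_forall fun ω => ?_)
  have h1 := hl (X ω) 0
  have h2 := norm_sub_norm_le (G (X ω)) (G 0)
  rw [sub_zero] at h1
  linarith

/-- One step of stochastic gradient descent from a square integrable point. -/
lemma sgd_step (hf : Differentiable ℝ f) (hℓ : 0 ≤ ℓ) (hV : 0 ≤ V)
    (hl : ∀ x y, ‖gradient f x - gradient f y‖ ≤ ℓ * ‖x - y‖)
    (hg : Measurable (Function.uncurry g)) (hgi : ∀ x, Integrable (g x) ν)
    (hgm : ∀ x, ∫ u, g x u ∂ν = gradient f x)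
    (hgv : ∀ x, ∫⁻ u, ‖g x u - gradient f x‖ₑ ^ 2 ∂ν ≤ ENNReal.ofReal V)
    (hXm : Measurable X) (hX : MemLp X 2 P) (hW : Measurable W) (hWν : P.map W = ν)
    (hXW : IndepFun X W P) (hη : 0 < η) (hηℓ : 2 * (η * ℓ) ≤ 1) :
    MemLp (fun ω => X ω - η • g (X ω) (W ω)) 2 P ∧
    ∫ ω, f (X ω - η • g (X ω) (W ω)) ∂P + η / 2 * ∫ ω, ‖gradient f (X ω)‖ ^ 2 ∂P
      ≤ ∫ ω, f (X ω) ∂P + ℓ * η ^ 2 * V := by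
  have hgc : Continuous (gradient f) := continuous_of_lipschitz_bound hℓ hl
  have hlaw : P.map (fun ω => (X ω, W ω)) = (P.map X).prod ν := by
    rw [← hWν]; exact (indepFun_iff_map_prod_eq_prod_map_map hXm.aemeasurable hW.aemeasurable).1 hXW
  have hXWm : Measurable fun ω => (X ω, W ω) := hXm.prodMk hW
  have hmX : IsProbabilityMeasure (P.map X) := Measure.isProbabilityMeasure_map hXm.aemeasurable
  have hnm : Measurable fun p : E × β => g p.1 p.2 - gradient f p.1 :=
    hg.sub (hgc.measurable.comp measurable_fst)
  have hgrad : MemLp (fun ω => gradient f (X ω)) 2 P := memLp_comp_of_lipschitz hℓ hl hX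
  have hN2 : ∫⁻ ω, ‖g (X ω) (W ω) - gradient f (X ω)‖ₑ ^ 2 ∂P ≤ ENNReal.ofReal V := by
    calc _ = ∫⁻ p, ‖g p.1 p.2 - gradient f p.1‖ₑ ^ 2 ∂(P.map (fun ω => (X ω, W ω))) :=
          (lintegral_map (f := fun p : E × β => ‖g p.1 p.2 - gradient f p.1‖ₑ ^ 2)
            (hnm.enorm.pow_const 2) hXWm).symm
      _ = ∫⁻ x, ∫⁻ w, ‖g x w - gradient f x‖ₑ ^ 2 ∂ν ∂(P.map X) := by
          rw [hlaw, lintegral_prod _ (hnm.enorm.pow_const 2).aemeasurable]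
      _ ≤ ∫⁻ x, ENNReal.ofReal V ∂(P.map X) := lintegral_mono fun x => hgv x
      _ = _ := by simp
  have hN : MemLp (fun ω => g (X ω) (W ω) - gradient f (X ω)) 2 P := by
    refine ⟨(hnm.comp hXWm).aestronglyMeasurable, ?_⟩
    rw [eLpNorm_lt_top_iff_lintegral_rpow_enorm_lt_top (by simp) (by simp)]
    refine lt_of_le_of_lt ?_ (ENNReal.ofReal_lt_top (r := V))
    simpa using hN2
  have hgL : MemLp (fun ω => g (X ω) (W ω)) 2 P := by
    have h := hN.add hgrad
    convert h using 2 with ω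
    simp
  have hY : MemLp (fun ω => X ω - η • g (X ω) (W ω)) 2 P := hX.sub (hgL.const_smul η)
  refine ⟨hY, ?_⟩
  have hNV : ∫ ω, ‖g (X ω) (W ω) - gradient f (X ω)‖ ^ 2 ∂P ≤ V := by
    rw [integral_eq_lintegral_of_nonneg_ae (.of_forall fun _ => sq_nonneg _)
      hN.norm.integrable_sq.1]
    refine ENNReal.toReal_le_of_le_ofReal hV ?_
    convert hN2 using 3 with ω
    rw [ENNReal.ofReal_pow (norm_nonneg _), ofReal_norm]
  have hinnerint : Integrable
      (fun ω => inner ℝ (gradient f (X ω)) (g (X ω) (W ω) - gradient f (X ω))) P := by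
    refine Integrable.mono' (hgrad.norm.integrable_mul hN.norm)
      (hgrad.1.inner hN.1) (.of_forall fun ω => ?_)
    exact abs_real_inner_le_norm _ _
  -- By independence the law of (X, W) is a product; integrating over the batch with the point x
  -- frozen leaves ⟨∇f(x), 𝔼g(x,·) - ∇f(x)⟩ = 0.
  have hinner : ∫ ω, inner ℝ (gradient f (X ω)) (g (X ω) (W ω) - gradient f (X ω)) ∂P = 0 := by
    have hm : StronglyMeasurable fun p : E × β =>
        inner ℝ (gradient f p.1) (g p.1 p.2 - gradient f p.1) :=
      ((hgc.measurable.comp measurable_fst).inner hnm).stronglyMeasurable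
    have hi : Integrable (fun p : E × β =>
        inner ℝ (gradient f p.1) (g p.1 p.2 - gradient f p.1)) (P.map fun ω => (X ω, W ω)) := by
      rw [integrable_map_measure hm.aestronglyMeasurable hXWm.aemeasurable]
      exact hinnerint
    calc _ = ∫ p, inner ℝ (gradient f p.1) (g p.1 p.2 - gradient f p.1)
            ∂(P.map fun ω => (X ω, W ω)) :=
          (integral_map hXWm.aemeasurable hm.aestronglyMeasurable).symm
      _ = ∫ x, ∫ w, inner ℝ (gradient f x) (g x w - gradient f x) ∂ν ∂(P.map X) := by
          rw [hlaw] at hi ⊢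
          rw [integral_prod _ hi]
      _ = ∫ x, 0 ∂(P.map X) := by
          congr 1 with x
          rw [integral_inner (f := fun w => g x w - gradient f x)
            ((hgi x).sub (integrable_const _)), integral_sub (hgi x) (integrable_const _), hgm x]
          simp
      _ = 0 := by simp
  -- Expand the quadratic bound with g = ∇f + n. The condition 2ηℓ ≤ 1 lets half of η‖∇f‖² absorb
  -- ℓη²‖∇f‖², and the cross term has mean zero.
  have hpt : ∀ ω, f (X ω - η • g (X ω) (W ω)) ≤
      f (X ω) - η / 2 * ‖gradient f (X ω)‖ ^ 2
        + (2 * (ℓ * η ^ 2) - η) * inner ℝ (gradient f (X ω)) (g (X ω) (W ω) - gradient f (X ω))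
        + ℓ * η ^ 2 * ‖g (X ω) (W ω) - gradient f (X ω)‖ ^ 2 := by
    intro ω
    have h := (abs_le.1 (abs_sub_inner_gradient_le hf hℓ hl (X ω)
      (X ω - η • g (X ω) (W ω)))).2
    set v := gradient f (X ω)
    set n := g (X ω) (W ω) - v with hn
    have hgn : g (X ω) (W ω) = v + n := by rw [hn]; abel
    have e1 : X ω - η • g (X ω) (W ω) - X ω = -(η • (v + n)) := by rw [hgn]; abel
    have e2 : inner ℝ v (-(η • (v + n))) = -(η * (‖v‖ ^ 2 + inner ℝ v n)) := by
      rw [inner_neg_right, inner_smul_right, inner_add_right, real_inner_self_eq_norm_sq]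
    have e3 : ‖-(η • (v + n))‖ ^ 2 = η ^ 2 * (‖v‖ ^ 2 + 2 * inner ℝ v n + ‖n‖ ^ 2) := by
      rw [norm_neg, norm_smul, mul_pow, norm_add_sq_real, Real.norm_eq_abs, sq_abs]
    rw [e1, e2, e3] at h
    have h4 : ℓ * η ^ 2 * ‖v‖ ^ 2 ≤ η / 2 * ‖v‖ ^ 2 := by
      gcongr
      nlinarith
    nlinarith
  have hfX := integrable_comp_of_smooth hf hℓ hl hX
  have hfY := integrable_comp_of_smooth hf hℓ hl hY
  have i1 : Integrable (fun ω => η / 2 * ‖gradient f (X ω)‖ ^ 2) P :=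
    hgrad.norm.integrable_sq.const_mul _
  have i2 := hinnerint.const_mul (2 * (ℓ * η ^ 2) - η)
  have i3 : Integrable (fun ω => ℓ * η ^ 2 * ‖g (X ω) (W ω) - gradient f (X ω)‖ ^ 2) P :=
    hN.norm.integrable_sq.const_mul _
  have hle := integral_mono hfY (((hfX.sub i1).add i2).add i3) hpt
  simp only [Pi.add_apply, Pi.sub_apply] at hle
  have s1 := integral_add ((hfX.sub i1).add i2) i3
  have s2 := integral_add (hfX.sub i1) i2
  have s3 := integral_sub hfX i1
  simp only [Pi.add_apply, Pi.sub_apply] at s1 s2 s3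
  rw [s1, s2, s3, integral_const_mul, integral_const_mul, integral_const_mul, hinner] at hle
  have : ℓ * η ^ 2 * ∫ ω, ‖g (X ω) (W ω) - gradient f (X ω)‖ ^ 2 ∂P ≤ ℓ * η ^ 2 * V := by gcongr
  linarith

end Step

/-! ### Iterates of SGD, their independence of the next batch, and convergence. -/

section Iterates

variable {m : ℕ} {β : Type}

/-- The iterate at time t uses only the batches before t; this is the adaptedness behind
`indepFun_sgd`. -/
lemma sgd_congr {η : ℝ} {g : Euc m → β → Euc m} {φ₀ : Euc m} {w w' : ℕ → β} :
    ∀ {t : ℕ}, (∀ s < t, w s = w' s) → Model.sgd η g φ₀ w t = Model.sgd η g φ₀ w' t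
  | 0, _ => rfl
  | t + 1, h => by
    have ih := sgd_congr (η := η) (g := g) (φ₀ := φ₀) (t := t) fun s hs => h s (by omega)
    simp only [Model.sgd, ih, h t (by omega)]

variable [MeasurableSpace β]

lemma measurable_sgd {η : ℝ} {g : Euc m → β → Euc m} (hg : Measurable (Function.uncurry g))
    (φ₀ : Euc m) {α : Type*} [MeasurableSpace α] {w : ℕ → α → β} (hw : ∀ s, Measurable (w s)) :
    ∀ t : ℕ, Measurable fun a => Model.sgd η g φ₀ (fun s => w s a) t
  | 0 => measurable_const
  | t + 1 => by
    have ih := measurable_sgd (η := η) hg φ₀ hw t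
    exact ih.sub ((hg.comp (ih.prodMk (hw t))).const_smul η)

lemma indepFun_sgd {η : ℝ} {g : Euc m → β → Euc m} (hg : Measurable (Function.uncurry g))
    (φ₀ : Euc m) {Ω : Type*} [MeasurableSpace Ω] {P : Measure Ω} [IsProbabilityMeasure P]
    {w : ℕ → Ω → β} (hw : ∀ s, Measurable (w s)) (hi : iIndepFun w P) (t : ℕ) :
    IndepFun (fun ω => Model.sgd η g φ₀ (fun s => w s ω) t) (w t) P := by
  obtain ⟨ω₀⟩ : Nonempty Ω := nonempty_of_isProbabilityMeasure P
  have h := hi.indepFun_finset (Finset.range t) {t} (by simp) hw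
  -- A tuple of the first t batches is padded to an infinite sequence by an arbitrary value, which
  -- the iterate at time t never reads. The iterate thus becomes a measurable function of those
  -- batches alone.
  let e : ℕ → ((Finset.range t) → β) → β := fun s v =>
    if hs : s ∈ Finset.range t then v ⟨s, hs⟩ else w 0 ω₀
  have he : ∀ s, Measurable (e s) := by
    intro s
    by_cases hs : s ∈ Finset.range t
    · simpa only [e, dif_pos hs] using measurable_pi_apply _
    · simp only [e, dif_neg hs]
      exact measurable_const
  have h2 := h.comp (measurable_sgd (η := η) hg φ₀ he t)
    (measurable_pi_apply (⟨t, by simp⟩ : ({t} : Finset ℕ)))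
  refine h2.congr (.of_forall fun ω => ?_) (.of_forall fun _ => rfl)
  refine sgd_congr fun s hs => ?_
  exact dif_pos (Finset.mem_range.2 hs)

/-- The three requirements on η are the descent condition, a noise floor of at most a quarter of ε²,
and enough total progress ηT to consume the initial gap L₀. -/
lemma exists_stepSize {ℓ V L₀ ε : ℝ} {T : ℕ} (hℓ : 0 ≤ ℓ) (hV : 0 ≤ V) (hL₀ : 0 ≤ L₀)
    (hε : 0 < ε) (hT : 1 ≤ T) (h : 16 * (ℓ * L₀ / ε ^ 2) * (1 + V / ε ^ 2) ≤ T) :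
    ∃ η : ℝ, 0 < η ∧ 2 * (η * ℓ) ≤ 1 ∧ 4 * (ℓ * η * V) ≤ ε ^ 2 ∧ 4 * L₀ ≤ η * T * ε ^ 2 := by
  have hT' : (1 : ℝ) ≤ T := by exact_mod_cast hT
  have hε2 : 0 < ε ^ 2 := by positivity
  rcases hℓ.eq_or_lt with rfl | hℓ
  -- For ℓ = 0 nothing bounds the step from above. The added 1 keeps it positive when L₀ = 0.
  · refine ⟨4 * L₀ / ε ^ 2 + 1, by positivity, by simp, by simpa using hε2.le, ?_⟩
    have h1 : 4 * L₀ ≤ (4 * L₀ / ε ^ 2 + 1) * ε ^ 2 := by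
      rw [add_mul, div_mul_cancel₀ _ hε2.ne']
      linarith
    have h2 : (4 * L₀ / ε ^ 2 + 1) * ε ^ 2 * 1 ≤ (4 * L₀ / ε ^ 2 + 1) * ε ^ 2 * T := by gcongr
    linarith
  · set r := V / ε ^ 2 with hr
    have hVr : V = r * ε ^ 2 := by rw [hr, div_mul_cancel₀ _ hε2.ne']
    have hr0 : 0 ≤ r := by positivity
    -- With V = rε² the noise term is 2rε²/(1+2r) ≤ ε², and the progress requirement reduces to
    -- 8(1+r) ≥ 4(1+2r).
    refine ⟨1 / (2 * ℓ * (1 + 2 * r)), by positivity, ?_, ?_, ?_⟩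
    · rw [← mul_div_right_comm, ← mul_div_assoc, div_le_one (by positivity)]
      nlinarith
    · rw [hVr, ← mul_div_assoc, ← mul_div_right_comm, ← mul_div_assoc, div_le_iff₀ (by positivity)]
      have : 0 ≤ ℓ * r * ε ^ 2 := by positivity
      nlinarith [mul_pos hℓ hε2]
    · rw [← mul_div_right_comm, ← mul_div_right_comm, le_div_iff₀ (by positivity)]
      have e : 16 * (ℓ * L₀ / ε ^ 2) * (1 + r) * ε ^ 2 = 16 * ℓ * L₀ * (1 + r) := by
        field_simp
      have h3 := mul_le_mul_of_nonneg_right h hε2.le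
      rw [e] at h3
      have : 0 ≤ ℓ * L₀ := by positivity
      nlinarith [mul_nonneg this hr0]

/-- Stochastic gradient descent on a smooth function bounded below, with an unbiased estimator of
bounded variance, finds a point with small gradient. -/
theorem exists_sgd_gradient_le {f : Euc m → ℝ} {ℓ V : ℝ} {g : Euc m → β → Euc m} {ν : Measure β}
    [IsProbabilityMeasure ν] (hf : Model.Smooth f ℓ) (hℓ : 0 ≤ ℓ) (hV : 0 ≤ V)
    (hb : BddBelow (Set.range f)) (hg : Measurable (Function.uncurry g))
    (hgi : ∀ x, Integrable (g x) ν) (hgm : ∀ x, ∫ u, g x u ∂ν = gradient f x)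
    (hgv : ∀ x, ∫⁻ u, ‖g x u - ∫ u', g x u' ∂ν‖ₑ ^ 2 ∂ν ≤ ENNReal.ofReal V)
    (φ₀ : Euc m) {ε : ℝ} {T : ℕ} (hε : 0 < ε) (hT : 1 ≤ T)
    (h : 16 * (ℓ * (f φ₀ - ⨅ φ, f φ) / ε ^ 2) * (1 + V / ε ^ 2) ≤ T) :
    ∃ η : ℝ, 0 < η ∧
      ∀ (Ω : Type u) [MeasurableSpace Ω] (P : Measure Ω) [IsProbabilityMeasure P]
        (w : ℕ → Ω → β), (∀ t, Measurable (w t)) → (∀ t, P.map (w t) = ν) → iIndepFun w P →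
        ∃ t < T,
          Integrable (fun ω => ‖gradient f (Model.sgd η g φ₀ (fun s => w s ω) t)‖) P ∧
          ∫ ω, ‖gradient f (Model.sgd η g φ₀ (fun s => w s ω) t)‖ ∂P ≤ ε := by
  have hinf : ∀ φ, ⨅ φ, f φ ≤ f φ := fun φ => ciInf_le hb φ
  obtain ⟨η, hη, h1, h2, h3⟩ := exists_stepSize hℓ hV (sub_nonneg.2 (hinf φ₀)) hε hT h
  refine ⟨η, hη, fun Ω _ P _ w hw hwν hi => ?_⟩
  simp_rw [hgm] at hgv
  set X : ℕ → Ω → Euc m := fun t ω => Model.sgd η g φ₀ (fun s => w s ω) t with hXdef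
  have hXm : ∀ t, Measurable (X t) := measurable_sgd hg φ₀ hw
  have hstep : ∀ t, MemLp (X t) 2 P → MemLp (X (t + 1)) 2 P ∧
      ∫ ω, f (X (t + 1) ω) ∂P + η / 2 * ∫ ω, ‖gradient f (X t ω)‖ ^ 2 ∂P
        ≤ ∫ ω, f (X t ω) ∂P + ℓ * η ^ 2 * V := fun t ht =>
    sgd_step hf.1 hℓ hV hf.2 hg hgi hgm hgv (hXm t) ht (hw t) (hwν t)
      (indepFun_sgd hg φ₀ hw hi t) hη h1
  have hXL : ∀ t, MemLp (X t) 2 P := by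
    intro t
    induction t with
    | zero => exact memLp_const φ₀
    | succ t ih => exact (hstep t ih).1
  have hgradL : ∀ t, MemLp (fun ω => gradient f (X t ω)) 2 P := fun t =>
    memLp_comp_of_lipschitz hℓ hf.2 (hXL t)
  -- Telescoped descent inequality.
  have hsum : ∀ t : ℕ, ∫ ω, f (X t ω) ∂P
      + η / 2 * ∑ s ∈ Finset.range t, ∫ ω, ‖gradient f (X s ω)‖ ^ 2 ∂P
      ≤ f φ₀ + t * (ℓ * η ^ 2 * V) := by
    intro t
    induction t with
    | zero => simp [hXdef, Model.sgd]
    | succ t ih =>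
      have := (hstep t (hXL t)).2
      rw [Finset.sum_range_succ]
      push_cast
      linarith
  have hlow : ⨅ φ, f φ ≤ ∫ ω, f (X T ω) ∂P := by
    have := integral_mono (integrable_const (⨅ φ, f φ))
      (integrable_comp_of_smooth hf.1 hℓ hf.2 (hXL T)) (fun ω => hinf (X T ω))
    simpa using this
  have hTpos : (0 : ℝ) < T := by exact_mod_cast hT
  obtain ⟨t, ht, hle⟩ : ∃ t ∈ Finset.range T, ∫ ω, ‖gradient f (X t ω)‖ ^ 2 ∂P ≤ ε ^ 2 := by
    -- If every mean square gradient exceeded ε², the telescoped sum would give ηTε²/2 < L₀ + Tℓη²V,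
    -- while the choice of η makes each term on the right at most ηTε²/4.
    by_contra! hcon
    have hlt := Finset.sum_lt_sum_of_nonempty (Finset.nonempty_range_iff.2 (by omega)) hcon
    rw [Finset.sum_const, Finset.card_range, nsmul_eq_mul] at hlt
    have hs := hsum T
    have h4 : η / 2 * (T * ε ^ 2) <
        η / 2 * ∑ s ∈ Finset.range T, ∫ ω, ‖gradient f (X s ω)‖ ^ 2 ∂P := by gcongr
    have h5 : (T : ℝ) * η * (4 * (ℓ * η * V)) ≤ T * η * ε ^ 2 := by gcongr
    nlinarith
  refine ⟨t, Finset.mem_range.1 ht, ((hgradL t).integrable one_le_two).norm, ?_⟩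
  refine le_of_sq_le_sq ?_ hε.le |>.trans le_rfl
  refine le_trans ?_ hle
  -- Jensen's inequality, in the form that the variance of ‖∇f‖ is nonnegative, passes from the
  -- second moment to the first.
  have hv := variance_nonneg (fun ω => ‖gradient f (X t ω)‖) P
  rw [variance_eq_sub (hgradL t).norm] at hv
  simpa using hv

end Iterates

/-! ### Mean and variance of sums over pairs of independent samples. -/

section PairStatistic

variable {ι α : Type*} [Fintype ι] [MeasurableSpace α] {μ : Measure α} [IsProbabilityMeasure μ]

lemma iIndepFun_eval_pi : iIndepFun (fun (i : ι) (u : ι → α) => u i) (Measure.pi fun _ => μ) :=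
  iIndepFun_pi (X := fun _ => id) fun _ => aemeasurable_id

lemma measurePreserving_pair {a b : ι} (hab : a ≠ b) :
    MeasurePreserving (fun u : ι → α => (u a, u b)) (Measure.pi fun _ => μ) (μ.prod μ) := by
  refine ⟨by fun_prop, ?_⟩
  rw [(indepFun_iff_map_prod_eq_prod_map_map (measurable_pi_apply a).aemeasurable
    (measurable_pi_apply b).aemeasurable).1 (iIndepFun_eval_pi.indepFun hab)]
  exact congrArg₂ _ (measurePreserving_eval (fun _ => μ) a).map_eq
    (measurePreserving_eval (fun _ => μ) b).map_eq

lemma measurePreserving_two_pairs {a b c d : ι} (hab : a ≠ b) (hcd : c ≠ d) (hac : a ≠ c)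
    (had : a ≠ d) (hbc : b ≠ c) (hbd : b ≠ d) :
    MeasurePreserving (fun u : ι → α => ((u a, u b), (u c, u d))) (Measure.pi fun _ => μ)
      ((μ.prod μ).prod (μ.prod μ)) := by
  refine ⟨by fun_prop, ?_⟩
  rw [(indepFun_iff_map_prod_eq_prod_map_map (f := fun u : ι → α => (u a, u b))
    (g := fun u : ι → α => (u c, u d)) (by fun_prop) (by fun_prop)).1
    (iIndepFun_eval_pi.indepFun_prodMk_prodMk (by fun_prop) a b c d hac had hbc hbd)]
  exact congrArg₂ _ (measurePreserving_pair hab).map_eq (measurePreserving_pair hcd).map_eq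

lemma integrable_inner_of_memLp {E : Type*} [NormedAddCommGroup E]
    [InnerProductSpace ℝ E] {Ω : Type*} [MeasurableSpace Ω] {P : Measure Ω} {f g : Ω → E}
    (hf : MemLp f 2 P) (hg : MemLp g 2 P) : Integrable (fun ω => inner ℝ (f ω) (g ω)) P :=
  Integrable.mono' (hf.norm.integrable_mul hg.norm) (hf.1.inner hg.1)
    (.of_forall fun _ => abs_real_inner_le_norm _ _)

variable {E : Type*} [NormedAddCommGroup E] [InnerProductSpace ℝ E] [CompleteSpace E]
  {Z : α × α → E}

/-- Disjoint index pairs give independent centred vectors, so the mean inner product factors into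
⟨0, 0⟩. -/
lemma integral_inner_disjoint_pairs (hZ : MemLp Z 2 (μ.prod μ)) (h0 : ∫ p, Z p ∂μ.prod μ = 0)
    {a b c d : ι} (hab : a ≠ b) (hcd : c ≠ d) (hac : a ≠ c)
    (had : a ≠ d) (hbc : b ≠ c) (hbd : b ≠ d) :
    ∫ u : ι → α, inner ℝ (Z (u a, u b)) (Z (u c, u d)) ∂(Measure.pi fun _ => μ) = 0 := by
  have hmp := measurePreserving_two_pairs (μ := μ) hab hcd hac had hbc hbd
  have h1 : MemLp (fun p : (α × α) × (α × α) => Z p.1) 2 ((μ.prod μ).prod (μ.prod μ)) :=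
    hZ.comp_measurePreserving measurePreserving_fst
  have h2 : MemLp (fun p : (α × α) × (α × α) => Z p.2) 2 ((μ.prod μ).prod (μ.prod μ)) :=
    hZ.comp_measurePreserving measurePreserving_snd
  have hi := integrable_inner_of_memLp h1 h2
  have e := integral_map (μ := Measure.pi fun _ : ι => μ) hmp.measurable.aemeasurable
    (f := fun p : (α × α) × (α × α) => inner ℝ (Z p.1) (Z p.2))
    (by rw [hmp.map_eq]; exact hi.1)
  rw [← e, hmp.map_eq, integral_prod _ hi]
  simp_rw [integral_inner (hZ.integrable one_le_two), h0, inner_zero_right, integral_zero]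

/-- The crude bound, by ⟨x,y⟩ ≤ (‖x‖²+‖y‖²)/2, reserved for the few pairs that share an index. -/
lemma integral_inner_pairs_le (hZ : MemLp Z 2 (μ.prod μ)) {a b c d : ι} (hab : a ≠ b)
    (hcd : c ≠ d) :
    ∫ u : ι → α, inner ℝ (Z (u a, u b)) (Z (u c, u d)) ∂(Measure.pi fun _ => μ)
      ≤ ∫ p, ‖Z p‖ ^ 2 ∂μ.prod μ := by
  have h1 := hZ.comp_measurePreserving (measurePreserving_pair (μ := μ) hab)
  have h2 := hZ.comp_measurePreserving (measurePreserving_pair (μ := μ) hcd)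
  have e : ∀ {a b : ι}, a ≠ b → ∫ u : ι → α, ‖Z (u a, u b)‖ ^ 2 ∂(Measure.pi fun _ => μ)
      = ∫ p, ‖Z p‖ ^ 2 ∂μ.prod μ := by
    intro a b hab
    have hmp := measurePreserving_pair (μ := μ) hab
    have := integral_map (μ := Measure.pi fun _ : ι => μ) hmp.measurable.aemeasurable
      (f := fun p : α × α => ‖Z p‖ ^ 2) (by rw [hmp.map_eq]; exact hZ.norm.integrable_sq.1)
    rw [← this, hmp.map_eq]
  have hle : ∀ u : ι → α, inner ℝ (Z (u a, u b)) (Z (u c, u d)) ≤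
      (1 / 2) * ‖Z (u a, u b)‖ ^ 2 + (1 / 2) * ‖Z (u c, u d)‖ ^ 2 := by
    intro u
    have := real_inner_le_norm (Z (u a, u b)) (Z (u c, u d))
    nlinarith [sq_nonneg (‖Z (u a, u b)‖ - ‖Z (u c, u d)‖)]
  have i1 := h1.norm.integrable_sq.const_mul (1 / 2)
  have i2 := h2.norm.integrable_sq.const_mul (1 / 2)
  have hm := integral_mono (integrable_inner_of_memLp h1 h2) (i1.add i2) hle
  have s := integral_add i1 i2
  simp only [Pi.add_apply, Function.comp_def] at hm s
  rw [s, integral_const_mul, integral_const_mul, e hab, e hcd] at hm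
  linarith

/-- The number of pairs that share an index with a given pair. -/
lemma card_filter_meets_le [DecidableEq ι] (A : Finset (ι × ι)) (a b : ι) :
    (A.filter fun e => a = e.1 ∨ a = e.2 ∨ b = e.1 ∨ b = e.2).card ≤ 4 * Fintype.card ι := by
  -- A pair that meets {a, b} lies in one of two rows or two columns, each with |ι| entries.
  have hsub : (A.filter fun e => a = e.1 ∨ a = e.2 ∨ b = e.1 ∨ b = e.2) ⊆
      ({a} ×ˢ Finset.univ ∪ Finset.univ ×ˢ {a}) ∪ ({b} ×ˢ Finset.univ ∪ Finset.univ ×ˢ {b}) := by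
    intro e he
    simp only [Finset.mem_filter] at he
    simp only [Finset.mem_union, Finset.mem_product, Finset.mem_singleton, Finset.mem_univ,
      and_true, true_and]
    grind
  refine (Finset.card_le_card hsub).trans ?_
  refine (Finset.card_union_le _ _).trans ?_
  have h1 := Finset.card_union_le (({a} : Finset ι) ×ˢ (Finset.univ : Finset ι))
    (Finset.univ ×ˢ {a})
  have h2 := Finset.card_union_le (({b} : Finset ι) ×ˢ (Finset.univ : Finset ι))
    (Finset.univ ×ˢ {b})
  simp only [Finset.card_product, Finset.card_singleton, Finset.card_univ, one_mul, mul_one]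
    at h1 h2
  omega

/-- The second moment of a sum of a centred kernel over pairs of independent samples. -/
lemma integral_norm_sq_sum_pairs_le (hZ : MemLp Z 2 (μ.prod μ)) (h0 : ∫ p, Z p ∂μ.prod μ = 0)
    (A : Finset (ι × ι)) (hA : ∀ e ∈ A, e.1 ≠ e.2) :
    ∫ u : ι → α, ‖∑ e ∈ A, Z (u e.1, u e.2)‖ ^ 2 ∂(Measure.pi fun _ => μ)
      ≤ A.card * (4 * Fintype.card ι) * ∫ p, ‖Z p‖ ^ 2 ∂μ.prod μ := by
  classical
  set v := ∫ p, ‖Z p‖ ^ 2 ∂μ.prod μ with hv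
  have hv0 : 0 ≤ v := integral_nonneg fun _ => sq_nonneg _
  have hL : ∀ e ∈ A, MemLp (fun u : ι → α => Z (u e.1, u e.2)) 2 (Measure.pi fun _ => μ) :=
    fun e he => hZ.comp_measurePreserving (measurePreserving_pair (μ := μ) (hA e he))
  have hexp : ∀ u : ι → α, ‖∑ e ∈ A, Z (u e.1, u e.2)‖ ^ 2 =
      ∑ e ∈ A, ∑ e' ∈ A, inner ℝ (Z (u e.1, u e.2)) (Z (u e'.1, u e'.2)) := by
    intro u
    rw [← real_inner_self_eq_norm_sq, sum_inner]
    simp_rw [inner_sum]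
  simp_rw [hexp]
  rw [integral_finsetSum _ fun e he => integrable_finsetSum _ fun e' he' =>
    integrable_inner_of_memLp (hL e he) (hL e' he')]
  have hrow : ∀ e ∈ A, ∫ u : ι → α, ∑ e' ∈ A, inner ℝ (Z (u e.1, u e.2)) (Z (u e'.1, u e'.2))
      ∂(Measure.pi fun _ => μ) ≤ 4 * Fintype.card ι * v := by
    intro e he
    rw [integral_finsetSum _ fun e' he' => integrable_inner_of_memLp (hL e he) (hL e' he')]
    -- In a row of the covariance matrix only the pairs that meet e contribute.
    calc _ ≤ ∑ e' ∈ A, if (e.1 = e'.1 ∨ e.1 = e'.2 ∨ e.2 = e'.1 ∨ e.2 = e'.2) then v else 0 := by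
          refine Finset.sum_le_sum fun e' he' => ?_
          split_ifs with h
          · exact integral_inner_pairs_le hZ (hA e he) (hA e' he')
          · push Not at h
            exact (integral_inner_disjoint_pairs hZ h0 (hA e he) (hA e' he') h.1 h.2.1 h.2.2.1
              h.2.2.2).le
      _ = (A.filter fun e' => e.1 = e'.1 ∨ e.1 = e'.2 ∨ e.2 = e'.1 ∨ e.2 = e'.2).card * v := by
          rw [← Finset.sum_filter, Finset.sum_const, nsmul_eq_mul]
      _ ≤ _ := by
          gcongr
          exact_mod_cast card_filter_meets_le A e.1 e.2
  calc _ ≤ ∑ e ∈ A, 4 * Fintype.card ι * v := Finset.sum_le_sum hrow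
    _ = _ := by rw [Finset.sum_const, nsmul_eq_mul]; ring

/-- A normalized sum of a square integrable kernel over pairs of independent samples: its mean and
a bound for its variance. -/
theorem pairStatistic_mean_variance {Y : α × α → E} (hY : MemLp Y 2 (μ.prod μ))
    {A : Finset (ι × ι)} (hA : ∀ e ∈ A, e.1 ≠ e.2) {w : ℝ} (hw : w * A.card = 1) {V : ℝ}
    (hV : ∫ p, ‖Y p‖ ^ 2 ∂μ.prod μ ≤ V) :
    Integrable (fun u : ι → α => w • ∑ e ∈ A, Y (u e.1, u e.2)) (Measure.pi fun _ => μ) ∧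
    ∫ u : ι → α, w • ∑ e ∈ A, Y (u e.1, u e.2) ∂(Measure.pi fun _ => μ) = ∫ p, Y p ∂μ.prod μ ∧
    ∫⁻ u : ι → α, ‖w • ∑ e ∈ A, Y (u e.1, u e.2)
        - ∫ u' : ι → α, w • ∑ e ∈ A, Y (u' e.1, u' e.2) ∂(Measure.pi fun _ => μ)‖ₑ ^ 2
        ∂(Measure.pi fun _ => μ) ≤ ENNReal.ofReal (w * (4 * Fintype.card ι) * V) := by
  have hw0 : 0 ≤ w := by
    by_contra! h
    have : w * A.card ≤ 0 := mul_nonpos_of_nonpos_of_nonneg h.le (by positivity)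
    linarith
  have hL : ∀ e ∈ A, MemLp (fun u : ι → α => Y (u e.1, u e.2)) 2 (Measure.pi fun _ => μ) :=
    fun e he => hY.comp_measurePreserving (measurePreserving_pair (μ := μ) (hA e he))
  have hint : ∀ e ∈ A, Integrable (fun u : ι → α => Y (u e.1, u e.2)) (Measure.pi fun _ => μ) :=
    fun e he => (hL e he).integrable one_le_two
  have hmean : ∀ e ∈ A, ∫ u : ι → α, Y (u e.1, u e.2) ∂(Measure.pi fun _ => μ)
      = ∫ p, Y p ∂μ.prod μ := by
    intro e he
    have hmp := measurePreserving_pair (μ := μ) (hA e he)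
    have := integral_map (μ := Measure.pi fun _ : ι => μ) hmp.measurable.aemeasurable
      (f := Y) (by rw [hmp.map_eq]; exact hY.1)
    rw [← this, hmp.map_eq]
  set m := ∫ p, Y p ∂μ.prod μ with hm
  have htot : ∫ u : ι → α, w • ∑ e ∈ A, Y (u e.1, u e.2) ∂(Measure.pi fun _ => μ) = m := by
    rw [integral_smul, integral_finsetSum _ hint, Finset.sum_congr rfl hmean, Finset.sum_const,
      ← Nat.cast_smul_eq_nsmul ℝ, smul_smul, hw, one_smul]
  refine ⟨(integrable_finsetSum _ hint).smul w, htot, ?_⟩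
  rw [htot]
  set Z : α × α → E := fun p => Y p - m with hZdef
  have hZ : MemLp Z 2 (μ.prod μ) := hY.sub (memLp_const m)
  have h0 : ∫ p, Z p ∂μ.prod μ = 0 := by
    rw [integral_sub (hY.integrable one_le_two) (integrable_const _)]
    simp [hm]
  -- Centring can only lower the second moment: 𝔼‖Y - m‖² = 𝔼‖Y‖² - ‖m‖².
  have hZV : ∫ p, ‖Z p‖ ^ 2 ∂μ.prod μ ≤ V := by
    refine le_trans ?_ hV
    have hexp : ∀ p, ‖Z p‖ ^ 2 = ‖Y p‖ ^ 2 - (2 * inner ℝ m (Y p) - ‖m‖ ^ 2) := by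
      intro p
      rw [hZdef, norm_sub_sq_real, real_inner_comm]
      ring
    simp_rw [hexp]
    have i1 := ((hY.integrable one_le_two).const_inner (𝕜 := ℝ) m).const_mul 2
    have i2 : Integrable (fun p => 2 * inner ℝ m (Y p) - ‖m‖ ^ 2) (μ.prod μ) :=
      i1.sub (integrable_const _)
    rw [integral_sub hY.norm.integrable_sq i2,
      integral_sub i1 (integrable_const _), integral_const_mul,
      integral_inner (hY.integrable one_le_two), ← hm, real_inner_self_eq_norm_sq]
    simp only [integral_const, probReal_univ, smul_eq_mul, one_mul]
    nlinarith [sq_nonneg ‖m‖]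
  have hdiff : ∀ u : ι → α, w • ∑ e ∈ A, Y (u e.1, u e.2) - m
      = w • ∑ e ∈ A, Z (u e.1, u e.2) := by
    intro u
    rw [hZdef, Finset.sum_sub_distrib, smul_sub, Finset.sum_const, ← Nat.cast_smul_eq_nsmul ℝ,
      smul_smul, hw, one_smul]
  simp_rw [hdiff]
  have hS : MemLp (fun u : ι → α => w • ∑ e ∈ A, Z (u e.1, u e.2)) 2 (Measure.pi fun _ => μ) :=
    (memLp_finsetSum _ fun e he =>
      hZ.comp_measurePreserving (measurePreserving_pair (μ := μ) (hA e he))).const_smul w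
  have hconv : ∫⁻ u : ι → α, ‖w • ∑ e ∈ A, Z (u e.1, u e.2)‖ₑ ^ 2 ∂(Measure.pi fun _ => μ)
      = ENNReal.ofReal
        (∫ u : ι → α, ‖w • ∑ e ∈ A, Z (u e.1, u e.2)‖ ^ 2 ∂(Measure.pi fun _ => μ)) := by
    rw [ofReal_integral_eq_lintegral_ofReal hS.norm.integrable_sq (.of_forall fun _ => sq_nonneg _)]
    congr 1 with u
    rw [ENNReal.ofReal_pow (norm_nonneg _), ofReal_norm]
  rw [hconv]
  refine ENNReal.ofReal_le_ofReal ?_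
  simp_rw [norm_smul, mul_pow, integral_const_mul]
  have hmain := integral_norm_sq_sum_pairs_le hZ h0 A hA
  have hv0 : 0 ≤ ∫ p, ‖Z p‖ ^ 2 ∂μ.prod μ := integral_nonneg fun _ => sq_nonneg _
  rw [Real.norm_eq_abs, sq_abs]
  calc _ ≤ w ^ 2 * (A.card * (4 * Fintype.card ι) * ∫ p, ‖Z p‖ ^ 2 ∂μ.prod μ) := by gcongr
    -- One of the two factors w cancels the number of pairs; the other leaves the rate w|ι|.
    _ = (w * A.card) * (w * (4 * Fintype.card ι) * ∫ p, ‖Z p‖ ^ 2 ∂μ.prod μ) := by ring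
    _ ≤ _ := by rw [hw, one_mul]; gcongr

end PairStatistic

/-! ### Fourth moments of the Euclidean and maximum norms of a Gaussian vector. -/

section GaussianMoments

lemma integrable_and_integral_le_of_lintegral {α : Type*} [MeasurableSpace α] {μ : Measure α}
    {f : α → ℝ} {c : ℝ} (hf : AEStronglyMeasurable f μ) (h0 : ∀ a, 0 ≤ f a) (hc : 0 ≤ c)
    (h : ∫⁻ a, ENNReal.ofReal (f a) ∂μ ≤ ENNReal.ofReal c) :
    Integrable f μ ∧ ∫ a, f a ∂μ ≤ c := by
  refine ⟨(lintegral_ofReal_ne_top_iff_integrable hf (.of_forall h0)).1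
    (ne_top_of_le_ne_top ENNReal.ofReal_ne_top h), ?_⟩
  rw [integral_eq_lintegral_of_nonneg_ae (.of_forall h0) hf]
  exact ENNReal.toReal_le_of_le_ofReal hc h

/-- The exact value is √2. This single exponential moment yields both the d² and the log² d bounds
below. -/
lemma lintegral_exp_sq_gaussianReal_le :
    ∫⁻ x, ENNReal.ofReal (Real.exp (x ^ 2 / 4)) ∂gaussianReal 0 1 ≤ ENNReal.ofReal 2 := by
  rw [gaussianReal_of_var_ne_zero _ one_ne_zero,
    lintegral_withDensity_eq_lintegral_mul _ (measurable_gaussianPDF 0 1) (by fun_prop)]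
  have e : ∀ x : ℝ, (gaussianPDF 0 1 * fun x => ENNReal.ofReal (Real.exp (x ^ 2 / 4))) x
      = ENNReal.ofReal ((√(2 * Real.pi))⁻¹ * Real.exp (-(1 / 4) * x ^ 2)) := by
    intro x
    rw [Pi.mul_apply, gaussianPDF, ← ENNReal.ofReal_mul (gaussianPDFReal_nonneg _ _ _),
      gaussianPDFReal, mul_assoc, ← Real.exp_add]
    congr 3
    · simp
    · simp only [sub_zero, NNReal.coe_one]; ring_nf
  simp_rw [e]
  rw [← ofReal_integral_eq_lintegral_ofReal
    ((integrable_exp_neg_mul_sq (by norm_num)).const_mul _) (.of_forall fun x => by positivity),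
    integral_const_mul, integral_gaussian]
  refine ENNReal.ofReal_le_ofReal ?_
  rw [inv_mul_le_iff₀ (by positivity)]
  refine Real.sqrt_le_left (by positivity) |>.2 ?_
  rw [mul_pow, Real.sq_sqrt (by positivity)]
  linarith [Real.pi_pos]

variable {d : ℕ}

lemma map_eval_stdGaussian (i : Fin d) :
    (stdGaussian (Euc d)).map (fun ξ => ξ i) = gaussianReal 0 1 := by
  rw [← map_pi_eq_stdGaussian, Measure.map_map (by fun_prop) (by fun_prop)]
  exact (measurePreserving_eval (fun _ : Fin d => gaussianReal 0 1) i).map_eq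

lemma lintegral_exp_sq_stdGaussian_le (i : Fin d) :
    ∫⁻ ξ : Euc d, ENNReal.ofReal (Real.exp (ξ i ^ 2 / 4)) ∂stdGaussian (Euc d)
      ≤ ENNReal.ofReal 2 := by
  rw [← lintegral_map (f := fun x : ℝ => ENNReal.ofReal (Real.exp (x ^ 2 / 4)))
    (g := fun ξ : Euc d => ξ i) (by fun_prop) (by fun_prop), map_eval_stdGaussian]
  exact lintegral_exp_sq_gaussianReal_le

lemma lintegral_sum_exp_sq_stdGaussian_le :
    ∫⁻ ξ : Euc d, ENNReal.ofReal (∑ i, Real.exp (ξ i ^ 2 / 4)) ∂stdGaussian (Euc d)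
      ≤ ENNReal.ofReal (2 * d) := by
  simp_rw [ENNReal.ofReal_sum_of_nonneg fun i _ => (Real.exp_pos _).le]
  rw [lintegral_finsetSum _ fun i _ => by fun_prop]
  calc _ ≤ ∑ i : Fin d, ENNReal.ofReal 2 :=
        Finset.sum_le_sum fun i _ => lintegral_exp_sq_stdGaussian_le i
    _ = _ := by
        rw [Finset.sum_const, Finset.card_univ, Fintype.card_fin, nsmul_eq_mul, mul_comm,
          ENNReal.ofReal_mul (by norm_num), ENNReal.ofReal_natCast]

lemma sq_le_two_mul_exp {t : ℝ} (ht : 0 ≤ t) : t ^ 2 ≤ 2 * Real.exp t := by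
  have := Real.quadratic_le_exp_of_nonneg ht
  linarith

lemma norm_pow_four_le_sum_exp (ξ : Euc d) :
    ‖ξ‖ ^ 4 ≤ 32 * d * ∑ i, Real.exp (ξ i ^ 2 / 4) := by
  have h1 : ‖ξ‖ ^ 4 = (∑ i, ξ i ^ 2) ^ 2 := by
    rw [show ‖ξ‖ ^ 4 = (‖ξ‖ ^ 2) ^ 2 by ring, EuclideanSpace.real_norm_sq_eq]
  have h2 : (∑ i, ξ i ^ 2) ^ 2 ≤ d * ∑ i, (ξ i ^ 2) ^ 2 := by
    simpa using sq_sum_le_card_mul_sum_sq (s := Finset.univ) (f := fun i => ξ i ^ 2)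
  have h3 : ∑ i, (ξ i ^ 2) ^ 2 ≤ ∑ i, 32 * Real.exp (ξ i ^ 2 / 4) := by
    refine Finset.sum_le_sum fun i _ => ?_
    have := sq_le_two_mul_exp (t := ξ i ^ 2 / 4) (by positivity)
    linarith
  rw [← Finset.mul_sum] at h3
  rw [h1]
  calc _ ≤ _ := h2
    _ ≤ d * (32 * ∑ i, Real.exp (ξ i ^ 2 / 4)) := by gcongr
    _ = _ := by ring

/-- The fourth moment of the maximum norm is controlled by exponential moments of the entries. -/
lemma one_add_supNorm_pow_four_le (hd : 1 ≤ d) (ξ : Euc d) :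
    (1 + ‖WithLp.ofLp ξ‖) ^ 4
      ≤ 8 + 256 * Real.log d ^ 2 + 512 / d * ∑ i, Real.exp (ξ i ^ 2 / 4) := by
  have : Nonempty (Fin d) := ⟨⟨0, hd⟩⟩
  have hd0 : (0 : ℝ) < d := by exact_mod_cast hd
  obtain ⟨i, hi⟩ : ∃ i, ‖WithLp.ofLp ξ‖ = |ξ i| := by
    obtain ⟨i, -, hi⟩ := Finset.exists_max_image Finset.univ (fun i => |ξ i|)
      Finset.univ_nonempty
    refine ⟨i, le_antisymm ?_ (norm_le_pi_norm (WithLp.ofLp ξ) i)⟩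
    exact (pi_norm_le_iff_of_nonneg (abs_nonneg _)).2 fun j => hi j (Finset.mem_univ _)
  set T := ξ i ^ 2 / 4 with hT
  set lam := Real.log d with hlam
  have hlam0 : 0 ≤ lam := Real.log_nonneg (by exact_mod_cast hd)
  have hT0 : 0 ≤ T := by positivity
  have hexp : Real.exp T / d ≤ (∑ j, Real.exp (ξ j ^ 2 / 4)) / d := by
    gcongr
    exact Finset.single_le_sum (f := fun j => Real.exp (ξ j ^ 2 / 4))
      (fun j _ => (Real.exp_pos _).le) (Finset.mem_univ i)
  -- Above the level log d one has (T - log d)² ≤ 2 exp(T - log d) = 2 exp(T)/d. The division by d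
  -- compensates for replacing the maximal entry by a sum over all d entries.
  have hTsq : T ^ 2 ≤ 2 * lam ^ 2 + 4 * (Real.exp T / d) := by
    rcases le_total T lam with h | h
    · have : 0 ≤ Real.exp T / d := by positivity
      nlinarith
    · have h1 := sq_le_two_mul_exp (sub_nonneg.2 h)
      rw [Real.exp_sub, hlam, Real.exp_log hd0] at h1
      nlinarith [sq_nonneg (T - 2 * lam)]
  have h4 : |ξ i| ^ 4 = 16 * T ^ 2 := by
    rw [show |ξ i| ^ 4 = (|ξ i| ^ 2) ^ 2 by ring, sq_abs, hT]; ring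
  have h5 : (1 + |ξ i|) ^ 4 ≤ 8 * (1 + |ξ i| ^ 4) := by
    have := abs_nonneg (ξ i)
    nlinarith [sq_nonneg (|ξ i| - 1), sq_nonneg (|ξ i| ^ 2 - 1),
      mul_nonneg this (sq_nonneg (|ξ i| - 1)), mul_nonneg this (sq_nonneg (|ξ i| ^ 2 - 1))]
  rw [hi]
  have : 512 / d * ∑ i, Real.exp (ξ i ^ 2 / 4) = 512 * ((∑ j, Real.exp (ξ j ^ 2 / 4)) / d) := by
    ring
  rw [this]
  linarith

lemma lintegral_norm_pow_four_stdGaussian_le :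
    ∫⁻ ξ : Euc d, ENNReal.ofReal (‖ξ‖ ^ 4) ∂stdGaussian (Euc d)
      ≤ ENNReal.ofReal (64 * (d : ℝ) ^ 2) := by
  calc _ ≤ ∫⁻ ξ : Euc d, ENNReal.ofReal (32 * d) * ENNReal.ofReal (∑ i, Real.exp (ξ i ^ 2 / 4))
        ∂stdGaussian (Euc d) := by
        refine lintegral_mono fun ξ => ?_
        rw [← ENNReal.ofReal_mul (by positivity)]
        exact ENNReal.ofReal_le_ofReal (norm_pow_four_le_sum_exp ξ)
    _ ≤ ENNReal.ofReal (32 * d) * ENNReal.ofReal (2 * d) := by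
        rw [lintegral_const_mul _ (by fun_prop)]
        gcongr
        exact lintegral_sum_exp_sq_stdGaussian_le
    _ = _ := by
        rw [← ENNReal.ofReal_mul (by positivity)]
        congr 1; ring

lemma measurable_supNorm : Measurable fun ξ : Euc d => ‖WithLp.ofLp ξ‖ :=
  (PiLp.continuous_ofLp 2 _).norm.measurable

/-- The condition d ≥ 2 keeps log d away from 0, so that the additive constants 8 + 1024 are
absorbed into log² d. -/
lemma lintegral_one_add_supNorm_pow_four_le (hd : 2 ≤ d) :
    ∫⁻ ξ : Euc d, ENNReal.ofReal ((1 + ‖WithLp.ofLp ξ‖) ^ 4) ∂stdGaussian (Euc d)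
      ≤ ENNReal.ofReal (2500 * Real.log d ^ 2) := by
  have hd0 : (0 : ℝ) < d := by positivity
  have hlog : 0.69 ≤ Real.log d := by
    have h1 : Real.log 2 ≤ Real.log d := Real.log_le_log (by norm_num) (by exact_mod_cast hd)
    have := Real.log_two_gt_d9
    linarith
  calc _ ≤ ∫⁻ ξ : Euc d, (ENNReal.ofReal (8 + 256 * Real.log d ^ 2) + ENNReal.ofReal (512 / d)
          * ENNReal.ofReal (∑ i, Real.exp (ξ i ^ 2 / 4))) ∂stdGaussian (Euc d) := by
        refine lintegral_mono fun ξ => ?_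
        have h0 : 0 ≤ ∑ i, Real.exp (ξ i ^ 2 / 4) := by positivity
        rw [← ENNReal.ofReal_mul (by positivity), ← ENNReal.ofReal_add (by positivity)
          (by positivity)]
        exact ENNReal.ofReal_le_ofReal (one_add_supNorm_pow_four_le (by omega) ξ)
    _ ≤ ENNReal.ofReal (8 + 256 * Real.log d ^ 2)
          + ENNReal.ofReal (512 / d) * ENNReal.ofReal (2 * d) := by
        rw [lintegral_add_left (by fun_prop), lintegral_const_mul _ (by fun_prop)]
        simp only [lintegral_const, measure_univ, mul_one]
        gcongr
        exact lintegral_sum_exp_sq_stdGaussian_le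
    _ ≤ _ := by
        rw [← ENNReal.ofReal_mul (by positivity), ← ENNReal.ofReal_add (by positivity)
          (by positivity)]
        refine ENNReal.ofReal_le_ofReal ?_
        have : 512 / (d : ℝ) * (2 * d) = 1024 := by field_simp; norm_num
        rw [this]
        nlinarith

end GaussianMoments

/-! ### Densities of diagonal affine images of a Gaussian. -/

section AffineGaussian

variable {d : ℕ}

lemma pi_gaussianReal_eq_withDensity (a : Fin d → ℝ) {v : Fin d → NNReal} (hv : ∀ i, v i ≠ 0) :
    Measure.pi (fun i => gaussianReal (a i) (v i))
      = volume.withDensity fun x : Fin d → ℝ =>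
          ENNReal.ofReal (∏ i, gaussianPDFReal (a i) (v i) (x i)) := by
  refine Measure.pi_eq fun s hs => ?_
  rw [withDensity_apply _ (MeasurableSet.univ_pi hs), volume_pi, Measure.restrict_pi_pi,
    ← ofReal_integral_eq_lintegral_ofReal
      (Integrable.fintype_prod fun i => (integrable_gaussianPDFReal (a i) (v i)).restrict)
      (.of_forall fun x => Finset.prod_nonneg fun i _ => gaussianPDFReal_nonneg _ _ _),
    integral_fintype_prod_eq_prod (𝕜 := ℝ),
    ENNReal.ofReal_prod_of_nonneg fun i _ =>
      integral_nonneg fun x => gaussianPDFReal_nonneg _ _ _]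
  exact Finset.prod_congr rfl fun i _ => (gaussianReal_apply_eq_integral _ (hv i) _).symm

/-- A nondegenerate diagonal affine image of the standard Gaussian measure has the product of the
Gaussian densities as its density. -/
lemma map_affine_stdGaussian (a σ : Euc d) (hσ : ∀ i, 0 < σ i) :
    (stdGaussian (Euc d)).map (fun ξ => WithLp.toLp 2 fun i => a i + σ i * ξ i)
      = volume.withDensity fun x : Euc d =>
          ENNReal.ofReal (∏ i, gaussianPDFReal (a i) (σ i ^ 2).toNNReal (x i)) := by
  have hv : ∀ i, (σ i ^ 2).toNNReal ≠ 0 := fun i => by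
    have := hσ i
    simpa using this.ne'
  have hcoord : ∀ i, (gaussianReal 0 1).map (fun x => a i + σ i * x)
      = gaussianReal (a i) (σ i ^ 2).toNNReal := by
    intro i
    have := Measure.map_map (μ := gaussianReal 0 1) (g := fun x => a i + x)
      (f := fun x => σ i * x) (by fun_prop) (by fun_prop)
    rw [Function.comp_def] at this
    rw [← this, gaussianReal_map_const_mul, gaussianReal_map_const_add]
    congr 1
    · simp
    · ext; simp [Real.coe_toNNReal _ (sq_nonneg (σ i))]
  have hpi : (Measure.pi fun _ : Fin d => gaussianReal 0 1).map (fun y i => a i + σ i * y i)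
      = Measure.pi fun i => gaussianReal (a i) (σ i ^ 2).toNNReal := by
    have h1 : ∀ i, SigmaFinite ((gaussianReal 0 1).map (fun x => a i + σ i * x)) := fun i => by
      rw [hcoord i]; infer_instance
    rw [Measure.pi_map_pi (μ := fun _ : Fin d => gaussianReal 0 1)
      (f := fun i x => a i + σ i * x) fun i => by fun_prop]
    simp_rw [hcoord]
  rw [← map_pi_eq_stdGaussian, Measure.map_map (by fun_prop) (by fun_prop)]
  have e : (fun ξ : Euc d => WithLp.toLp 2 fun i => a i + σ i * ξ i) ∘ (WithLp.toLp 2)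
      = (WithLp.toLp 2) ∘ fun (y : Fin d → ℝ) i => a i + σ i * y i := rfl
  rw [e, ← Measure.map_map (by fun_prop) (by fun_prop), hpi, pi_gaussianReal_eq_withDensity _ hv]
  have hmp := PiLp.volume_preserving_toLp (Fin d)
  refine Measure.ext_of_lintegral _ fun f hf => ?_
  have hm : Measurable fun x : Euc d =>
      ENNReal.ofReal (∏ i, gaussianPDFReal (a i) (σ i ^ 2).toNNReal (x i)) :=
    (Finset.measurable_prod _ fun i _ =>
      (measurable_gaussianPDFReal _ _).comp (by fun_prop)).ennreal_ofReal
  have hm' : Measurable fun x : Fin d → ℝ =>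
      ENNReal.ofReal (∏ i, gaussianPDFReal (a i) (σ i ^ 2).toNNReal (x i)) :=
    hm.comp hmp.measurable
  rw [lintegral_map hf (by fun_prop), lintegral_withDensity_eq_lintegral_mul _ hm'
    (g := fun y => f (WithLp.toLp 2 y)) (hf.comp hmp.measurable), lintegral_withDensity_eq_lintegral_mul _ hm hf,
    ← hmp.lintegral_comp (hm.mul hf)]
  rfl

end AffineGaussian

/-! ### The conditional density, the mixture density and the law of the samples. -/

namespace Model

variable {m dz d : ℕ} {S : Model m dz d} {G L : ℝ}

lemma LayerAssumption.std_pos (hA : S.LayerAssumption G L) (z : Euc dz) (φ : Euc m) (i : Fin d) :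
    0 < S.std z φ i :=
  lt_of_lt_of_le (by have := hA.L_pos; positivity) (hA.std_ge z φ i)

lemma LayerAssumption.inv_std_le (hA : S.LayerAssumption G L) (z : Euc dz) (φ : Euc m)
    (i : Fin d) : (S.std z φ i)⁻¹ ≤ √L := by
  have h := hA.std_ge z φ i
  have hL : 0 < √L := Real.sqrt_pos.2 hA.L_pos
  rw [inv_le_comm₀ (hA.std_pos z φ i) hL]
  simpa using h

lemma LayerAssumption.measurable_mean (hA : S.LayerAssumption G L) (φ : Euc m) (i : Fin d) :
    Measurable fun z => S.mean z φ i :=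
  (by fun_prop : Measurable fun x : Euc d => x i).comp (hA.mean.measurable φ)

lemma LayerAssumption.measurable_std (hA : S.LayerAssumption G L) (φ : Euc m) (i : Fin d) :
    Measurable fun z => S.std z φ i :=
  (by fun_prop : Measurable fun x : Euc d => x i).comp (hA.std.measurable φ)

lemma LayerAssumption.measurable_reparam (hA : S.LayerAssumption G L) (φ : Euc m) :
    Measurable (S.reparam φ) := by
  refine (WithLp.measurable_toLp 2 _).comp (measurable_pi_lambda _ fun i => ?_)
  exact ((hA.measurable_mean φ i).comp measurable_fst).add
    (((hA.measurable_std φ i).comp measurable_fst).mul (by fun_prop))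

lemma LayerAssumption.measurable_condDensity (hA : S.LayerAssumption G L) (φ : Euc m) :
    Measurable fun p : Euc dz × Euc d => S.condDensity φ p.1 p.2 := by
  refine Finset.measurable_prod _ fun i _ => ?_
  refine measurable_uncurry_gaussianPDFReal.comp
    (((hA.measurable_mean φ i).comp measurable_fst).prodMk
      (Measurable.prodMk ?_ (by fun_prop)))
  exact (((hA.measurable_std φ i).comp measurable_fst).pow_const 2).real_toNNReal

lemma condDensity_nonneg (φ : Euc m) (z : Euc dz) (x : Euc d) : 0 ≤ S.condDensity φ z x :=
  Finset.prod_nonneg fun _ _ => gaussianPDFReal_nonneg _ _ _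

lemma LayerAssumption.condDensity_pos (hA : S.LayerAssumption G L) (φ : Euc m) (z : Euc dz)
    (x : Euc d) : 0 < S.condDensity φ z x := by
  refine Finset.prod_pos fun i _ => gaussianPDFReal_pos _ _ _ ?_
  have := hA.std_pos z φ i
  simpa using this.ne'

/-- The conditional density as the exponential of a quadratic form. -/
lemma condDensity_eq (φ : Euc m) (z : Euc dz) (x : Euc d) :
    S.condDensity φ z x = (∏ i, (√(2 * Real.pi * S.std z φ i ^ 2))⁻¹)
      * Real.exp (∑ i, -(x i - S.mean z φ i) ^ 2 / (2 * S.std z φ i ^ 2)) := by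
  rw [Real.exp_sum, ← Finset.prod_mul_distrib]
  refine Finset.prod_congr rfl fun i _ => ?_
  rw [gaussianPDFReal, Real.coe_toNNReal _ (sq_nonneg _)]

/-- Each factor is at most 1/σ ≤ √L because 2π ≥ 1. The lower bound on σ is thus what makes the
density bounded uniformly in z and x. -/
lemma LayerAssumption.normalizer_le (hA : S.LayerAssumption G L) (φ : Euc m) (z : Euc dz) :
    ∏ i, (√(2 * Real.pi * S.std z φ i ^ 2))⁻¹ ≤ √L ^ d := by
  calc _ ≤ ∏ _i : Fin d, √L := by
        refine Finset.prod_le_prod (fun i _ => by positivity) fun i _ => ?_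
        refine le_trans ?_ (hA.inv_std_le z φ i)
        have h := hA.std_pos z φ i
        refine inv_anti₀ h (Real.le_sqrt_of_sq_le ?_)
        nlinarith [Real.pi_gt_three, sq_nonneg (S.std z φ i)]
    _ = _ := by simp

lemma LayerAssumption.condDensity_le (hA : S.LayerAssumption G L) (φ : Euc m) (z : Euc dz)
    (x : Euc d) : S.condDensity φ z x ≤ √L ^ d := by
  rw [condDensity_eq]
  refine (mul_le_of_le_one_right (Finset.prod_nonneg fun i _ => by positivity) ?_).trans
    (hA.normalizer_le φ z)
  refine Real.exp_le_one_iff.2 (Finset.sum_nonpos fun i _ => ?_)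
  rw [neg_div]
  exact neg_nonpos.2 (by positivity)

/-- The score of the conditional layer. -/
def condScore (S : Model m dz d) (φ : Euc m) (z : Euc dz) (x : Euc d) : Euc d :=
  WithLp.toLp 2 fun i => -((x i - S.mean z φ i) / S.std z φ i ^ 2)

lemma hasGradientAt_condDensity (φ : Euc m) (z : Euc dz) (x : Euc d) :
    HasGradientAt (S.condDensity φ z) (S.condDensity φ z x • S.condScore φ z x) x := by
  have hi : ∀ i : Fin d, HasFDerivAt (fun y : Euc d => y i)
      (EuclideanSpace.proj i : Euc d →L[ℝ] ℝ) x := fun i =>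
    (EuclideanSpace.proj i : Euc d →L[ℝ] ℝ).hasFDerivAt
  have hq : ∀ i : Fin d, HasFDerivAt
      (fun y : Euc d => -(y i - S.mean z φ i) ^ 2 / (2 * S.std z φ i ^ 2))
      ((-((x i - S.mean z φ i) / S.std z φ i ^ 2)) • (EuclideanSpace.proj i : Euc d →L[ℝ] ℝ)) x := by
    intro i
    have h := (((hi i).sub_const (S.mean z φ i)).pow 2).const_mul (-(2 * S.std z φ i ^ 2)⁻¹)
    refine (h.congr_of_eventuallyEq (.of_forall fun y => ?_)).congr_fderiv ?_
    · ring
    · ext v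
      simp only [FunLike.coe_smul, Pi.smul_apply, smul_eq_mul, nsmul_eq_mul, mul_inv]
      push_cast
      ring
  have hs := ((HasFDerivAt.fun_sum (u := Finset.univ) fun i _ => hq i).exp).const_mul
    (∏ i, (√(2 * Real.pi * S.std z φ i ^ 2))⁻¹)
  rw [hasGradientAt_iff_hasFDerivAt]
  refine (hs.congr_of_eventuallyEq (.of_forall fun y => condDensity_eq φ z y)).congr_fderiv ?_
  ext v
  rw [condDensity_eq, InnerProductSpace.toDual_apply_apply, inner_smul_left, condScore]
  simp only [FunLike.coe_smul, Pi.smul_apply, smul_eq_mul, FunLike.coe_sum, Finset.sum_apply,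
    PiLp.inner_apply, PiLp.proj_apply]
  have e : ∀ i, inner ℝ (-((x i - S.mean z φ i) / S.std z φ i ^ 2)) (v i)
      = -((x i - S.mean z φ i) / S.std z φ i ^ 2) * v i := fun i => by
    simp [mul_comm]
  simp only [e, conj_trivial]
  ring

lemma LayerAssumption.norm_condScore_le (hA : S.LayerAssumption G L) (φ : Euc m) (z : Euc dz)
    (x : Euc d) :
    ‖S.condScore φ z x‖ ≤ √L * √(∑ i, ((x i - S.mean z φ i) / S.std z φ i) ^ 2) := by
  rw [EuclideanSpace.norm_eq, ← Real.sqrt_mul hA.L_pos.le, Finset.mul_sum]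
  refine Real.sqrt_le_sqrt (Finset.sum_le_sum fun i _ => ?_)
  have h := hA.std_pos z φ i
  have e : ‖(S.condScore φ z x) i‖ ^ 2
      = (S.std z φ i)⁻¹ ^ 2 * ((x i - S.mean z φ i) / S.std z φ i) ^ 2 := by
    rw [Real.norm_eq_abs, sq_abs, condScore]
    field_simp
  rw [e]
  gcongr
  calc (S.std z φ i)⁻¹ ^ 2 ≤ √L ^ 2 := by
        gcongr
        exact hA.inv_std_le z φ i
    _ = L := Real.sq_sqrt hA.L_pos.le

/-- In terms of the standardized distance t the score is at most √L t and the density decays like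
exp(-t²/2), and t exp(-t²/2) ≤ 1. -/
lemma LayerAssumption.norm_gradient_condDensity_le (hA : S.LayerAssumption G L) (φ : Euc m)
    (z : Euc dz) (x : Euc d) :
    ‖S.condDensity φ z x • S.condScore φ z x‖ ≤ √L ^ d * √L := by
  set t := √(∑ i, ((x i - S.mean z φ i) / S.std z φ i) ^ 2) with ht
  have ht0 : 0 ≤ t := Real.sqrt_nonneg _
  have hexp : ∑ i, -(x i - S.mean z φ i) ^ 2 / (2 * S.std z φ i ^ 2) = -(t ^ 2 / 2) := by
    rw [ht, Real.sq_sqrt (by positivity), Finset.sum_div, ← Finset.sum_neg_distrib]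
    refine Finset.sum_congr rfl fun i _ => ?_
    have h := hA.std_pos z φ i
    field_simp
  have hte : Real.exp (-(t ^ 2 / 2)) * t ≤ 1 := by
    rw [Real.exp_neg, inv_mul_le_iff₀ (Real.exp_pos _), mul_one]
    have := Real.add_one_le_exp (t ^ 2 / 2)
    nlinarith [sq_nonneg (t - 1)]
  have hL : 0 ≤ √L := Real.sqrt_nonneg _
  rw [norm_smul, Real.norm_of_nonneg (condDensity_nonneg _ _ _), condDensity_eq, hexp]
  calc _ ≤ √L ^ d * Real.exp (-(t ^ 2 / 2)) * (√L * t) := by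
        gcongr
        · exact hA.normalizer_le φ z
        · exact hA.norm_condScore_le φ z x
    _ = √L ^ d * √L * (Real.exp (-(t ^ 2 / 2)) * t) := by ring
    _ ≤ √L ^ d * √L * 1 := by gcongr
    _ = _ := mul_one _

lemma LayerAssumption.measurable_condScore (hA : S.LayerAssumption G L) (φ : Euc m) :
    Measurable fun p : Euc dz × Euc d => S.condScore φ p.1 p.2 := by
  refine (WithLp.measurable_toLp 2 _).comp (measurable_pi_lambda _ fun i => ?_)
  exact (((by fun_prop : Measurable fun p : Euc dz × Euc d => p.2 i).sub
    ((hA.measurable_mean φ i).comp measurable_fst)).div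
      (((hA.measurable_std φ i).comp measurable_fst).pow_const 2)).neg

/-! ### The law of the samples -/

section Law

variable [IsProbabilityMeasure S.mix]

instance : IsProbabilityMeasure S.noise := by
  unfold noise
  infer_instance

/-- The joint law of the latent variable and the sample. -/
lemma LayerAssumption.map_noise (hA : S.LayerAssumption G L) (φ : Euc m) :
    S.noise.map (fun u => (u.1, S.reparam φ u))
      = (S.mix.prod volume).withDensity fun p => ENNReal.ofReal (S.condDensity φ p.1 p.2) := by
  have hm : Measurable fun u => (u.1, S.reparam φ u) :=
    measurable_fst.prodMk (hA.measurable_reparam φ)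
  have hd := (hA.measurable_condDensity φ).ennreal_ofReal
  refine Measure.ext_of_lintegral _ fun f hf => ?_
  have hfm : Measurable fun u => f (u.1, S.reparam φ u) := hf.comp hm
  have hdf : Measurable fun p : Euc dz × Euc d =>
      ENNReal.ofReal (S.condDensity φ p.1 p.2) * f p := hd.mul hf
  have e1 : ∫⁻ p, f p ∂(S.mix.prod volume).withDensity
      (fun p => ENNReal.ofReal (S.condDensity φ p.1 p.2))
      = ∫⁻ p, ENNReal.ofReal (S.condDensity φ p.1 p.2) * f p ∂S.mix.prod volume :=
    lintegral_withDensity_eq_lintegral_mul _ hd hf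
  have e2 := lintegral_prod _ hdf.aemeasurable (μ := S.mix) (ν := volume)
  have e3 := lintegral_prod _ hfm.aemeasurable (μ := S.mix) (ν := stdGaussian (Euc d))
  rw [lintegral_map hf hm, e1, noise, e2, e3]
  refine lintegral_congr fun z => ?_
  have hz := map_affine_stdGaussian (S.mean z φ) (S.std z φ) (hA.std_pos z φ)
  have hfz : Measurable fun x => f (z, x) := hf.comp measurable_prodMk_left
  have hdz : Measurable fun x => ENNReal.ofReal (S.condDensity φ z x) :=
    ((hA.measurable_condDensity φ).comp (measurable_prodMk_left (x := z))).ennreal_ofReal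
  have h1 : Measurable fun ξ : Euc d =>
      (WithLp.toLp 2 fun i => S.mean z φ i + S.std z φ i * ξ i : Euc d) :=
    (hA.measurable_reparam φ).comp measurable_prodMk_left
  have e4 : ∫⁻ ξ, f (z, WithLp.toLp 2 fun i => S.mean z φ i + S.std z φ i * ξ i)
      ∂stdGaussian (Euc d) = ∫⁻ x, f (z, x) ∂((stdGaussian (Euc d)).map
          (fun ξ => WithLp.toLp 2 fun i => S.mean z φ i + S.std z φ i * ξ i)) :=
    (lintegral_map hfz h1).symm
  refine e4.trans ?_
  rw [hz]
  exact lintegral_withDensity_eq_lintegral_mul _ hdz hfz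

lemma LayerAssumption.integrable_condDensity (hA : S.LayerAssumption G L) (φ : Euc m)
    (x : Euc d) : Integrable (fun z => S.condDensity φ z x) S.mix := by
  refine Integrable.of_bound
    ((hA.measurable_condDensity φ).comp measurable_prodMk_right).aestronglyMeasurable (√L ^ d)
    (.of_forall fun z => ?_)
  rw [Real.norm_of_nonneg (condDensity_nonneg _ _ _)]
  exact hA.condDensity_le φ z x

lemma LayerAssumption.measurable_varDensity (hA : S.LayerAssumption G L) (φ : Euc m) :
    Measurable (S.varDensity φ) :=
  ((hA.measurable_condDensity φ).stronglyMeasurable.integral_prod_left'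
    (μ := S.mix)).measurable

lemma LayerAssumption.varDensity_pos (hA : S.LayerAssumption G L) (φ : Euc m) (x : Euc d) :
    0 < S.varDensity φ x := by
  refine (integral_pos_iff_support_of_nonneg (fun z => condDensity_nonneg φ z x)
    (hA.integrable_condDensity φ x)).2 ?_
  have : Function.support (fun z => S.condDensity φ z x) = Set.univ :=
    Set.eq_univ_of_forall fun z => (hA.condDensity_pos φ z x).ne'
  rw [this]
  simp

/-- The law of the sample has density `varDensity`. -/
lemma LayerAssumption.map_reparam_noise (hA : S.LayerAssumption G L) (φ : Euc m) :
    S.noise.map (S.reparam φ) = densMeasure (S.varDensity φ) := by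
  have hm : Measurable fun u => (u.1, S.reparam φ u) :=
    measurable_fst.prodMk (hA.measurable_reparam φ)
  have hd := (hA.measurable_condDensity φ).ennreal_ofReal
  have e : S.noise.map (S.reparam φ)
      = (S.noise.map (fun u => (u.1, S.reparam φ u))).map Prod.snd := by
    rw [Measure.map_map measurable_snd hm]
    rfl
  rw [e, hA.map_noise φ, densMeasure]
  refine Measure.ext_of_lintegral _ fun f hf => ?_
  have hf2 : Measurable fun p : Euc dz × Euc d => f p.2 := hf.comp measurable_snd
  have hdf : Measurable fun p : Euc dz × Euc d =>
      ENNReal.ofReal (S.condDensity φ p.1 p.2) * f p.2 := hd.mul hf2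
  have e1 : ∫⁻ p, f p.2 ∂(S.mix.prod volume).withDensity
      (fun p => ENNReal.ofReal (S.condDensity φ p.1 p.2))
      = ∫⁻ p, ENNReal.ofReal (S.condDensity φ p.1 p.2) * f p.2 ∂S.mix.prod volume :=
    lintegral_withDensity_eq_lintegral_mul _ hd hf2
  have e2 := lintegral_prod_symm _ hdf.aemeasurable (μ := S.mix) (ν := volume)
  have e3 : ∫⁻ x, f x ∂volume.withDensity (fun x => ENNReal.ofReal (S.varDensity φ x))
      = ∫⁻ x, ENNReal.ofReal (S.varDensity φ x) * f x :=
    lintegral_withDensity_eq_lintegral_mul _ (hA.measurable_varDensity φ).ennreal_ofReal hf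
  rw [lintegral_map hf measurable_snd, e1, e2, e3]
  refine lintegral_congr fun x => ?_
  have hdx : Measurable fun z => ENNReal.ofReal (S.condDensity φ z x) :=
    ((hA.measurable_condDensity φ).comp (measurable_prodMk_right (y := x))).ennreal_ofReal
  dsimp only
  rw [lintegral_mul_const _ hdx, varDensity,
    ofReal_integral_eq_lintegral_ofReal (hA.integrable_condDensity φ x)
      (.of_forall fun z => condDensity_nonneg φ z x)]

lemma LayerAssumption.integrable_gradient_condDensity (hA : S.LayerAssumption G L) (φ : Euc m)
    (x : Euc d) : Integrable (fun z => S.condDensity φ z x • S.condScore φ z x) S.mix :=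
  Integrable.of_bound (((hA.measurable_condDensity φ).smul
      (hA.measurable_condScore φ)).comp measurable_prodMk_right).aestronglyMeasurable (√L ^ d * √L)
    (.of_forall fun z => hA.norm_gradient_condDensity_le φ z x)

/-- The gradient bound for the layer is uniform in z and x, so a constant dominates over the whole
space. -/
lemma LayerAssumption.hasGradientAt_varDensity (hA : S.LayerAssumption G L) (φ : Euc m)
    (x : Euc d) :
    HasGradientAt (S.varDensity φ)
      (∫ z, S.condDensity φ z x • S.condScore φ z x ∂S.mix) x := by
  rw [hasGradientAt_iff_hasFDerivAt]
  have h := hasFDerivAt_integral_of_dominated_of_fderiv_le (𝕜 := ℝ) (μ := S.mix)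
    (F := fun x z => S.condDensity φ z x)
    (F' := fun x z => InnerProductSpace.toDual ℝ (Euc d)
      (S.condDensity φ z x • S.condScore φ z x)) (x₀ := x) (s := Set.univ)
    (bound := fun _ => √L ^ d * √L) Filter.univ_mem
    (.of_forall fun x => (hA.integrable_condDensity φ x).1) (hA.integrable_condDensity φ x)
    ((InnerProductSpace.toDual ℝ (Euc d)).continuous.comp_aestronglyMeasurable
      (hA.integrable_gradient_condDensity φ x).1)
    (.of_forall fun z y _ => by
      rw [LinearIsometryEquiv.norm_map]
      exact hA.norm_gradient_condDensity_le φ z y)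
    (integrable_const _)
    (.of_forall fun z y _ => (hasGradientAt_condDensity φ z y).hasFDerivAt)
  refine h.congr_fderiv ?_
  exact ((InnerProductSpace.toDual ℝ (Euc d)).toContinuousLinearEquiv.toContinuousLinearMap
    |>.integral_comp_comm (hA.integrable_gradient_condDensity φ x))

end Law

end Model

/-! ### The feature map of the kernel. -/

section Kernel

lemma integrable_smul_of_norm_le {α E : Type*} [MeasurableSpace α] {μ : Measure α}
    [NormedAddCommGroup E] [NormedSpace ℝ E] {a : α → ℝ} {g : α → E} {c : ℝ} (ha : Integrable a μ)
    (hg : AEStronglyMeasurable g μ) (hc : ∀ x, ‖g x‖ ≤ c) : Integrable (fun x => a x • g x) μ := by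
  refine Integrable.mono' (ha.norm.const_mul c) (ha.1.smul hg) (.of_forall fun x => ?_)
  rw [norm_smul, mul_comm]
  exact mul_le_mul_of_nonneg_right (hc x) (norm_nonneg _)

variable {d : ℕ} {H₀ : Type v} [NormedAddCommGroup H₀] [InnerProductSpace ℝ H₀]
  [CompleteSpace H₀] [RKHS ℝ H₀ (Euc d) ℝ] {k : Euc d → Euc d → ℝ}

lemma IsRKHSOf.inner_kerFun (hk : IsRKHSOf H₀ k) (x y : Euc d) :
    inner ℝ (RKHS.kerFun H₀ x (1 : ℝ)) (RKHS.kerFun H₀ y 1) = k x y := by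
  rw [real_inner_comm, ← RKHS.kernel_inner, hk x y]
  simp

lemma IsRKHSOf.symm (hk : IsRKHSOf H₀ k) (x y : Euc d) : k x y = k y x := by
  rw [← hk.inner_kerFun, real_inner_comm, hk.inner_kerFun]

lemma IsRKHSOf.norm_kerFun_le (hk : IsRKHSOf H₀ k) {B : ℝ} (hB : 0 ≤ B)
    (hle : ∀ x y, k x y ≤ B ^ 2) (x : Euc d) : ‖RKHS.kerFun H₀ x (1 : ℝ)‖ ≤ B := by
  refine le_of_sq_le_sq ?_ hB |>.trans le_rfl
  rw [← real_inner_self_eq_norm_sq, hk.inner_kerFun]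
  exact hle x x

/-- Only an upper bound on k is assumed; Cauchy-Schwarz for the feature map makes it two-sided. -/
lemma IsRKHSOf.abs_le (hk : IsRKHSOf H₀ k) {B : ℝ} (hB : 0 ≤ B)
    (hle : ∀ x y, k x y ≤ B ^ 2) (x y : Euc d) : |k x y| ≤ B ^ 2 := by
  rw [← hk.inner_kerFun, sq]
  exact (abs_real_inner_le_norm _ _).trans (mul_le_mul (hk.norm_kerFun_le hB hle x)
    (hk.norm_kerFun_le hB hle y) (norm_nonneg _) hB)

/-- The squared distance of two features is k(y,y) - 2k(y,x) + k(x,x). Continuity supplies the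
measurability needed for integrals in `H₀`. -/
lemma IsRKHSOf.continuous_kerFun (hk : IsRKHSOf H₀ k)
    (hc : Continuous fun xy : Euc d × Euc d => k xy.1 xy.2) :
    Continuous fun x : Euc d => RKHS.kerFun H₀ x (1 : ℝ) := by
  rw [continuous_iff_continuousAt]
  intro x
  rw [ContinuousAt, tendsto_iff_norm_sub_tendsto_zero]
  have hsq : ∀ y : Euc d, ‖RKHS.kerFun H₀ y (1 : ℝ) - RKHS.kerFun H₀ x 1‖
      = √(k y y - 2 * k y x + k x x) := by
    intro y
    rw [← Real.sqrt_sq (norm_nonneg _), norm_sub_sq_real, ← real_inner_self_eq_norm_sq,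
      ← real_inner_self_eq_norm_sq, hk.inner_kerFun, hk.inner_kerFun, hk.inner_kerFun]
  simp_rw [hsq]
  have h1 : Continuous fun y : Euc d => k y y := hc.comp (continuous_id.prodMk continuous_id)
  have h2 : Continuous fun y : Euc d => k y x := hc.comp (continuous_id.prodMk continuous_const)
  have h3 : Continuous fun y : Euc d => √(k y y - 2 * k y x + k x x) := by fun_prop
  have := h3.tendsto x
  simpa [show k x x - 2 * k x x + k x x = 0 by ring] using this

end Kernel

/-! ### The loss as an expectation over two independent samples. -/

namespace Model

variable {m dz d : ℕ} {S : Model m dz d} {B G L M : ℝ}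

lemma TargetAssumption.continuous_score (hT : S.TargetAssumption L M) : Continuous S.score := by
  have h1 : ContDiff ℝ 1 fun x => Real.log (S.p x) := hT.contDiff.of_le (by norm_num)
  exact (InnerProductSpace.toDual ℝ (Euc d)).symm.continuous.comp
    (h1.continuous_fderiv one_ne_zero)

lemma LayerAssumption.measurable_scoreDiff (hA : S.LayerAssumption G L)
    (hT : S.TargetAssumption L M) (φ : Euc m) : Measurable (S.scoreDiff φ) := by
  refine (hT.continuous_score.measurable.comp (hA.measurable_reparam φ)).add
    ((WithLp.measurable_toLp 2 _).comp (measurable_pi_lambda _ fun i => ?_))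
  exact (by fun_prop : Measurable fun u : Euc dz × Euc d => u.2 i).div
    ((hA.measurable_std φ i).comp measurable_fst)

variable [IsProbabilityMeasure S.mix]

lemma LayerAssumption.gradient_log_div (hA : S.LayerAssumption G L)
    (hT : S.TargetAssumption L M) (φ : Euc m) (y : Euc d) :
    gradient (fun x => Real.log (S.p x / S.varDensity φ x)) y
      = S.score y - (S.varDensity φ y)⁻¹ • ∫ z, S.condDensity φ z y • S.condScore φ z y ∂S.mix := by
  have h1 : HasFDerivAt (fun x => Real.log (S.p x)) (fderiv ℝ (fun x => Real.log (S.p x)) y) y :=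
    ((hT.contDiff.differentiable (by norm_num)) y).hasFDerivAt
  have h2 := (hA.hasGradientAt_varDensity φ y).hasFDerivAt.log (hA.varDensity_pos φ y).ne'
  have h3 : HasGradientAt (fun x => Real.log (S.p x / S.varDensity φ x))
      (S.score y - (S.varDensity φ y)⁻¹ • ∫ z, S.condDensity φ z y • S.condScore φ z y ∂S.mix)
      y := by
    rw [hasGradientAt_iff_hasFDerivAt]
    refine ((h1.sub h2).congr_of_eventuallyEq (.of_forall fun x => ?_)).congr_fderiv ?_
    · exact Real.log_div (hT.pos x).ne' (hA.varDensity_pos φ x).ne'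
    · rw [map_sub, map_smul, score, toDual_gradient]
  exact h3.gradient

variable {H₀ : Type v} [NormedAddCommGroup H₀] [InnerProductSpace ℝ H₀]
  [CompleteSpace H₀] [RKHS ℝ H₀ (Euc d) ℝ]

/-- Integration by parts in the form of the denoising identity: the score of the semi-implicit
density may be replaced by the score of the conditional layer. -/
lemma LayerAssumption.integralOp_eq (hA : S.LayerAssumption G L) (hT : S.TargetAssumption L M)
    (hK : S.KernelAssumption B) (hk : IsRKHSOf H₀ S.k) (φ : Euc m)
    (hf : Integrable (S.scoreDiff φ) S.noise) (i : Fin d) :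
    integralOp H₀ (densMeasure (S.varDensity φ))
        (fun y => gradient (fun x => Real.log (S.p x / S.varDensity φ x)) y i)
      = ∫ u, S.scoreDiff φ u i • RKHS.kerFun H₀ (S.reparam φ u) (1 : ℝ) ∂S.noise := by
  have hKc := hk.continuous_kerFun hK.contDiff.continuous
  have hJ : Measurable fun u => (u.1, S.reparam φ u) :=
    measurable_fst.prodMk (hA.measurable_reparam φ)
  have hcm := hA.measurable_condDensity φ
  -- the integrand as a function of the latent variable and the sample
  set a : Euc dz × Euc d → ℝ := fun p => S.score p.2 i - S.condScore φ p.1 p.2 i with ha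
  have ham : Measurable a :=
    ((by fun_prop : Measurable fun x : Euc d => x i).comp
      (hT.continuous_score.measurable.comp measurable_snd)).sub
    ((by fun_prop : Measurable fun x : Euc d => x i).comp (hA.measurable_condScore φ))
  -- At x = μ + σ ⊙ ξ the conditional score equals -ξ/σ.
  have haJ : ∀ u, a (u.1, S.reparam φ u) = S.scoreDiff φ u i := by
    intro u
    have := (hA.std_pos u.1 φ i).ne'
    simp only [ha, condScore, scoreDiff, reparam, PiLp.add_apply]
    field_simp
    ring
  have hgm : StronglyMeasurable fun p : Euc dz × Euc d => a p • RKHS.kerFun H₀ p.2 (1 : ℝ) :=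
    ham.stronglyMeasurable.smul (hKc.stronglyMeasurable.comp_measurable measurable_snd)
  have hint : Integrable (fun u => S.scoreDiff φ u i •
      RKHS.kerFun H₀ (S.reparam φ u) (1 : ℝ)) S.noise := by
    exact integrable_smul_of_norm_le ((EuclideanSpace.proj i : Euc d →L[ℝ] ℝ).integrable_comp hf)
      (hKc.stronglyMeasurable.comp_measurable (hA.measurable_reparam φ)).aestronglyMeasurable
      fun u => hk.norm_kerFun_le hK.pos.le hK.le _
  have hintJ : Integrable (fun p : Euc dz × Euc d => a p • RKHS.kerFun H₀ p.2 (1 : ℝ))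
      (S.noise.map fun u => (u.1, S.reparam φ u)) := by
    rw [integrable_map_measure hgm.aestronglyMeasurable hJ.aemeasurable]
    refine hint.congr (.of_forall fun u => ?_)
    simp only [Function.comp, haJ]
  have hR : ∫ u, S.scoreDiff φ u i • RKHS.kerFun H₀ (S.reparam φ u) (1 : ℝ) ∂S.noise
      = ∫ p, S.condDensity φ p.1 p.2 • a p • RKHS.kerFun H₀ p.2 (1 : ℝ)
          ∂S.mix.prod volume := by
    have e1 := integral_map (μ := S.noise) hJ.aemeasurable hgm.aestronglyMeasurable
    simp only [haJ] at e1
    rw [← e1, hA.map_noise φ, integral_withDensity_eq_integral_toReal_smul hcm.ennreal_ofReal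
      (.of_forall fun _ => ENNReal.ofReal_lt_top)]
    refine integral_congr_ae (.of_forall fun p => ?_)
    simp only [ENNReal.toReal_ofReal (condDensity_nonneg φ p.1 p.2)]
  have hintP : Integrable (fun p : Euc dz × Euc d =>
      S.condDensity φ p.1 p.2 • a p • RKHS.kerFun H₀ p.2 (1 : ℝ)) (S.mix.prod volume) := by
    rw [hA.map_noise φ, integrable_withDensity_iff_integrable_smul' hcm.ennreal_ofReal
      (.of_forall fun _ => ENNReal.ofReal_lt_top)] at hintJ
    refine hintJ.congr (.of_forall fun p => ?_)
    simp only [ENNReal.toReal_ofReal (condDensity_nonneg φ p.1 p.2)]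
  -- After integrating over z first, the claim holds for each y separately: the weight q_φ(y)
  -- cancels the denominator of ∇log q_φ(y).
  rw [hR, integral_prod_symm _ hintP, integralOp, densMeasure,
    integral_withDensity_eq_integral_toReal_smul (hA.measurable_varDensity φ).ennreal_ofReal
      (.of_forall fun _ => ENNReal.ofReal_lt_top)]
  refine integral_congr_ae (.of_forall fun y => ?_)
  have hq := hA.varDensity_pos φ y
  have hgi := hA.integrable_gradient_condDensity φ y
  have hcoord : (∫ z, S.condDensity φ z y • S.condScore φ z y ∂S.mix) i
      = ∫ z, S.condDensity φ z y * S.condScore φ z y i ∂S.mix :=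
    ((EuclideanSpace.proj i : Euc d →L[ℝ] ℝ).integral_comp_comm hgi).symm
  have hgi' : Integrable (fun z => S.condDensity φ z y * S.condScore φ z y i) S.mix :=
    (EuclideanSpace.proj i : Euc d →L[ℝ] ℝ).integrable_comp hgi
  simp only [ENNReal.toReal_ofReal hq.le]
  rw [hA.gradient_log_div hT φ y, PiLp.sub_apply, PiLp.smul_apply, hcoord, smul_smul, smul_eq_mul,
    mul_sub, mul_inv_cancel_left₀ hq.ne']
  simp_rw [smul_smul]
  rw [integral_smul_const]
  congr 1
  simp only [ha, mul_sub]
  rw [integral_sub ((hA.integrable_condDensity φ y).mul_const _) hgi', integral_mul_const]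
  rfl

/-- The loss is the expectation of `pairLoss` over two independent samples. -/
theorem LayerAssumption.loss_eq (hA : S.LayerAssumption G L) (hT : S.TargetAssumption L M)
    (hK : S.KernelAssumption B) (hk : IsRKHSOf H₀ S.k) (φ : Euc m)
    (hf : Integrable (S.scoreDiff φ) S.noise) :
    S.loss H₀ φ = ∫ p, S.pairLoss φ p.1 p.2 ∂S.noise.prod S.noise := by
  have hKc := hk.continuous_kerFun hK.contDiff.continuous
  have hfi : ∀ i, Integrable (fun u => S.scoreDiff φ u i) S.noise := fun i =>
    (EuclideanSpace.proj i : Euc d →L[ℝ] ℝ).integrable_comp hf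
  have hint : ∀ i, Integrable (fun u => S.scoreDiff φ u i •
      RKHS.kerFun H₀ (S.reparam φ u) (1 : ℝ)) S.noise := by
    intro i
    exact integrable_smul_of_norm_le (hfi i)
      (hKc.stronglyMeasurable.comp_measurable (hA.measurable_reparam φ)).aestronglyMeasurable
      fun u => hk.norm_kerFun_le hK.pos.le hK.le _
  have hkm : Measurable fun p : (Euc dz × Euc d) × (Euc dz × Euc d) =>
      S.k (S.reparam φ p.1) (S.reparam φ p.2) :=
    hK.contDiff.continuous.measurable.comp
      (((hA.measurable_reparam φ).comp measurable_fst).prodMk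
        ((hA.measurable_reparam φ).comp measurable_snd))
  have hprod : ∀ i, Integrable (fun p : (Euc dz × Euc d) × (Euc dz × Euc d) =>
      S.scoreDiff φ p.1 i * S.scoreDiff φ p.2 i * S.k (S.reparam φ p.1) (S.reparam φ p.2))
      (S.noise.prod S.noise) := fun i =>
    ((hfi i).mul_prod (hfi i)).mul_bdd (c := B ^ 2) hkm.aestronglyMeasurable
      (.of_forall fun p => hk.abs_le hK.pos.le hK.le _ _)
  -- The squared norm of a vector-valued integral is the double integral of inner products, and
  -- inner products of features are values of k.
  have hsq : ∀ i, ‖∫ u, S.scoreDiff φ u i • RKHS.kerFun H₀ (S.reparam φ u) (1 : ℝ) ∂S.noise‖ ^ 2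
      = ∫ p, S.scoreDiff φ p.1 i * S.scoreDiff φ p.2 i * S.k (S.reparam φ p.1) (S.reparam φ p.2)
          ∂S.noise.prod S.noise := by
    intro i
    rw [← real_inner_self_eq_norm_sq, ← integral_inner (hint i), integral_prod _ (hprod i)]
    refine integral_congr_ae (.of_forall fun u => ?_)
    dsimp only
    rw [real_inner_comm, ← integral_inner (hint i)]
    refine integral_congr_ae (.of_forall fun u' => ?_)
    dsimp only
    rw [inner_smul_left, inner_smul_right, hk.inner_kerFun]
    simp only [conj_trivial]
    ring
  rw [loss, KSD, PiLp.norm_sq_eq_of_L2]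
  simp_rw [hA.integralOp_eq hT hK hk φ hf, hsq]
  rw [← integral_finsetSum _ fun i _ => hprod i]
  refine integral_congr_ae (.of_forall fun p => ?_)
  simp only [pairLoss]
  rw [← Finset.sum_mul, mul_comm, PiLp.inner_apply]
  simp [mul_comm]

end Model

/-! ### Propagation of first and second derivative bounds. -/

section Calculus

open scoped Topology

variable {E F H W : Type*} [NormedAddCommGroup E] [NormedSpace ℝ E] [NormedAddCommGroup F]
  [NormedSpace ℝ F] [NormedAddCommGroup H] [NormedSpace ℝ H] [NormedAddCommGroup W]
  [NormedSpace ℝ W]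

lemma norm_iteratedFDeriv_two (f : E → F) (x : E) :
    ‖iteratedFDeriv ℝ 2 f x‖ = ‖fderiv ℝ (fderiv ℝ f) x‖ := by
  rw [← norm_iteratedFDeriv_one, norm_iteratedFDeriv_fderiv]

/-- `f` is `C²`, and its first two derivatives at `x` are bounded by `a` and `b`. -/
structure C2BoundAt (f : E → F) (x : E) (a b : ℝ) : Prop where
  contDiff : ContDiff ℝ 2 f
  fderiv_le : ‖fderiv ℝ f x‖ ≤ a
  hess_le : ‖iteratedFDeriv ℝ 2 f x‖ ≤ b

namespace C2BoundAt

variable {f : E → F} {g : E → H} {x : E} {a b a' b' : ℝ}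

lemma nonneg_left (h : C2BoundAt f x a b) : 0 ≤ a := (norm_nonneg _).trans h.fderiv_le

lemma nonneg_right (h : C2BoundAt f x a b) : 0 ≤ b := (norm_nonneg _).trans h.hess_le

lemma differentiableAt (h : C2BoundAt f x a b) (y : E) : DifferentiableAt ℝ f y :=
  h.contDiff.differentiable (by norm_num) y

lemma mono (h : C2BoundAt f x a b) (ha : a ≤ a') (hb : b ≤ b') : C2BoundAt f x a' b' :=
  ⟨h.contDiff, h.fderiv_le.trans ha, h.hess_le.trans hb⟩

lemma add {g : E → F} (hf : C2BoundAt f x a b) (hg : C2BoundAt g x a' b') :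
    C2BoundAt (fun y => f y + g y) x (a + a') (b + b') := by
  refine ⟨hf.contDiff.add hg.contDiff, ?_, ?_⟩
  · rw [fderiv_fun_add (hf.differentiableAt x) (hg.differentiableAt x)]
    exact norm_add_le_of_le hf.fderiv_le hg.fderiv_le
  · rw [show (fun y => f y + g y) = f + g from rfl,
      iteratedFDeriv_add_apply hf.contDiff.contDiffAt hg.contDiff.contDiffAt]
    exact norm_add_le_of_le hf.hess_le hg.hess_le

lemma clm {A : F →L[ℝ] H} {c : ℝ} (hA : ‖A‖ ≤ c) (hf : C2BoundAt f x a b) :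
    C2BoundAt (fun y => A (f y)) x (c * a) (c * b) := by
  have hc : 0 ≤ c := (norm_nonneg _).trans hA
  refine ⟨A.contDiff.comp hf.contDiff, ?_, ?_⟩
  · have h : fderiv ℝ (fun y => A (f y)) x = A.comp (fderiv ℝ f x) :=
      (A.hasFDerivAt.comp x (hf.differentiableAt x).hasFDerivAt).fderiv
    rw [h]
    exact (A.opNorm_comp_le _).trans (mul_le_mul hA hf.fderiv_le (norm_nonneg _) hc)
  · have h : iteratedFDeriv ℝ 2 (fun y => A (f y)) x
        = A.compContinuousMultilinearMap (iteratedFDeriv ℝ 2 f x) :=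
      A.iteratedFDeriv_comp_left hf.contDiff.contDiffAt le_rfl
    rw [h]
    exact (A.norm_compContinuousMultilinearMap_le _).trans
      (mul_le_mul hA hf.hess_le (norm_nonneg _) hc)

lemma bilinear {A : F →L[ℝ] H →L[ℝ] W} (hA : ‖A‖ ≤ 1) (hf : C2BoundAt f x a b)
    (hg : C2BoundAt g x a' b') {p q : ℝ} (hp : ‖f x‖ ≤ p) (hq : ‖g x‖ ≤ q) :
    C2BoundAt (fun y => A (f y) (g y)) x (a * q + p * a') (b * q + 2 * a * a' + p * b') := by
  have hp0 : 0 ≤ p := (norm_nonneg _).trans hp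
  have hq0 : 0 ≤ q := (norm_nonneg _).trans hq
  have ha0 := hf.nonneg_left
  have hb0 := hf.nonneg_right
  refine ⟨A.isBoundedBilinearMap.contDiff.comp (hf.contDiff.prodMk hg.contDiff), ?_, ?_⟩
  · have h := A.norm_iteratedFDeriv_le_of_bilinear_of_le_one hf.contDiff hg.contDiff x
      (n := 1) (by norm_num) hA
    simp only [Finset.sum_range_succ, Finset.sum_range_zero, Nat.choose_zero_right,
      Nat.choose_self, Nat.cast_one, one_mul, zero_add, Nat.sub_zero,
      norm_iteratedFDeriv_zero, norm_iteratedFDeriv_one] at h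
    have e : ‖iteratedFDeriv ℝ (1 - 1) g x‖ = ‖g x‖ := norm_iteratedFDeriv_zero
    rw [e] at h
    refine h.trans ?_
    rw [add_comm]
    gcongr
    · exact hf.fderiv_le
    · exact hg.fderiv_le
  · have h := A.norm_iteratedFDeriv_le_of_bilinear_of_le_one hf.contDiff hg.contDiff x
      (n := 2) (by norm_num) hA
    simp only [Finset.sum_range_succ, Finset.sum_range_zero, Nat.choose_zero_right,
      Nat.choose_self, Nat.cast_one, one_mul, zero_add, Nat.sub_zero,
      norm_iteratedFDeriv_zero, norm_iteratedFDeriv_one, Nat.choose_one_right,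
      Nat.cast_ofNat] at h
    have e : ‖iteratedFDeriv ℝ (2 - 2) g x‖ = ‖g x‖ := norm_iteratedFDeriv_zero
    have e' : ‖iteratedFDeriv ℝ (2 - 1) g x‖ = ‖fderiv ℝ g x‖ := norm_iteratedFDeriv_one g
    rw [e, e'] at h
    calc _ ≤ _ := h
      _ = ‖iteratedFDeriv ℝ 2 f x‖ * ‖g x‖ + 2 * ‖fderiv ℝ f x‖ * ‖fderiv ℝ g x‖
          + ‖f x‖ * ‖iteratedFDeriv ℝ 2 g x‖ := by ring
      _ ≤ _ := by
        gcongr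
        · exact hf.hess_le
        · exact hf.fderiv_le
        · exact hg.fderiv_le
        · exact hg.hess_le

/-- The two terms of the second bound come from D²g(Df, Df) and Dg ∘ D²f. Regularity of g is
required only at values of f, since ξ/y is singular on the coordinate hyperplanes. -/
lemma comp {g : F → H} (hf : C2BoundAt f x a b) (hg : ∀ y, ContDiffAt ℝ 2 g (f y))
    (h1 : ‖fderiv ℝ g (f x)‖ ≤ a') (h2 : ‖iteratedFDeriv ℝ 2 g (f x)‖ ≤ b') :
    C2BoundAt (fun y => g (f y)) x (a' * a) (b' * a ^ 2 + a' * b) := by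
  have ha' : 0 ≤ a' := (norm_nonneg _).trans h1
  have hb' : 0 ≤ b' := (norm_nonneg _).trans h2
  have ha := hf.nonneg_left
  have hd : ∀ y, fderiv ℝ (fun y => g (f y)) y = (fderiv ℝ g (f y)).comp (fderiv ℝ f y) :=
    fun y => fderiv_comp y ((hg y).differentiableAt (by norm_num)) (hf.differentiableAt y)
  refine ⟨contDiff_iff_contDiffAt.2 fun y => (hg y).comp y hf.contDiff.contDiffAt, ?_, ?_⟩
  · rw [hd x]
    exact (ContinuousLinearMap.opNorm_comp_le _ _).trans
      (mul_le_mul h1 hf.fderiv_le (norm_nonneg _) ha')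
  · rw [norm_iteratedFDeriv_two] at h2 ⊢
    have hf2 := hf.hess_le
    rw [norm_iteratedFDeriv_two] at hf2
    have hdf : HasFDerivAt (fderiv ℝ f) (fderiv ℝ (fderiv ℝ f) x) x :=
      ((hf.contDiff.fderiv_right (m := 1) (by norm_num)).differentiable
        one_ne_zero x).hasFDerivAt
    have hdg : HasFDerivAt (fderiv ℝ g) (fderiv ℝ (fderiv ℝ g) (f x)) (f x) :=
      (((hg x).fderiv_right (m := 1) (by norm_num)).differentiableAt
        one_ne_zero).hasFDerivAt
    have hc := (hdg.comp x (hf.differentiableAt x).hasFDerivAt).clm_comp hdf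
    have e : fderiv ℝ (fun y => g (f y)) = fun y => (fderiv ℝ g (f y)).comp (fderiv ℝ f y) :=
      funext hd
    rw [e]
    simp only [Function.comp_def] at hc
    rw [hc.fderiv]
    refine ContinuousLinearMap.opNorm_le_bound _ (by have := hf.nonneg_right; positivity) fun v => ?_
    simp only [add_apply, ContinuousLinearMap.comp_apply, ContinuousLinearMap.compL_apply,
      ContinuousLinearMap.flip_apply]
    have n1 : ‖(fderiv ℝ g (f x)).comp (fderiv ℝ (fderiv ℝ f) x v)‖ ≤ a' * (b * ‖v‖) :=
      (ContinuousLinearMap.opNorm_comp_le _ _).trans (mul_le_mul h1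
        ((fderiv ℝ (fderiv ℝ f) x).le_of_opNorm_le hf2 v) (norm_nonneg _) ha')
    have n2 : ‖(fderiv ℝ (fderiv ℝ g) (f x) (fderiv ℝ f x v)).comp (fderiv ℝ f x)‖
        ≤ (b' * (a * ‖v‖)) * a := by
      refine (ContinuousLinearMap.opNorm_comp_le _ _).trans (mul_le_mul ?_ hf.fderiv_le
        (norm_nonneg _) (by positivity))
      exact (ContinuousLinearMap.le_opNorm _ _).trans (mul_le_mul h2
        ((fderiv ℝ f x).le_of_opNorm_le hf.fderiv_le v) (norm_nonneg _) hb')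
    refine (norm_add_le_of_le n1 n2).trans (le_of_eq ?_)
    ring

lemma congr_fun {f' : E → F} (h : C2BoundAt f x a b) (he : ∀ y, f' y = f y) :
    C2BoundAt f' x a b := by
  obtain rfl : f' = f := funext he
  exact h

end C2BoundAt

/-- The derivative of a function on a product is bounded by the partial derivatives. -/
lemma norm_fderiv_prod_le {f : E × F → H} {x : E} {y : F} (hf : DifferentiableAt ℝ f (x, y)) :
    ‖fderiv ℝ f (x, y)‖ ≤ ‖fderiv ℝ (fun x' => f (x', y)) x‖ + ‖fderiv ℝ (fun y' => f (x, y')) y‖ := by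
  have h1 : fderiv ℝ (fun x' => f (x', y)) x
      = (fderiv ℝ f (x, y)).comp (ContinuousLinearMap.inl ℝ E F) :=
    (hf.hasFDerivAt.comp (f := fun x' : E => (x', y)) x (hasFDerivAt_prodMk_left x y)).fderiv
  have h2 : fderiv ℝ (fun y' => f (x, y')) y
      = (fderiv ℝ f (x, y)).comp (ContinuousLinearMap.inr ℝ E F) :=
    (hf.hasFDerivAt.comp (f := fun y' : F => (x, y')) y (hasFDerivAt_prodMk_right x y)).fderiv
  refine ContinuousLinearMap.opNorm_le_bound _ (by positivity) fun v => ?_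
  have e : fderiv ℝ f (x, y) v = fderiv ℝ (fun x' => f (x', y)) x v.1
      + fderiv ℝ (fun y' => f (x, y')) y v.2 := by
    rw [h1, h2, ContinuousLinearMap.comp_apply, ContinuousLinearMap.comp_apply, ← map_add]
    simp
  rw [e, add_mul]
  refine norm_add_le_of_le ?_ ?_
  · exact (ContinuousLinearMap.le_opNorm _ _).trans (by gcongr; exact norm_fst_le v)
  · exact (ContinuousLinearMap.le_opNorm _ _).trans (by gcongr; exact norm_snd_le v)

/-- Joint first and second order bounds for a symmetric kernel from bounds for its partial
derivatives. -/
lemma c2BoundAt_symmetric_kernel {k : E → E → ℝ} {c : ℝ}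
    (hk : ContDiff ℝ 2 fun p : E × E => k p.1 p.2) (hs : ∀ x y, k x y = k y x)
    (h1 : ∀ x y, ‖fderiv ℝ (fun x' => k x' y) x‖ ≤ c)
    (h11 : ∀ x y, ‖iteratedFDeriv ℝ 2 (fun x' => k x' y) x‖ ≤ c)
    (h12 : ∀ x y, ‖fderiv ℝ (fun y' => fderiv ℝ (fun x' => k x' y') x) y‖ ≤ c) (p : E × E) :
    C2BoundAt (fun p : E × E => k p.1 p.2) p (2 * c) (4 * c) := by
  have hc : 0 ≤ c := (norm_nonneg _).trans (h1 p.1 p.2)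
  set κ : E × E → ℝ := fun p => k p.1 p.2 with hκ
  have hdκ : Differentiable ℝ κ := hk.differentiable (by norm_num)
  -- the first partial derivative
  set D : E × E → (E →L[ℝ] ℝ) := fun p => fderiv ℝ (fun x' => k x' p.2) p.1 with hD
  have hDeq : ∀ p, D p = (fderiv ℝ κ p).comp (ContinuousLinearMap.inl ℝ E E) := fun p =>
    ((hdκ p).hasFDerivAt.comp (f := fun x' : E => (x', p.2)) p.1
      (hasFDerivAt_prodMk_left p.1 p.2)).fderiv
  have hDdiff : Differentiable ℝ D := by
    have h : Differentiable ℝ (fderiv ℝ κ) :=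
      (hk.fderiv_right (m := 1) (by norm_num)).differentiable one_ne_zero
    have : D = fun p => (fderiv ℝ κ p).comp (ContinuousLinearMap.inl ℝ E E) := funext hDeq
    rw [this]
    exact fun p => (h p).clm_comp (differentiableAt_const _)
  have hDD : ∀ p, ‖fderiv ℝ D p‖ ≤ 2 * c := by
    intro p
    have e11 : ‖fderiv ℝ (fun x' => D (x', p.2)) p.1‖ ≤ c := by
      have := h11 p.1 p.2
      rwa [norm_iteratedFDeriv_two] at this
    have e12 : ‖fderiv ℝ (fun y' => D (p.1, y')) p.2‖ ≤ c := h12 p.1 p.2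
    have := norm_fderiv_prod_le (hDdiff (p.1, p.2))
    linarith
  -- Symmetry identifies the second partial derivative at (x, y) with the first at (y, x), so the
  -- full derivative is assembled from `D` alone and no bound on the second variable's own Hessian
  -- is needed.
  have hswap : ∀ p : E × E, fderiv ℝ (fun y' => k p.1 y') p.2 = D p.swap := by
    intro p
    have : (fun y' => k p.1 y') = fun y' => k y' p.1 := funext fun y' => hs _ _
    rw [this]
    rfl
  have hfd : ∀ p, fderiv ℝ κ p = (D p).comp (ContinuousLinearMap.fst ℝ E E)
      + (D p.swap).comp (ContinuousLinearMap.snd ℝ E E) := by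
    intro p
    have h2 : D p.swap = (fderiv ℝ κ p).comp (ContinuousLinearMap.inr ℝ E E) := by
      rw [← hswap]
      exact ((hdκ p).hasFDerivAt.comp (f := fun y' : E => (p.1, y')) p.2
        (hasFDerivAt_prodMk_right p.1 p.2)).fderiv
    rw [hDeq, h2]
    ext v <;> simp <;> exact map_zero _
  refine ⟨hk, ?_, ?_⟩
  · have h := norm_fderiv_prod_le (hdκ (p.1, p.2))
    have e1 := h1 p.1 p.2
    have e2 : ‖fderiv ℝ (fun y' => κ (p.1, y')) p.2‖ ≤ c := by
      have : fderiv ℝ (fun y' => κ (p.1, y')) p.2 = D p.swap := hswap p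
      rw [this]
      exact h1 _ _
    linarith
  · rw [norm_iteratedFDeriv_two]
    have hsw : HasFDerivAt (fun p : E × E => D p.swap)
        ((fderiv ℝ D p.swap).comp ((ContinuousLinearMap.snd ℝ E E).prod
          (ContinuousLinearMap.fst ℝ E E))) p :=
      (hDdiff p.swap).hasFDerivAt.comp p (f := Prod.swap)
        ((ContinuousLinearMap.snd ℝ E E).prod (ContinuousLinearMap.fst ℝ E E)).hasFDerivAt
    have hder := ((hDdiff p).hasFDerivAt.clm_comp
      (hasFDerivAt_const (ContinuousLinearMap.fst ℝ E E) p)).add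
      (hsw.clm_comp (hasFDerivAt_const (ContinuousLinearMap.snd ℝ E E) p))
    have hder' := hder.congr_of_eventuallyEq (f₁ := fderiv ℝ κ) (.of_forall fun q => hfd q)
    rw [hder'.fderiv]
    refine ContinuousLinearMap.opNorm_le_bound _ (by positivity) fun v => ?_
    simp only [add_apply, ContinuousLinearMap.comp_apply, ContinuousLinearMap.compL_apply,
      ContinuousLinearMap.flip_apply, ContinuousLinearMap.comp_zero, zero_add]
    have n1 : ‖(fderiv ℝ D p v).comp (ContinuousLinearMap.fst ℝ E E)‖ ≤ (2 * c * ‖v‖) * 1 :=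
      (ContinuousLinearMap.opNorm_comp_le _ _).trans (mul_le_mul
        ((fderiv ℝ D p).le_of_opNorm_le (hDD p) v) (ContinuousLinearMap.norm_fst_le ℝ E E)
        (norm_nonneg _) (by positivity))
    have n2 : ‖(fderiv ℝ D p.swap (((ContinuousLinearMap.snd ℝ E E).prod
          (ContinuousLinearMap.fst ℝ E E)) v)).comp (ContinuousLinearMap.snd ℝ E E)‖
        ≤ (2 * c * ‖v‖) * 1 := by
      refine (ContinuousLinearMap.opNorm_comp_le _ _).trans (mul_le_mul ?_
        (ContinuousLinearMap.norm_snd_le ℝ E E) (norm_nonneg _) (by positivity))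
      refine ((fderiv ℝ D p.swap).le_of_opNorm_le (hDD _) _).trans ?_
      gcongr
      exact (max_comm ‖v.2‖ ‖v.1‖).le
    refine (norm_add_le_of_le n1 n2).trans (le_of_eq ?_)
    ring

end Calculus

/-! ### Entrywise products and quotients. -/

section Entrywise

variable {d : ℕ}

/-- Entrywise multiplication by a fixed vector. -/
def hadamard : Euc d →L[ℝ] Euc d →L[ℝ] Euc d :=
  LinearMap.toContinuousLinearMap
    ((LinearMap.toContinuousLinearMap : (Euc d →ₗ[ℝ] Euc d) ≃ₗ[ℝ] (Euc d →L[ℝ] Euc d)).toLinearMap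
      ∘ₗ LinearMap.mk₂ ℝ (fun a b : Euc d => (WithLp.toLp 2 fun i => a i * b i : Euc d))
        (fun a a' b => by ext i; simp [add_mul]) (fun c a b => by ext i; simp [mul_assoc])
        (fun a b b' => by ext i; simp [mul_add]) (fun c a b => by ext i; simp [mul_left_comm]))

lemma hadamard_apply (a b : Euc d) (i : Fin d) : hadamard a b i = a i * b i := rfl

/-- A diagonal operator has norm its largest entry. Hence ξ enters the derivative bounds through
‖ξ‖_∞, which costs log d instead of d. -/
lemma norm_hadamard_apply_le {a : Euc d} {c : ℝ} (hc : 0 ≤ c) (ha : ∀ i, |a i| ≤ c) (b : Euc d) :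
    ‖hadamard a b‖ ≤ c * ‖b‖ := by
  rw [EuclideanSpace.norm_eq, EuclideanSpace.norm_eq, ← Real.sqrt_sq hc,
    ← Real.sqrt_mul (sq_nonneg c), Finset.mul_sum]
  refine Real.sqrt_le_sqrt (Finset.sum_le_sum fun i _ => ?_)
  rw [hadamard_apply, norm_mul, mul_pow, Real.norm_eq_abs (a i)]
  gcongr
  exact ha i

lemma norm_hadamard_le {a : Euc d} {c : ℝ} (hc : 0 ≤ c) (ha : ∀ i, |a i| ≤ c) :
    ‖hadamard a‖ ≤ c :=
  ContinuousLinearMap.opNorm_le_bound _ hc (norm_hadamard_apply_le hc ha)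

lemma abs_apply_le_norm (a : Euc d) (i : Fin d) : |a i| ≤ ‖a‖ := by
  simpa using PiLp.norm_apply_le a i

lemma hasFDerivAt_entrywise {g : Fin d → ℝ → ℝ} {g' : Fin d → ℝ} {y : Euc d}
    (h : ∀ i, HasDerivAt (g i) (g' i) (y i)) :
    HasFDerivAt (fun y : Euc d => (WithLp.toLp 2 fun i => g i (y i) : Euc d))
      (hadamard (WithLp.toLp 2 g')) y := by
  rw [← hasFDerivWithinAt_univ, hasFDerivWithinAt_euclidean]
  intro i
  rw [hasFDerivWithinAt_univ]
  have := (h i).hasFDerivAt.comp y (EuclideanSpace.proj i : Euc d →L[ℝ] ℝ).hasFDerivAt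
  refine this.congr_fderiv ?_
  ext v
  simp [hadamard_apply, mul_comm]

/-- Entrywise division of a fixed vector, with bounds for the first two derivatives away from the
coordinate hyperplanes. -/
lemma div_entrywise_bounds (ξ : Euc d) {y : Euc d} (hy : ∀ i, 0 < y i) {r : ℝ}
    (hr : ∀ i, (y i)⁻¹ ≤ r) (hr0 : 0 ≤ r) :
    ContDiffAt ℝ 2 (fun y : Euc d => (WithLp.toLp 2 fun i => ξ i / y i : Euc d)) y ∧
    ‖fderiv ℝ (fun y : Euc d => (WithLp.toLp 2 fun i => ξ i / y i : Euc d)) y‖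
      ≤ ‖WithLp.ofLp ξ‖ * r ^ 2 ∧
    ‖iteratedFDeriv ℝ 2 (fun y : Euc d => (WithLp.toLp 2 fun i => ξ i / y i : Euc d)) y‖
      ≤ 2 * ‖WithLp.ofLp ξ‖ * r ^ 3 := by
  have hξ : ∀ i, |ξ i| ≤ ‖WithLp.ofLp ξ‖ := fun i => norm_le_pi_norm (WithLp.ofLp ξ) i
  have hd1 : ∀ z : Euc d, (∀ i, 0 < z i) →
      HasFDerivAt (fun y : Euc d => (WithLp.toLp 2 fun i => ξ i / y i : Euc d))
        (hadamard (WithLp.toLp 2 fun i => -(ξ i / z i ^ 2))) z := by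
    intro z hz
    refine hasFDerivAt_entrywise (g := fun i t => ξ i / t) fun i => ?_
    refine ((hasDerivAt_inv (hz i).ne').const_mul (ξ i)).congr_deriv ?_
    ring
  have hopen : ∀ᶠ z in nhds y, ∀ i, 0 < z i := by
    refine Filter.eventually_all.2 fun i => ?_
    exact (by fun_prop : Continuous fun z : Euc d => z i).continuousAt.eventually
      (lt_mem_nhds (hy i))
  have hev : fderiv ℝ (fun y : Euc d => (WithLp.toLp 2 fun i => ξ i / y i : Euc d))
      =ᶠ[nhds y] fun z => hadamard (WithLp.toLp 2 fun i => -(ξ i / z i ^ 2)) :=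
    hopen.mono fun z hz => (hd1 z hz).fderiv
  have hd2 : HasFDerivAt (fun z : Euc d =>
      hadamard (WithLp.toLp 2 fun i => -(ξ i / z i ^ 2) : Euc d))
      (hadamard.comp (hadamard (WithLp.toLp 2 fun i => 2 * ξ i / y i ^ 3))) y := by
    refine hadamard.hasFDerivAt.comp y (hasFDerivAt_entrywise (g := fun i t => -(ξ i / t ^ 2))
      fun i => ?_)
    have h := (((hasDerivAt_pow 2 (y i)).inv (pow_ne_zero 2 (hy i).ne')).const_mul (ξ i)).neg
    refine (h.congr_of_eventuallyEq (.of_forall fun t => ?_)).congr_deriv ?_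
    · simp [div_eq_mul_inv]
    · have := (hy i).ne'
      field_simp
      norm_num
      ring
  refine ⟨contDiffAt_euclidean.2 fun i => ?_, ?_, ?_⟩
  · exact contDiffAt_const.div (EuclideanSpace.proj i : Euc d →L[ℝ] ℝ).contDiff.contDiffAt
      (hy i).ne'
  · rw [(hd1 y hy).fderiv]
    refine norm_hadamard_le (by positivity) fun i => ?_
    have h1 := hy i
    rw [abs_neg, abs_div, abs_of_pos (by positivity : 0 < y i ^ 2), div_eq_mul_inv, ← inv_pow]
    gcongr
    · exact hξ i
    · exact hr i
  · rw [norm_iteratedFDeriv_two, hev.fderiv_eq, hd2.fderiv]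
    refine ContinuousLinearMap.opNorm_le_bound _ (by positivity) fun v => ?_
    refine ContinuousLinearMap.opNorm_le_bound _ (by positivity) fun w => ?_
    -- The second derivative is an entrywise product of three vectors; the diagonal bound is used
    -- twice, the second time with |v i| ≤ ‖v‖.
    have e : (hadamard.comp (hadamard (WithLp.toLp 2 fun i => 2 * ξ i / y i ^ 3))) v w
        = hadamard (WithLp.toLp 2 fun i => 2 * ξ i / y i ^ 3) (hadamard v w) := by
      ext i
      simp only [ContinuousLinearMap.comp_apply, hadamard_apply]
      ring
    rw [e, mul_assoc]
    refine (norm_hadamard_apply_le (c := 2 * ‖WithLp.ofLp ξ‖ * r ^ 3) (by positivity)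
      (fun i => ?_) _).trans ?_
    · have h1 := hy i
      simp only
      rw [abs_div, abs_of_pos (by positivity : 0 < y i ^ 3), div_eq_mul_inv, ← inv_pow, abs_mul,
        abs_two]
      gcongr
      · exact hξ i
      · exact hr i
    · gcongr
      exact norm_hadamard_apply_le (norm_nonneg v) (abs_apply_le_norm v) w

end Entrywise

/-! ### Differentiation under the integral sign. -/

section ParametricIntegral

open Filter Topology

variable {m : ℕ} {α : Type*} [MeasurableSpace α]

/-- Directional derivatives are limits of measurable difference quotients, and in finite dimension
the derivative is assembled from those along a basis. -/
lemma stronglyMeasurable_fderiv_of_param {W : Type*} [NormedAddCommGroup W] [NormedSpace ℝ W]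
    {F : Euc m → α → W} (hF : ∀ φ, StronglyMeasurable (F φ)) {φ : Euc m}
    (hd : ∀ a, DifferentiableAt ℝ (fun ψ => F ψ a) φ) :
    StronglyMeasurable fun a => fderiv ℝ (fun ψ => F ψ a) φ := by
  have hdir : ∀ v : Euc m, StronglyMeasurable fun a => fderiv ℝ (fun ψ => F ψ a) φ v := by
    intro v
    refine stronglyMeasurable_of_tendsto (u := atTop)
      (f := fun (n : ℕ) a => (n : ℝ) • (F (φ + (n : ℝ)⁻¹ • v) a - F φ a))
      (fun n => ((hF _).sub (hF _)).const_smul _) (tendsto_pi_nhds.2 fun a => ?_)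
    refine (hd a).hasFDerivAt.lim v (c := fun n : ℕ => (n : ℝ)) ?_
    simpa using tendsto_natCast_atTop_atTop (R := ℝ)
  have hsum : (fun a => fderiv ℝ (fun ψ => F ψ a) φ) = fun a => ∑ i : Fin m,
      ContinuousLinearMap.smulRightL ℝ (Euc m) W (EuclideanSpace.proj i)
        (fderiv ℝ (fun ψ => F ψ a) φ (EuclideanSpace.single i 1)) := by
    funext a
    refine ContinuousLinearMap.ext fun v => ?_
    have hv : v = ∑ i, v i • EuclideanSpace.single i (1 : ℝ) := by
      ext j
      simp [Finset.sum_apply, Pi.single_apply]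
    conv_lhs => rw [hv, map_sum]
    simp only [map_smul, FunLike.coe_sum, Finset.sum_apply]
    rfl
  rw [hsum]
  refine Finset.stronglyMeasurable_fun_sum _ fun i _ => ?_
  exact (ContinuousLinearMap.continuous _).comp_stronglyMeasurable (hdir _)

/-- Differentiation under the integral sign to second order: the integral of a family of `C²`
functions whose derivatives are locally dominated is differentiable, its gradient is the integral
of the gradients, and the gradient is Lipschitz. -/
theorem smooth_integral {μ : Measure α} {F : Euc m → α → ℝ} (hF : ∀ φ, StronglyMeasurable (F φ))
    (hC : ∀ a, ContDiff ℝ 2 fun φ => F φ a) (hi : ∀ φ, Integrable (F φ) μ)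
    {b₁ b₂ c : Euc m → α → ℝ} (hb₁ : ∀ φ, Integrable (b₁ φ) μ) (hb₂ : ∀ φ, Integrable (b₂ φ) μ)
    (h₁ : ∀ φ, ∀ ψ ∈ Metric.ball φ 1, ∀ a, ‖fderiv ℝ (fun φ => F φ a) ψ‖ ≤ b₁ φ a)
    (h₂ : ∀ φ, ∀ ψ ∈ Metric.ball φ 1, ∀ a, ‖iteratedFDeriv ℝ 2 (fun φ => F φ a) ψ‖ ≤ b₂ φ a)
    {Λ : ℝ} (hc : ∀ φ a, ‖iteratedFDeriv ℝ 2 (fun φ => F φ a) φ‖ ≤ c φ a)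
    (hci : ∀ φ, Integrable (c φ) μ) (hcΛ : ∀ φ, ∫ a, c φ a ∂μ ≤ Λ) :
    Model.Smooth (fun φ => ∫ a, F φ a ∂μ) Λ ∧
      ∀ φ, Integrable (fun a => gradient (fun φ => F φ a) φ) μ ∧
        ∫ a, gradient (fun φ => F φ a) φ ∂μ = gradient (fun φ => ∫ a, F φ a ∂μ) φ := by
  have hd : ∀ φ a, DifferentiableAt ℝ (fun φ => F φ a) φ := fun φ a =>
    (hC a).differentiable (by norm_num) φ
  have hd2 : ∀ φ a, DifferentiableAt ℝ (fderiv ℝ fun φ => F φ a) φ := fun φ a =>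
    ((hC a).fderiv_right (m := 1) (by norm_num)).differentiable one_ne_zero φ
  have hm1 : ∀ φ, StronglyMeasurable fun a => fderiv ℝ (fun φ => F φ a) φ := fun φ =>
    stronglyMeasurable_fderiv_of_param hF (hd φ)
  have hm2 : ∀ φ, StronglyMeasurable fun a => fderiv ℝ (fderiv ℝ fun φ => F φ a) φ := fun φ =>
    stronglyMeasurable_fderiv_of_param (F := fun φ a => fderiv ℝ (fun φ => F φ a) φ) hm1 (hd2 φ)
  have hi1 : ∀ φ, Integrable (fun a => fderiv ℝ (fun φ => F φ a) φ) μ := fun φ =>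
    (hb₁ φ).mono' (hm1 φ).aestronglyMeasurable
      (.of_forall fun a => h₁ φ φ (Metric.mem_ball_self one_pos) a)
  have hD1 : ∀ φ, HasFDerivAt (fun φ => ∫ a, F φ a ∂μ)
      (∫ a, fderiv ℝ (fun φ => F φ a) φ ∂μ) φ := fun φ =>
    hasFDerivAt_integral_of_dominated_of_fderiv_le (Metric.ball_mem_nhds φ one_pos)
      (.of_forall fun ψ => (hF ψ).aestronglyMeasurable) (hi φ) (hm1 φ).aestronglyMeasurable
      (.of_forall fun a ψ hψ => h₁ φ ψ hψ a) (hb₁ φ)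
      (.of_forall fun a ψ _ => (hd ψ a).hasFDerivAt)
  have hD2 : ∀ φ, HasFDerivAt (fun φ => ∫ a, fderiv ℝ (fun φ => F φ a) φ ∂μ)
      (∫ a, fderiv ℝ (fderiv ℝ fun φ => F φ a) φ ∂μ) φ := fun φ =>
    hasFDerivAt_integral_of_dominated_of_fderiv_le (Metric.ball_mem_nhds φ one_pos)
      (.of_forall fun ψ => (hm1 ψ).aestronglyMeasurable) (hi1 φ) (hm2 φ).aestronglyMeasurable
      (.of_forall fun a ψ hψ => by
        rw [← norm_iteratedFDeriv_two]
        exact h₂ φ ψ hψ a) (hb₂ φ)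
      (.of_forall fun a ψ _ => (hd2 ψ a).hasFDerivAt)
  have hfd : ∀ φ, fderiv ℝ (fun φ => ∫ a, F φ a ∂μ) φ = ∫ a, fderiv ℝ (fun φ => F φ a) φ ∂μ :=
    fun φ => (hD1 φ).fderiv
  refine ⟨⟨fun φ => (hD1 φ).differentiableAt, fun φ ψ => ?_⟩, fun φ => ⟨?_, ?_⟩⟩
  -- The local envelopes `b₁` and `b₂` only justify the differentiation; the Lipschitz constant
  -- comes from the pointwise bound `c`, whose integral is at most Λ at every parameter.
  · rw [← norm_fderiv_sub_eq_norm_gradient_sub, hfd, hfd]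
    refine convex_univ.norm_image_sub_le_of_norm_fderiv_le (𝕜 := ℝ)
      (f := fun φ => ∫ a, fderiv ℝ (fun φ => F φ a) φ ∂μ)
      (fun φ _ => (hD2 φ).differentiableAt) (fun φ _ => ?_) (Set.mem_univ _) (Set.mem_univ _)
    rw [(hD2 φ).fderiv]
    refine (norm_integral_le_of_norm_le (hci φ) (.of_forall fun a => ?_)).trans (hcΛ φ)
    rw [← norm_iteratedFDeriv_two]
    exact hc φ a
  · exact (InnerProductSpace.toDual ℝ (Euc m)).symm.toContinuousLinearEquiv.toContinuousLinearMap
      |>.integrable_comp (hi1 φ)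
  · have h := (InnerProductSpace.toDual ℝ (Euc m)).symm.toContinuousLinearEquiv.toContinuousLinearMap
      |>.integral_comp_comm (hi1 φ)
    rw [gradient, hfd φ]
    exact h

end ParametricIntegral

/-! ### Derivative bounds for the samples, the score difference and `pairLoss`. -/

namespace Model

variable {m dz d : ℕ} {S : Model m dz d} {B G L M : ℝ}

/-- The bound `G (1 + ‖z‖) (1 + ‖ξ‖_∞)` for the derivatives of the reparameterization. -/
def growth (G : ℝ) (u : Euc dz × Euc d) : ℝ := G * (1 + ‖u.1‖) * (1 + ‖WithLp.ofLp u.2‖)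

lemma growth_nonneg (hG : 1 ≤ G) (u : Euc dz × Euc d) : 0 ≤ growth G u := by
  unfold growth
  positivity

lemma one_le_growth (hG : 1 ≤ G) (u : Euc dz × Euc d) : 1 ≤ growth G u := by
  have h1 : 1 ≤ 1 + ‖u.1‖ := by linarith [norm_nonneg u.1]
  have h2 : 1 ≤ 1 + ‖WithLp.ofLp u.2‖ := by linarith [norm_nonneg (WithLp.ofLp u.2)]
  exact one_le_mul_of_one_le_of_one_le (one_le_mul_of_one_le_of_one_le hG h1) h2

lemma measurable_growth : Measurable (growth G : Euc dz × Euc d → ℝ) :=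
  (measurable_const.mul (measurable_const.add (measurable_fst.norm))).mul
    (measurable_const.add (measurable_supNorm.comp measurable_snd))

lemma LayerRegular.c2BoundAt {h : Euc dz → Euc m → Euc d} (hh : LayerRegular h G) (z : Euc dz)
    (φ : Euc m) : C2BoundAt (h z) φ (G * (1 + ‖z‖)) (G * (1 + ‖z‖)) :=
  ⟨hh.contDiff z, hh.grad z φ, hh.hess z φ⟩

/-- The sample depends on φ through μ + ξ ⊙ σ, which is linear in (μ, σ), so both orders cost
G(1+‖z‖) times 1 + ‖ξ‖_∞. -/
lemma LayerAssumption.c2BoundAt_reparam (hA : S.LayerAssumption G L) (φ : Euc m)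
    (u : Euc dz × Euc d) :
    C2BoundAt (fun φ => S.reparam φ u) φ (growth G u) (growth G u) := by
  have hξ : ‖hadamard u.2‖ ≤ ‖WithLp.ofLp u.2‖ :=
    norm_hadamard_le (norm_nonneg _) fun i => norm_le_pi_norm (WithLp.ofLp u.2) i
  have h := (hA.mean.c2BoundAt u.1 φ).add ((hA.std.c2BoundAt u.1 φ).clm hξ)
  refine (h.mono (le_of_eq ?_) (le_of_eq ?_)).congr_fun fun ψ => ?_
  · unfold growth; ring
  · unfold growth; ring
  · ext i
    simp [reparam, hadamard_apply, mul_comm]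

lemma TargetAssumption.score_bounds (hT : S.TargetAssumption L M) (x : Euc d) :
    ContDiffAt ℝ 2 S.score x ∧ ‖fderiv ℝ S.score x‖ ≤ L ∧ ‖iteratedFDeriv ℝ 2 S.score x‖ ≤ M := by
  set f : Euc d → ℝ := fun y => Real.log (S.p y)
  have e : S.score = (InnerProductSpace.toDual ℝ (Euc d)).symm ∘ fderiv ℝ f := rfl
  refine ⟨?_, ?_, ?_⟩
  · rw [e]
    exact (InnerProductSpace.toDual ℝ (Euc d)).symm.contDiff.contDiffAt.comp x
      (hT.contDiff.fderiv_right (m := 2) (by norm_num)).contDiffAt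
  · rw [← norm_iteratedFDeriv_one, e, LinearIsometryEquiv.norm_iteratedFDeriv_comp_left,
      norm_iteratedFDeriv_fderiv]
    exact hT.hess x
  · rw [e, LinearIsometryEquiv.norm_iteratedFDeriv_comp_left, norm_iteratedFDeriv_fderiv]
    exact hT.third x

lemma TargetAssumption.nonneg_third (hT : S.TargetAssumption L M) : 0 ≤ M :=
  (norm_nonneg _).trans (hT.third 0)

/-- The coefficient in the bound for the second derivative of `scoreDiff`. -/
def hessCoeff (L M : ℝ) : ℝ := M + 2 * L + 2 * (L * √L)

/-- To second order, s_p(x) contributes MX² + LX, and ξ/σ contributes 2L√L and L times quantities at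
most X². Since X ≥ 1, a consequence of G ≥ 1, everything is absorbed into X². -/
lemma LayerAssumption.c2BoundAt_scoreDiff (hA : S.LayerAssumption G L)
    (hT : S.TargetAssumption L M) (φ : Euc m) (u : Euc dz × Euc d) :
    C2BoundAt (fun φ => S.scoreDiff φ u) φ (2 * L * growth G u)
      (hessCoeff L M * growth G u ^ 2) := by
  have hL := hA.L_pos
  have hM := hT.nonneg_third
  have hs := hT.score_bounds (S.reparam φ u)
  have h1 := (hA.c2BoundAt_reparam φ u).comp (fun ψ => (hT.score_bounds _).1) hs.2.1 hs.2.2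
  have hr := div_entrywise_bounds u.2 (hA.std_pos u.1 φ) (hA.inv_std_le u.1 φ) (Real.sqrt_nonneg L)
  have h2 := (hA.std.c2BoundAt u.1 φ).comp (fun ψ => (div_entrywise_bounds u.2
    (hA.std_pos u.1 ψ) (hA.inv_std_le u.1 ψ) (Real.sqrt_nonneg L)).1) hr.2.1 hr.2.2
  set t := ‖WithLp.ofLp u.2‖ with ht
  have ht0 : 0 ≤ t := norm_nonneg _
  set g := G * (1 + ‖u.1‖) with hg
  have hg1 : 1 ≤ g := one_le_mul_of_one_le_of_one_le hA.one_le (by linarith [norm_nonneg u.1])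
  have hX : growth G u = g * (1 + t) := rfl
  have hsq : √L ^ 2 = L := Real.sq_sqrt hL.le
  have hcube : √L ^ 3 = L * √L := by rw [pow_succ, hsq]
  have hX1 := one_le_growth hA.one_le u
  have hLL : 0 ≤ L * √L := by positivity
  have htX : t * g ≤ growth G u := by rw [hX]; nlinarith
  have hXX : growth G u ≤ growth G u ^ 2 := by nlinarith
  refine (h1.add h2).mono ?_ ?_
  · rw [hsq]
    nlinarith
  · have htg : t * g ^ 2 ≤ growth G u ^ 2 := by
      have : t ≤ (1 + t) ^ 2 := by nlinarith
      calc t * g ^ 2 = g ^ 2 * t := by ring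
        _ ≤ g ^ 2 * (1 + t) ^ 2 := mul_le_mul_of_nonneg_left this (sq_nonneg g)
        _ = growth G u ^ 2 := by rw [hX]; ring
    rw [hsq, hcube, hessCoeff]
    have e1 : L * growth G u ≤ L * growth G u ^ 2 := by gcongr
    have e2 : L * (t * g) ≤ L * growth G u ^ 2 := by
      gcongr
      exact htX.trans hXX
    have e3 : 2 * (L * √L) * (t * g ^ 2) ≤ 2 * (L * √L) * growth G u ^ 2 := by gcongr
    nlinarith

variable {H₀ : Type v} [NormedAddCommGroup H₀] [InnerProductSpace ℝ H₀]
  [CompleteSpace H₀] [RKHS ℝ H₀ (Euc d) ℝ]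

/-- The bound for the gradient of `pairLoss`, in terms of `X`, `X'`, `‖f‖`, `‖f'‖`. -/
def pairGradBound (B L X X' F F' : ℝ) : ℝ :=
  2 * B ^ 2 * (X + X') * (F * F') + B ^ 2 * (2 * L * X * F' + F * (2 * L * X'))

/-- The bound for the second derivative of `pairLoss`, in terms of `X`, `X'`, `‖f‖`, `‖f'‖`. -/
def pairHessBound (B L Q X X' F F' : ℝ) : ℝ :=
  6 * B ^ 2 * (X + X') ^ 2 * (F * F')
    + 4 * B ^ 2 * (X + X') * (2 * L * X * F' + F * (2 * L * X'))
    + B ^ 2 * (Q * X ^ 2 * F' + 8 * L ^ 2 * (X * X') + F * (Q * X' ^ 2))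

lemma LayerAssumption.c2BoundAt_pairLoss (hA : S.LayerAssumption G L)
    (hT : S.TargetAssumption L M) (hK : S.KernelAssumption B) (hk : IsRKHSOf H₀ S.k) (φ : Euc m)
    (u u' : Euc dz × Euc d) :
    C2BoundAt (fun φ => S.pairLoss φ u u') φ
      (pairGradBound B L (growth G u) (growth G u') ‖S.scoreDiff φ u‖ ‖S.scoreDiff φ u'‖)
      (pairHessBound B L (hessCoeff L M) (growth G u) (growth G u') ‖S.scoreDiff φ u‖
        ‖S.scoreDiff φ u'‖) := by
  have hX := hA.c2BoundAt_reparam φ u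
  have hX' := hA.c2BoundAt_reparam φ u'
  have hX1 := one_le_growth hA.one_le u
  have hX1' := one_le_growth hA.one_le u'
  have hf := hA.c2BoundAt_scoreDiff hT φ u
  have hf' := hA.c2BoundAt_scoreDiff hT φ u'
  have hpair : C2BoundAt (fun φ => (S.reparam φ u, S.reparam φ u')) φ
      (growth G u + growth G u') (growth G u + growth G u') := by
    have h := (hX.clm (ContinuousLinearMap.norm_inl_le_one ℝ (Euc d) (Euc d))).add
      (hX'.clm (ContinuousLinearMap.norm_inr_le_one ℝ (Euc d) (Euc d)))
    refine (h.mono (by linarith) (by linarith)).congr_fun fun ψ => ?_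
    simp
  have hκ := c2BoundAt_symmetric_kernel hK.contDiff hk.symm hK.grad₁ hK.grad₁₁ hK.grad₁₂
    (S.reparam φ u, S.reparam φ u')
  have hkx := hpair.comp (fun ψ => hK.contDiff.contDiffAt) hκ.fderiv_le hκ.hess_le
  have hin := hf.bilinear (A := (innerSL ℝ : Euc d →L[ℝ] Euc d →L[ℝ] ℝ))
    (norm_innerSL_le ℝ) hf' le_rfl le_rfl
  have hmul := hkx.bilinear (A := ContinuousLinearMap.mul ℝ ℝ)
    (ContinuousLinearMap.opNorm_mul_le ℝ ℝ) hin (p := B ^ 2)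
    (q := ‖S.scoreDiff φ u‖ * ‖S.scoreDiff φ u'‖)
    (by rw [Real.norm_eq_abs]; exact hk.abs_le hK.pos.le hK.le _ _)
    (by rw [innerSL_apply_apply, Real.norm_eq_abs]; exact abs_real_inner_le_norm _ _)
  set X := growth G u
  set X' := growth G u'
  set F := ‖S.scoreDiff φ u‖
  set F' := ‖S.scoreDiff φ u'‖
  have hF : 0 ≤ F := norm_nonneg _
  have hF' : 0 ≤ F' := norm_nonneg _
  refine hmul.mono ?_ ?_
  · unfold pairGradBound
    exact le_of_eq (by ring)
  · unfold pairHessBound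
    -- The chain rule for the kernel factor gives 4B²(X+X')² + 2B²(X+X'); as X + X' ≥ 1 this
    -- collapses to the coefficient 6.
    have hY : X + X' ≤ (X + X') ^ 2 := by nlinarith
    have h1 : 4 * B ^ 2 * (X + X') ^ 2 + 2 * B ^ 2 * (X + X') ≤ 6 * B ^ 2 * (X + X') ^ 2 := by
      have : 2 * B ^ 2 * (X + X') ≤ 2 * B ^ 2 * (X + X') ^ 2 := by gcongr
      linarith
    have h2 := mul_le_mul_of_nonneg_right h1 (mul_nonneg hF hF')
    refine le_trans (le_of_eq ?_) (add_le_add_left (add_le_add_left h2 _) _)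
    ring

end Model

/-! ### Integrating the pointwise bounds over two independent samples. -/

section PairMoments

open Model

variable {α : Type*} [MeasurableSpace α] {P : Measure α}
  {X F : α → ℝ} {a b : ℝ}

/-- Fourth moments control the mixed second moments. -/
lemma mixed_moments (hX : Measurable X) (hF : Measurable F)
    (hX4 : Integrable (fun x => X x ^ 4) P) (hF4 : Integrable (fun x => F x ^ 4) P)
    (ha : 0 < a) (hb : 0 < b) (hXa : ∫ x, X x ^ 4 ∂P ≤ a ^ 2) (hFb : ∫ x, F x ^ 4 ∂P ≤ b ^ 2) :
    Integrable (fun x => X x ^ 2 * F x ^ 2) P ∧ ∫ x, X x ^ 2 * F x ^ 2 ∂P ≤ a * b := by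
  -- AM-GM weighted so that both fourth moments contribute ab/2.
  have hpt : ∀ x, X x ^ 2 * F x ^ 2 ≤ b / (2 * a) * X x ^ 4 + a / (2 * b) * F x ^ 4 := by
    intro x
    have h : 0 ≤ (b * X x ^ 2 - a * F x ^ 2) ^ 2 / (2 * a * b) := by positivity
    have e : (b * X x ^ 2 - a * F x ^ 2) ^ 2 / (2 * a * b)
        = b / (2 * a) * X x ^ 4 + a / (2 * b) * F x ^ 4 - X x ^ 2 * F x ^ 2 := by
      field_simp
      ring
    linarith
  have hi : Integrable (fun x => b / (2 * a) * X x ^ 4 + a / (2 * b) * F x ^ 4) P :=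
    (hX4.const_mul _).add (hF4.const_mul _)
  have hi2 : Integrable (fun x => X x ^ 2 * F x ^ 2) P := by
    refine hi.mono' ((hX.pow_const 2).mul (hF.pow_const 2)).aestronglyMeasurable
      (.of_forall fun x => ?_)
    rw [Real.norm_of_nonneg (by positivity)]
    exact hpt x
  refine ⟨hi2, (integral_mono hi2 hi hpt).trans ?_⟩
  rw [integral_add (hX4.const_mul _) (hF4.const_mul _), integral_const_mul, integral_const_mul]
  calc _ ≤ b / (2 * a) * a ^ 2 + a / (2 * b) * b ^ 2 := by gcongr
    _ = a * b := by field_simp; ring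

variable [IsProbabilityMeasure P]

lemma second_moment (hX : Measurable X) (hX4 : Integrable (fun x => X x ^ 4) P)
    (ha : 0 < a) (hXa : ∫ x, X x ^ 4 ∂P ≤ a ^ 2) :
    Integrable (fun x => X x ^ 2) P ∧ ∫ x, X x ^ 2 ∂P ≤ a := by
  have h := mixed_moments (F := fun _ => 1) (b := 1) hX measurable_const hX4
    (by simp) ha one_pos hXa (by simp)
  simpa using h

lemma integral_prod_mul_le {p q : α → ℝ} {s t : ℝ} (hq : ∀ x, 0 ≤ q x)
    (hs : 0 ≤ s) (hps : ∫ x, p x ∂P ≤ s) (hqt : ∫ x, q x ∂P ≤ t) :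
    ∫ z, p z.1 * q z.2 ∂P.prod P ≤ s * t := by
  rw [integral_prod_mul]
  exact mul_le_mul hps hqt (integral_nonneg hq) hs

/-- Terms linear in f are made quadratic by f + f' ≤ (f²+f'²)/(2r) + r. What remains are products of
a function of one sample with a function of the other, all controlled by fourth moments. -/
lemma pairHessBound_le {B L Q r x x' f f' : ℝ} (hL : 0 ≤ L) (hQ : 0 ≤ Q) (hr : 0 < r)
    (hx : 0 ≤ x) (hx' : 0 ≤ x') (hf : 0 ≤ f) (hf' : 0 ≤ f') :
    pairHessBound B L Q x x' f f' ≤ B ^ 2 * ((6 + (16 * L + Q) / (2 * r))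
        * (x ^ 2 * f ^ 2 + x ^ 2 * f' ^ 2 + (f ^ 2 * x' ^ 2 + x' ^ 2 * f' ^ 2))
      + ((16 * L + Q) * r + 4 * L ^ 2) * (x ^ 2 + x' ^ 2)) := by
  have hw : (x + x') ^ 2 ≤ 2 * (x ^ 2 + x' ^ 2) := by nlinarith [sq_nonneg (x - x')]
  have hff : f * f' ≤ (f ^ 2 + f' ^ 2) / 2 := by nlinarith [sq_nonneg (f - f')]
  have hlin : f + f' ≤ (f ^ 2 + f' ^ 2) / (2 * r) + r := by
    have e : (f ^ 2 + f' ^ 2) / (2 * r) + r - (f + f')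
        = ((f - r) ^ 2 + (f' - r) ^ 2) / (2 * r) := by field_simp; ring
    have : 0 ≤ ((f - r) ^ 2 + (f' - r) ^ 2) / (2 * r) := by positivity
    linarith
  set w := x ^ 2 + x' ^ 2 with hwdef
  set s := f ^ 2 + f' ^ 2 with hs
  have hw0 : 0 ≤ w := by positivity
  have t1 : 6 * (x + x') ^ 2 * (f * f') ≤ 6 * (2 * w) * (s / 2) := by gcongr
  have t2 : 4 * (x + x') * (2 * L * x * f' + f * (2 * L * x'))
      ≤ 8 * L * ((2 * w) * (s / (2 * r) + r)) := by
    calc _ = 8 * L * ((x + x') * (x * f' + f * x')) := by ring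
      _ ≤ 8 * L * ((x + x') * ((x + x') * (f + f'))) := by
          refine mul_le_mul_of_nonneg_left (mul_le_mul_of_nonneg_left ?_ (by positivity))
            (by positivity)
          nlinarith [mul_nonneg hx hf, mul_nonneg hx' hf', mul_nonneg hx hf', mul_nonneg hx' hf]
      _ = 8 * L * ((x + x') ^ 2 * (f + f')) := by ring
      _ ≤ _ := by gcongr
  have t3 : Q * x ^ 2 * f' + f * (Q * x' ^ 2) ≤ Q * (w * (s / (2 * r) + r)) := by
    calc _ = Q * (x ^ 2 * f' + x' ^ 2 * f) := by ring
      _ ≤ Q * (w * (f + f')) := by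
          gcongr
          have := mul_nonneg (sq_nonneg x) hf
          have := mul_nonneg (sq_nonneg x') hf'
          nlinarith
      _ ≤ _ := by gcongr
  have t4 : 8 * L ^ 2 * (x * x') ≤ 4 * L ^ 2 * w := by
    have : 2 * (x * x') ≤ w := by nlinarith [sq_nonneg (x - x')]
    nlinarith [sq_nonneg L]
  unfold pairHessBound
  have e : B ^ 2 * ((6 + (16 * L + Q) / (2 * r))
        * (x ^ 2 * f ^ 2 + x ^ 2 * f' ^ 2 + (f ^ 2 * x' ^ 2 + x' ^ 2 * f' ^ 2))
      + ((16 * L + Q) * r + 4 * L ^ 2) * w)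
      = B ^ 2 * (6 * (2 * w) * (s / 2) + 8 * L * ((2 * w) * (s / (2 * r) + r))
        + Q * (w * (s / (2 * r) + r)) + 4 * L ^ 2 * w) := by
    rw [hwdef, hs]; ring
  rw [e]
  have := mul_le_mul_of_nonneg_left (add_le_add (add_le_add (add_le_add t1 t2) t3) t4) (sq_nonneg B)
  refine le_trans (le_of_eq ?_) this
  ring

/-- Each sample enters through at most x²f², so fourth moments suffice after factoring over the two
samples. -/
lemma pairGradBound_sq_le {B L x x' f f' : ℝ} :
    pairGradBound B L x x' f f' ^ 2 ≤ 16 * B ^ 4 * ((x ^ 2 * f ^ 2 * f' ^ 2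
      + f ^ 2 * (x' ^ 2 * f' ^ 2)) + L ^ 2 * (x ^ 2 * f' ^ 2 + f ^ 2 * x' ^ 2)) := by
  unfold pairGradBound
  set p := 2 * (x + x') * (f * f')
  set q := 2 * L * (x * f' + f * x')
  have e : 2 * B ^ 2 * (x + x') * (f * f') + B ^ 2 * (2 * L * x * f' + f * (2 * L * x'))
      = B ^ 2 * (p + q) := by ring
  have h1 : (p + q) ^ 2 ≤ 2 * p ^ 2 + 2 * q ^ 2 := by nlinarith [sq_nonneg (p - q)]
  have h2 : p ^ 2 ≤ 8 * ((x ^ 2 + x' ^ 2) * (f * f') ^ 2) := by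
    have : (x + x') ^ 2 ≤ 2 * (x ^ 2 + x' ^ 2) := by nlinarith [sq_nonneg (x - x')]
    have := mul_le_mul_of_nonneg_right this (sq_nonneg (f * f'))
    calc p ^ 2 = 4 * ((x + x') ^ 2 * (f * f') ^ 2) := by ring
      _ ≤ _ := by linarith
  have h3 : q ^ 2 ≤ 8 * L ^ 2 * (x ^ 2 * f' ^ 2 + f ^ 2 * x' ^ 2) := by
    have : (x * f' + f * x') ^ 2 ≤ 2 * (x ^ 2 * f' ^ 2 + f ^ 2 * x' ^ 2) := by
      nlinarith [sq_nonneg (x * f' - f * x')]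
    calc q ^ 2 = 4 * L ^ 2 * (x * f' + f * x') ^ 2 := by ring
      _ ≤ 4 * L ^ 2 * (2 * (x ^ 2 * f' ^ 2 + f ^ 2 * x' ^ 2)) := by gcongr
      _ = _ := by ring
  rw [e, mul_pow]
  have h4 : (p + q) ^ 2 ≤ 16 * ((x ^ 2 * f ^ 2 * f' ^ 2 + f ^ 2 * (x' ^ 2 * f' ^ 2))
      + L ^ 2 * (x ^ 2 * f' ^ 2 + f ^ 2 * x' ^ 2)) := by
    refine h1.trans (le_trans (add_le_add (mul_le_mul_of_nonneg_left h2 zero_le_two)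
      (mul_le_mul_of_nonneg_left h3 zero_le_two)) (le_of_eq ?_))
    ring
  have h5 := mul_le_mul_of_nonneg_left h4 (sq_nonneg (B ^ 2))
  exact h5.trans (le_of_eq (by ring))

/-- The expectation of `pairHessBound` over two independent samples. -/
lemma integral_pairHessBound_le {B L Q : ℝ} (hL : 0 ≤ L) (hQ : 0 ≤ Q)
    (hX : Measurable X) (hF : Measurable F) (hX0 : ∀ x, 0 ≤ X x) (hF0 : ∀ x, 0 ≤ F x)
    (hX4 : Integrable (fun x => X x ^ 4) P) (hF4 : Integrable (fun x => F x ^ 4) P)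
    (ha : 0 < a) (hb : 0 < b) (hXa : ∫ x, X x ^ 4 ∂P ≤ a ^ 2) (hFb : ∫ x, F x ^ 4 ∂P ≤ b ^ 2) :
    Integrable (fun z : α × α => pairHessBound B L Q (X z.1) (X z.2) (F z.1) (F z.2)) (P.prod P) ∧
    ∫ z : α × α, pairHessBound B L Q (X z.1) (X z.2) (F z.1) (F z.2) ∂P.prod P
      ≤ B ^ 2 * (24 * (a * b) + 4 * (16 * L + Q) * (a * √b) + 8 * L ^ 2 * a) := by
  obtain ⟨iX, mX⟩ := second_moment hX hX4 ha hXa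
  obtain ⟨iF, mF⟩ := second_moment hF hF4 hb hFb
  obtain ⟨iXF, mXF⟩ := mixed_moments hX hF hX4 hF4 ha hb hXa hFb
  have i1 : Integrable (fun _ : α => (1 : ℝ)) P := integrable_const _
  have m1 : ∫ _, (1 : ℝ) ∂P ≤ 1 := by simp
  -- This choice balances 4ab/(2r) against 2ar, for a total of 4a√b.
  set r := √b with hr
  have hr0 : 0 < r := Real.sqrt_pos.2 hb
  have hrb : r ^ 2 = b := Real.sq_sqrt hb.le
  -- the eight products
  have j1 : Integrable (fun z : α × α => X z.1 ^ 2 * F z.1 ^ 2) (P.prod P) := by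
    simpa using iXF.mul_prod i1
  have j2 : Integrable (fun z : α × α => X z.1 ^ 2 * F z.2 ^ 2) (P.prod P) := iX.mul_prod iF
  have j3 : Integrable (fun z : α × α => F z.1 ^ 2 * X z.2 ^ 2) (P.prod P) := iF.mul_prod iX
  have j4 : Integrable (fun z : α × α => X z.2 ^ 2 * F z.2 ^ 2) (P.prod P) := by
    simpa using i1.mul_prod iXF
  have j5 : Integrable (fun z : α × α => X z.1 ^ 2) (P.prod P) := by
    simpa using iX.mul_prod i1
  have j6 : Integrable (fun z : α × α => X z.2 ^ 2) (P.prod P) := by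
    simpa using i1.mul_prod iX
  have k1 : ∫ z : α × α, X z.1 ^ 2 * F z.1 ^ 2 ∂P.prod P ≤ a * b := by
    simpa using integral_prod_mul_le (P := P) (p := fun x => X x ^ 2 * F x ^ 2) (q := fun _ => 1)
      (fun _ => zero_le_one) (by positivity) mXF m1
  have k2 : ∫ z : α × α, X z.1 ^ 2 * F z.2 ^ 2 ∂P.prod P ≤ a * b :=
    integral_prod_mul_le (p := fun x => X x ^ 2) (q := fun x => F x ^ 2) (fun x => sq_nonneg _)
      ha.le mX mF
  have k3 : ∫ z : α × α, F z.1 ^ 2 * X z.2 ^ 2 ∂P.prod P ≤ b * a :=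
    integral_prod_mul_le (p := fun x => F x ^ 2) (q := fun x => X x ^ 2) (fun x => sq_nonneg _)
      hb.le mF mX
  have k4 : ∫ z : α × α, X z.2 ^ 2 * F z.2 ^ 2 ∂P.prod P ≤ a * b := by
    simpa using integral_prod_mul_le (P := P) (p := fun _ => 1) (q := fun x => X x ^ 2 * F x ^ 2)
      (fun x => by positivity) zero_le_one m1 mXF
  have k5 : ∫ z : α × α, X z.1 ^ 2 ∂P.prod P ≤ a := by
    simpa using integral_prod_mul_le (P := P) (p := fun x => X x ^ 2) (q := fun _ => 1)
      (fun _ => zero_le_one) ha.le mX m1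
  have k6 : ∫ z : α × α, X z.2 ^ 2 ∂P.prod P ≤ a := by
    simpa using integral_prod_mul_le (P := P) (p := fun _ => 1) (q := fun x => X x ^ 2)
      (fun x => by positivity) zero_le_one m1 mX
  set U : α × α → ℝ := fun z => B ^ 2 * ((6 + (16 * L + Q) / (2 * r))
        * (X z.1 ^ 2 * F z.1 ^ 2 + X z.1 ^ 2 * F z.2 ^ 2
          + (F z.1 ^ 2 * X z.2 ^ 2 + X z.2 ^ 2 * F z.2 ^ 2))
      + ((16 * L + Q) * r + 4 * L ^ 2) * (X z.1 ^ 2 + X z.2 ^ 2)) with hU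
  have l12 := j1.add j2
  have l34 := j3.add j4
  have l14 := l12.add l34
  have l56 := j5.add j6
  have iU : Integrable U (P.prod P) := ((l14.const_mul _).add (l56.const_mul _)).const_mul _
  have hle : ∀ z : α × α, pairHessBound B L Q (X z.1) (X z.2) (F z.1) (F z.2) ≤ U z := fun z =>
    pairHessBound_le hL hQ hr0 (hX0 _) (hX0 _) (hF0 _) (hF0 _)
  have h0 : ∀ z : α × α, 0 ≤ pairHessBound B L Q (X z.1) (X z.2) (F z.1) (F z.2) := by
    intro z
    have := hX0 z.1
    have := hX0 z.2
    have := hF0 z.1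
    have := hF0 z.2
    unfold pairHessBound
    positivity
  have hm : Measurable fun z : α × α => pairHessBound B L Q (X z.1) (X z.2) (F z.1) (F z.2) := by
    have hX1 : Measurable fun z : α × α => X z.1 := hX.comp measurable_fst
    have hX2 : Measurable fun z : α × α => X z.2 := hX.comp measurable_snd
    have hF1 : Measurable fun z : α × α => F z.1 := hF.comp measurable_fst
    have hF2 : Measurable fun z : α × α => F z.2 := hF.comp measurable_snd
    unfold pairHessBound
    fun_prop
  have iH : Integrable (fun z : α × α => pairHessBound B L Q (X z.1) (X z.2) (F z.1) (F z.2))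
      (P.prod P) := by
    refine iU.mono' hm.aestronglyMeasurable (.of_forall fun z => ?_)
    rw [Real.norm_of_nonneg (h0 z)]
    exact hle z
  refine ⟨iH, (integral_mono iH iU hle).trans ?_⟩
  have eU : ∫ z, U z ∂P.prod P = B ^ 2 * ((6 + (16 * L + Q) / (2 * r))
        * ((∫ z : α × α, X z.1 ^ 2 * F z.1 ^ 2 ∂P.prod P)
          + (∫ z : α × α, X z.1 ^ 2 * F z.2 ^ 2 ∂P.prod P)
          + ((∫ z : α × α, F z.1 ^ 2 * X z.2 ^ 2 ∂P.prod P)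
          + ∫ z : α × α, X z.2 ^ 2 * F z.2 ^ 2 ∂P.prod P))
      + ((16 * L + Q) * r + 4 * L ^ 2) * ((∫ z : α × α, X z.1 ^ 2 ∂P.prod P)
        + ∫ z : α × α, X z.2 ^ 2 ∂P.prod P)) := by
    rw [← integral_add j1 j2, ← integral_add j3 j4, ← integral_add j5 j6]
    have := integral_add l12 l34
    simp only [Pi.add_apply] at this
    rw [← this, ← integral_const_mul, ← integral_const_mul]
    have := integral_add (l14.const_mul (6 + (16 * L + Q) / (2 * r)))
      (l56.const_mul ((16 * L + Q) * r + 4 * L ^ 2))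
    simp only [Pi.add_apply] at this
    rw [← this, ← integral_const_mul]
  rw [eU]
  calc _ ≤ B ^ 2 * ((6 + (16 * L + Q) / (2 * r)) * (a * b + a * b + (b * a + a * b))
      + ((16 * L + Q) * r + 4 * L ^ 2) * (a + a)) := by gcongr
    _ = _ := by
      rw [← hrb]
      field_simp
      ring

/-- The expectation of the square of `pairGradBound` over two independent samples. -/
lemma integral_pairGradBound_sq_le {B L : ℝ}
    (hX : Measurable X) (hF : Measurable F)
    (hX4 : Integrable (fun x => X x ^ 4) P) (hF4 : Integrable (fun x => F x ^ 4) P)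
    (ha : 0 < a) (hb : 0 < b) (hXa : ∫ x, X x ^ 4 ∂P ≤ a ^ 2) (hFb : ∫ x, F x ^ 4 ∂P ≤ b ^ 2) :
    MemLp (fun z : α × α => pairGradBound B L (X z.1) (X z.2) (F z.1) (F z.2)) 2 (P.prod P) ∧
    ∫ z : α × α, pairGradBound B L (X z.1) (X z.2) (F z.1) (F z.2) ^ 2 ∂P.prod P
      ≤ 32 * B ^ 4 * (a * b * (b + L ^ 2)) := by
  obtain ⟨iX, mX⟩ := second_moment hX hX4 ha hXa
  obtain ⟨iF, mF⟩ := second_moment hF hF4 hb hFb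
  obtain ⟨iXF, mXF⟩ := mixed_moments hX hF hX4 hF4 ha hb hXa hFb
  have j1 : Integrable (fun z : α × α => X z.1 ^ 2 * F z.1 ^ 2 * F z.2 ^ 2) (P.prod P) :=
    iXF.mul_prod iF
  have j2 : Integrable (fun z : α × α => F z.1 ^ 2 * (X z.2 ^ 2 * F z.2 ^ 2)) (P.prod P) :=
    iF.mul_prod iXF
  have j3 : Integrable (fun z : α × α => X z.1 ^ 2 * F z.2 ^ 2) (P.prod P) := iX.mul_prod iF
  have j4 : Integrable (fun z : α × α => F z.1 ^ 2 * X z.2 ^ 2) (P.prod P) := iF.mul_prod iX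
  have k1 : ∫ z : α × α, X z.1 ^ 2 * F z.1 ^ 2 * F z.2 ^ 2 ∂P.prod P ≤ a * b * b :=
    integral_prod_mul_le (p := fun x => X x ^ 2 * F x ^ 2) (q := fun x => F x ^ 2)
      (fun x => sq_nonneg _) (by positivity) mXF mF
  have k2 : ∫ z : α × α, F z.1 ^ 2 * (X z.2 ^ 2 * F z.2 ^ 2) ∂P.prod P ≤ b * (a * b) :=
    integral_prod_mul_le (p := fun x => F x ^ 2) (q := fun x => X x ^ 2 * F x ^ 2)
      (fun x => by positivity) hb.le mF mXF
  have k3 : ∫ z : α × α, X z.1 ^ 2 * F z.2 ^ 2 ∂P.prod P ≤ a * b :=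
    integral_prod_mul_le (p := fun x => X x ^ 2) (q := fun x => F x ^ 2) (fun x => sq_nonneg _)
      ha.le mX mF
  have k4 : ∫ z : α × α, F z.1 ^ 2 * X z.2 ^ 2 ∂P.prod P ≤ b * a :=
    integral_prod_mul_le (p := fun x => F x ^ 2) (q := fun x => X x ^ 2) (fun x => sq_nonneg _)
      hb.le mF mX
  set U : α × α → ℝ := fun z => 16 * B ^ 4 * ((X z.1 ^ 2 * F z.1 ^ 2 * F z.2 ^ 2
      + F z.1 ^ 2 * (X z.2 ^ 2 * F z.2 ^ 2))
      + L ^ 2 * (X z.1 ^ 2 * F z.2 ^ 2 + F z.1 ^ 2 * X z.2 ^ 2)) with hU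
  have l12 := j1.add j2
  have l34 := (j3.add j4).const_mul (L ^ 2)
  have iU : Integrable U (P.prod P) := (l12.add l34).const_mul _
  have hle : ∀ z : α × α, pairGradBound B L (X z.1) (X z.2) (F z.1) (F z.2) ^ 2 ≤ U z := fun z =>
    pairGradBound_sq_le
  have hm : Measurable fun z : α × α => pairGradBound B L (X z.1) (X z.2) (F z.1) (F z.2) := by
    have hX1 : Measurable fun z : α × α => X z.1 := hX.comp measurable_fst
    have hX2 : Measurable fun z : α × α => X z.2 := hX.comp measurable_snd
    have hF1 : Measurable fun z : α × α => F z.1 := hF.comp measurable_fst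
    have hF2 : Measurable fun z : α × α => F z.2 := hF.comp measurable_snd
    unfold pairGradBound
    fun_prop
  have iH : Integrable (fun z : α × α => pairGradBound B L (X z.1) (X z.2) (F z.1) (F z.2) ^ 2)
      (P.prod P) := by
    refine iU.mono' (hm.pow_const 2).aestronglyMeasurable (.of_forall fun z => ?_)
    rw [Real.norm_of_nonneg (sq_nonneg _)]
    exact hle z
  refine ⟨(memLp_two_iff_integrable_sq hm.aestronglyMeasurable).2 iH,
    (integral_mono iH iU hle).trans ?_⟩
  have eU : ∫ z, U z ∂P.prod P = 16 * B ^ 4 * (((∫ z : α × α, X z.1 ^ 2 * F z.1 ^ 2 * F z.2 ^ 2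
      ∂P.prod P) + ∫ z : α × α, F z.1 ^ 2 * (X z.2 ^ 2 * F z.2 ^ 2) ∂P.prod P)
      + L ^ 2 * ((∫ z : α × α, X z.1 ^ 2 * F z.2 ^ 2 ∂P.prod P)
        + ∫ z : α × α, F z.1 ^ 2 * X z.2 ^ 2 ∂P.prod P)) := by
    rw [← integral_add j1 j2, ← integral_add j3 j4, ← integral_const_mul]
    have := integral_add l12 l34
    simp only [Pi.add_apply] at this
    rw [← this, ← integral_const_mul]
  rw [eU]
  calc _ ≤ 16 * B ^ 4 * ((a * b * b + b * (a * b)) + L ^ 2 * (a * b + b * a)) := by gcongr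
    _ = _ := by ring

end PairMoments

/-! ### Fourth moments of `growth` and `scoreDiff`. -/

lemma scoreConst_nonneg (L s : ℝ) {d : ℕ} (x : Euc d) : 0 ≤ scoreConst L s x := Real.sqrt_nonneg _

lemma add_pow_four_le (x y : ℝ) : (x + y) ^ 4 ≤ 8 * (x ^ 4 + y ^ 4) := by
  have h1 : (x + y) ^ 2 ≤ 2 * (x ^ 2 + y ^ 2) := by nlinarith [sq_nonneg (x - y)]
  have h2 : (x ^ 2 + y ^ 2) ^ 2 ≤ 2 * (x ^ 4 + y ^ 4) := by nlinarith [sq_nonneg (x ^ 2 - y ^ 2)]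
  have h3 : ((x + y) ^ 2) ^ 2 ≤ (2 * (x ^ 2 + y ^ 2)) ^ 2 := pow_le_pow_left₀ (sq_nonneg _) h1 2
  nlinarith

lemma add_three_pow_four_le (x y z : ℝ) : (x + y + z) ^ 4 ≤ 27 * (x ^ 4 + y ^ 4 + z ^ 4) := by
  have h1 : (x + y + z) ^ 2 ≤ 3 * (x ^ 2 + y ^ 2 + z ^ 2) := by
    nlinarith [sq_nonneg (x - y), sq_nonneg (y - z), sq_nonneg (x - z)]
  have h2 : (x ^ 2 + y ^ 2 + z ^ 2) ^ 2 ≤ 3 * (x ^ 4 + y ^ 4 + z ^ 4) := by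
    nlinarith [sq_nonneg (x ^ 2 - y ^ 2), sq_nonneg (y ^ 2 - z ^ 2), sq_nonneg (x ^ 2 - z ^ 2)]
  have h3 : ((x + y + z) ^ 2) ^ 2 ≤ (3 * (x ^ 2 + y ^ 2 + z ^ 2)) ^ 2 :=
    pow_le_pow_left₀ (sq_nonneg _) h1 2
  nlinarith

namespace Model

variable {m dz d : ℕ} {S : Model m dz d} {B G L M K s : ℝ}

/-- The bound for the root of the fourth moment of `growth`. -/
def growthMoment (K G : ℝ) (dz d : ℕ) : ℝ := 200 * (1 + max K 0) * (G ^ 2 * dz * Real.log d)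

lemma growthMoment_pos (hG : 1 ≤ G) (hdz : 1 ≤ dz) (hd : 2 ≤ d) : 0 < growthMoment K G dz d := by
  have h1 : 0 < Real.log d := Real.log_pos (by exact_mod_cast hd)
  have h2 : (0 : ℝ) < dz := by exact_mod_cast hdz
  have h3 : 0 ≤ max K 0 := le_max_right _ _
  unfold growthMoment
  positivity

lemma MomentAssumption.lintegral_one_add_norm_pow_four_le (hS : S.MomentAssumption K s)
    (hdz : 1 ≤ dz) :
    ∫⁻ z, ENNReal.ofReal ((1 + ‖z‖) ^ 4) ∂S.mix
      ≤ ENNReal.ofReal (8 * (1 + max K 0) * (dz : ℝ) ^ 2) := by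
  have := hS.isProb
  have hdz' : (1 : ℝ) ≤ (dz : ℝ) ^ 2 := one_le_pow₀ (by exact_mod_cast hdz)
  have hK : 0 ≤ max K 0 := le_max_right _ _
  calc _ ≤ ∫⁻ z, ENNReal.ofReal 8 * (ENNReal.ofReal 1 + ‖z‖ₑ ^ 4) ∂S.mix := by
        refine lintegral_mono fun z => ?_
        rw [← ofReal_norm, ← ENNReal.ofReal_pow (norm_nonneg z),
          ← ENNReal.ofReal_add zero_le_one (by positivity), ← ENNReal.ofReal_mul (by norm_num)]
        refine ENNReal.ofReal_le_ofReal ((add_pow_four_le 1 ‖z‖).trans (le_of_eq ?_))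
        ring
    _ = ENNReal.ofReal 8 * (ENNReal.ofReal 1 + ∫⁻ z, ‖z‖ₑ ^ 4 ∂S.mix) := by
        rw [lintegral_const_mul _ (by fun_prop), lintegral_add_left measurable_const,
          lintegral_const, measure_univ, mul_one]
    _ ≤ ENNReal.ofReal 8 * (ENNReal.ofReal 1 + ENNReal.ofReal (max K 0 * (dz : ℝ) ^ 2)) := by
        gcongr
        refine hS.mix.trans (ENNReal.ofReal_le_ofReal ?_)
        gcongr
        exact le_max_left _ _
    _ ≤ _ := by
        rw [← ENNReal.ofReal_add zero_le_one (by positivity), ← ENNReal.ofReal_mul (by norm_num)]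
        refine ENNReal.ofReal_le_ofReal ?_
        nlinarith

/-- Independence of z and ξ factors the fourth moment. The constants 8 and 2500 of the two factors
give 20000 ≤ 200². -/
lemma MomentAssumption.integral_growth_pow_four_le (hS : S.MomentAssumption K s) (hG : 1 ≤ G)
    (hdz : 1 ≤ dz) (hd : 2 ≤ d) :
    Integrable (fun u => growth G u ^ 4) S.noise ∧
      ∫ u, growth G u ^ 4 ∂S.noise ≤ growthMoment K G dz d ^ 2 := by
  have := hS.isProb
  have hK : 0 ≤ max K 0 := le_max_right _ _
  refine integrable_and_integral_le_of_lintegral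
    (measurable_growth.pow_const 4).aestronglyMeasurable
    (fun u => pow_nonneg (growth_nonneg hG u) 4) (sq_nonneg _) ?_
  have hm : Measurable fun ξ : Euc d => ENNReal.ofReal ((1 + ‖WithLp.ofLp ξ‖) ^ 4) :=
    ((measurable_supNorm.const_add 1).pow_const 4).ennreal_ofReal
  calc _ = ∫⁻ u, ENNReal.ofReal (G ^ 4 * (1 + ‖u.1‖) ^ 4)
        * ENNReal.ofReal ((1 + ‖WithLp.ofLp u.2‖) ^ 4) ∂S.noise := by
        refine lintegral_congr fun u => ?_
        rw [← ENNReal.ofReal_mul (by positivity), growth]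
        ring_nf
    _ = (∫⁻ z, ENNReal.ofReal (G ^ 4 * (1 + ‖z‖) ^ 4) ∂S.mix)
        * ∫⁻ ξ : Euc d, ENNReal.ofReal ((1 + ‖WithLp.ofLp ξ‖) ^ 4) ∂stdGaussian (Euc d) :=
        lintegral_prod_mul (f := fun z : Euc dz => ENNReal.ofReal (G ^ 4 * (1 + ‖z‖) ^ 4))
          (by fun_prop) hm.aemeasurable
    _ ≤ ENNReal.ofReal (G ^ 4 * (8 * (1 + max K 0) * (dz : ℝ) ^ 2))
        * ENNReal.ofReal (2500 * Real.log d ^ 2) := by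
        refine mul_le_mul' ?_ (lintegral_one_add_supNorm_pow_four_le hd)
        have e : ∀ z : Euc dz, ENNReal.ofReal (G ^ 4 * (1 + ‖z‖) ^ 4)
            = ENNReal.ofReal (G ^ 4) * ENNReal.ofReal ((1 + ‖z‖) ^ 4) := fun z =>
          ENNReal.ofReal_mul (by positivity)
        simp_rw [e]
        rw [lintegral_const_mul _ (by fun_prop), ENNReal.ofReal_mul (by positivity)]
        gcongr
        exact hS.lintegral_one_add_norm_pow_four_le hdz
    _ ≤ _ := by
        rw [← ENNReal.ofReal_mul (by positivity)]
        refine ENNReal.ofReal_le_ofReal ?_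
        unfold growthMoment
        have h : 20000 * (1 + max K 0) ≤ (200 * (1 + max K 0)) ^ 2 := by nlinarith
        calc _ = 20000 * (1 + max K 0) * (G ^ 2 * dz * Real.log d) ^ 2 := by ring
          _ ≤ (200 * (1 + max K 0)) ^ 2 * (G ^ 2 * dz * Real.log d) ^ 2 := by gcongr
          _ = _ := by ring

lemma TargetAssumption.norm_score_le (hT : S.TargetAssumption L M) {xstar : Euc d}
    (hx : S.score xstar = 0) (x : Euc d) : ‖S.score x‖ ≤ L * ‖x‖ + L * ‖xstar‖ := by
  have hL : 0 ≤ L := (norm_nonneg _).trans (hT.hess 0)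
  have h := convex_univ.norm_image_sub_le_of_norm_fderiv_le (𝕜 := ℝ) (f := S.score)
    (fun y _ => (hT.score_bounds y).1.differentiableAt (by norm_num))
    (fun y _ => (hT.score_bounds y).2.1) (Set.mem_univ xstar) (Set.mem_univ x)
  rw [hx, sub_zero] at h
  rw [← mul_add]
  exact h.trans (mul_le_mul_of_nonneg_left (norm_sub_le _ _) hL)

lemma LayerAssumption.norm_scoreDiff_pow_four_le (hA : S.LayerAssumption G L)
    (hT : S.TargetAssumption L M) {xstar : Euc d} (hx : S.score xstar = 0) (φ : Euc m)
    (u : Euc dz × Euc d) :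
    ‖S.scoreDiff φ u‖ ^ 4
      ≤ 27 * (L ^ 4 * ‖S.reparam φ u‖ ^ 4 + L ^ 4 * ‖xstar‖ ^ 4 + L ^ 2 * ‖u.2‖ ^ 4) := by
  have hL := hA.L_pos
  have h1 : ‖(WithLp.toLp 2 fun i => u.2 i / S.std u.1 φ i : Euc d)‖ ≤ √L * ‖u.2‖ := by
    have h := norm_hadamard_apply_le (a := WithLp.toLp 2 fun i => (S.std u.1 φ i)⁻¹)
      (Real.sqrt_nonneg L) (fun i => by
        rw [PiLp.toLp_apply, abs_of_pos (inv_pos.2 (hA.std_pos u.1 φ i))]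
        exact hA.inv_std_le u.1 φ i) u.2
    refine le_trans (le_of_eq ?_) h
    congr 1
    ext i
    simp [hadamard_apply, div_eq_inv_mul]
  have h2 : ‖S.scoreDiff φ u‖ ≤ L * ‖S.reparam φ u‖ + L * ‖xstar‖ + √L * ‖u.2‖ :=
    (norm_add_le _ _).trans (add_le_add (hT.norm_score_le hx _) h1)
  have h4 : √L ^ 4 = L ^ 2 := by
    rw [show (4 : ℕ) = 2 * 2 from rfl, pow_mul, Real.sq_sqrt hL.le]
  calc _ ≤ (L * ‖S.reparam φ u‖ + L * ‖xstar‖ + √L * ‖u.2‖) ^ 4 :=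
        pow_le_pow_left₀ (norm_nonneg _) h2 4
    _ ≤ _ := add_three_pow_four_le _ _ _
    _ = _ := by rw [mul_pow, mul_pow, mul_pow, h4]

/-- The bound for the root of the fourth moment of `scoreDiff`. -/
def scoreMoment (L s : ℝ) {d : ℕ} (xstar : Euc d) : ℝ := 42 * (L * d + scoreConst L s xstar)

lemma scoreMoment_pos (hL : 0 < L) (hd : 2 ≤ d) (xstar : Euc d) : 0 < scoreMoment L s xstar := by
  have h := scoreConst_nonneg L s xstar
  have : (0 : ℝ) < d := by positivity
  unfold scoreMoment
  positivity

lemma LayerAssumption.integral_norm_scoreDiff_pow_four_le (hA : S.LayerAssumption G L)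
    (hT : S.TargetAssumption L M) (hS : S.MomentAssumption K s) {xstar : Euc d}
    (hx : S.score xstar = 0) (φ : Euc m) :
    Integrable (fun u => ‖S.scoreDiff φ u‖ ^ 4) S.noise ∧
      ∫ u, ‖S.scoreDiff φ u‖ ^ 4 ∂S.noise ≤ scoreMoment L s xstar ^ 2 := by
  have := hS.isProb
  have hL := hA.L_pos
  refine integrable_and_integral_le_of_lintegral
    ((hA.measurable_scoreDiff hT φ).norm.pow_const 4).aestronglyMeasurable
    (fun u => by positivity) (sq_nonneg _) ?_
  have hr := hA.measurable_reparam φ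
  have e1 : ∫⁻ u, ENNReal.ofReal (‖S.reparam φ u‖ ^ 4) ∂S.noise ≤ ENNReal.ofReal (s ^ 4) := by
    refine le_trans (le_of_eq ?_) (hS.var φ)
    rw [← hA.map_reparam_noise φ, lintegral_map (by fun_prop) hr]
    refine lintegral_congr fun u => ?_
    rw [ENNReal.ofReal_pow (norm_nonneg _), ofReal_norm]
  have e2 : ∫⁻ u, ENNReal.ofReal (‖u.2‖ ^ 4) ∂S.noise ≤ ENNReal.ofReal (64 * (d : ℝ) ^ 2) := by
    refine le_trans (le_of_eq ?_) lintegral_norm_pow_four_stdGaussian_le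
    have h := lintegral_prod_mul (μ := S.mix) (ν := stdGaussian (Euc d)) (f := fun _ => 1)
      (g := fun ξ : Euc d => ENNReal.ofReal (‖ξ‖ ^ 4)) (by fun_prop) (by fun_prop)
    simpa [noise] using h
  calc _ ≤ ∫⁻ u, ENNReal.ofReal 27 * (ENNReal.ofReal (L ^ 4) * ENNReal.ofReal (‖S.reparam φ u‖ ^ 4)
        + ENNReal.ofReal (L ^ 4 * ‖xstar‖ ^ 4)
        + ENNReal.ofReal (L ^ 2) * ENNReal.ofReal (‖u.2‖ ^ 4)) ∂S.noise := by
        refine lintegral_mono fun u => ?_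
        rw [← ENNReal.ofReal_mul (by positivity), ← ENNReal.ofReal_mul (by positivity),
          ← ENNReal.ofReal_add (by positivity) (by positivity),
          ← ENNReal.ofReal_add (by positivity) (by positivity), ← ENNReal.ofReal_mul (by positivity)]
        exact ENNReal.ofReal_le_ofReal (hA.norm_scoreDiff_pow_four_le hT hx φ u)
    _ = ENNReal.ofReal 27 * (ENNReal.ofReal (L ^ 4)
          * ∫⁻ u, ENNReal.ofReal (‖S.reparam φ u‖ ^ 4) ∂S.noise
        + ENNReal.ofReal (L ^ 4 * ‖xstar‖ ^ 4)
        + ENNReal.ofReal (L ^ 2) * ∫⁻ u, ENNReal.ofReal (‖u.2‖ ^ 4) ∂S.noise) := by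
        rw [lintegral_const_mul _ (by fun_prop), lintegral_add_right _ (by fun_prop),
          lintegral_add_right _ (by fun_prop), lintegral_const_mul _ (by fun_prop),
          lintegral_const_mul _ (by fun_prop), lintegral_const, measure_univ, mul_one]
    _ ≤ ENNReal.ofReal 27 * (ENNReal.ofReal (L ^ 4) * ENNReal.ofReal (s ^ 4)
        + ENNReal.ofReal (L ^ 4 * ‖xstar‖ ^ 4)
        + ENNReal.ofReal (L ^ 2) * ENNReal.ofReal (64 * (d : ℝ) ^ 2)) := by gcongr
    _ ≤ _ := by
        rw [← ENNReal.ofReal_mul (by positivity), ← ENNReal.ofReal_mul (by positivity),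
          ← ENNReal.ofReal_add (by positivity) (by positivity),
          ← ENNReal.ofReal_add (by positivity) (by positivity), ← ENNReal.ofReal_mul (by positivity)]
        refine ENNReal.ofReal_le_ofReal ?_
        have hC0 := scoreConst_nonneg L s xstar
        have hC : scoreConst L s xstar ^ 2 = L ^ 4 * (s ^ 4 + ‖xstar‖ ^ 4) :=
          Real.sq_sqrt (by positivity)
        have hLd : 0 ≤ L * d * scoreConst L s xstar := by positivity
        unfold scoreMoment
        -- The left side is 27C² + 27·64(Ld)², and 27·64 = 1728 ≤ 42².
        nlinarith [sq_nonneg (L * d), sq_nonneg (scoreConst L s xstar)]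

end Model

/-! ### Smoothness of the loss and the second moment of the pair gradient. -/

namespace Model

variable {m dz d : ℕ} {S : Model m dz d} {B G L M K s : ℝ}

lemma pairGradBound_mono {x x' f f' g g' : ℝ} (hL : 0 ≤ L) (hx : 0 ≤ x) (hx' : 0 ≤ x')
    (hf : 0 ≤ f) (hf' : 0 ≤ f') (hfg : f ≤ g) (hfg' : f' ≤ g') :
    pairGradBound B L x x' f f' ≤ pairGradBound B L x x' g g' := by
  have hg : 0 ≤ g := hf.trans hfg
  unfold pairGradBound
  gcongr

lemma pairHessBound_mono {Q x x' f f' g g' : ℝ} (hL : 0 ≤ L) (hQ : 0 ≤ Q) (hx : 0 ≤ x)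
    (hx' : 0 ≤ x') (hf : 0 ≤ f) (hf' : 0 ≤ f') (hfg : f ≤ g) (hfg' : f' ≤ g') :
    pairHessBound B L Q x x' f f' ≤ pairHessBound B L Q x x' g g' := by
  have hg : 0 ≤ g := hf.trans hfg
  unfold pairHessBound
  gcongr

lemma hessCoeff_nonneg (hL : 0 ≤ L) (hM : 0 ≤ M) : 0 ≤ hessCoeff L M := by
  unfold hessCoeff
  positivity

/-- A bound for `scoreDiff` on the unit ball around `φ`. -/
def localBound (S : Model m dz d) (G L : ℝ) (φ : Euc m) (u : Euc dz × Euc d) : ℝ :=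
  ‖S.scoreDiff φ u‖ + 2 * L * growth G u

/-- The derivative bound 2LX for `scoreDiff` does not involve the parameter, so over the unit ball f
moves by at most 2LX. This supplies integrable local envelopes. -/
lemma LayerAssumption.norm_scoreDiff_le_localBound (hA : S.LayerAssumption G L)
    (hT : S.TargetAssumption L M) {φ ψ : Euc m} (hψ : ψ ∈ Metric.ball φ 1) (u : Euc dz × Euc d) :
    ‖S.scoreDiff ψ u‖ ≤ S.localBound G L φ u := by
  have hL := hA.L_pos
  have h := convex_univ.norm_image_sub_le_of_norm_fderiv_le (𝕜 := ℝ)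
    (f := fun φ => S.scoreDiff φ u)
    (fun χ _ => (hA.c2BoundAt_scoreDiff hT χ u).contDiff.differentiable (by norm_num) χ)
    (fun χ _ => (hA.c2BoundAt_scoreDiff hT χ u).fderiv_le) (Set.mem_univ φ) (Set.mem_univ ψ)
  have h1 : ‖ψ - φ‖ ≤ 1 := by
    rw [← dist_eq_norm]
    exact (Metric.mem_ball.1 hψ).le
  have hX := growth_nonneg hA.one_le u
  have h2 : 2 * L * growth G u * ‖ψ - φ‖ ≤ 2 * L * growth G u :=
    mul_le_of_le_one_right (by positivity) h1
  have h3 := norm_le_norm_add_norm_sub' (S.scoreDiff ψ u) (S.scoreDiff φ u)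
  unfold localBound
  linarith

lemma LayerAssumption.measurable_localBound (hA : S.LayerAssumption G L)
    (hT : S.TargetAssumption L M) (φ : Euc m) : Measurable (S.localBound G L φ) :=
  (hA.measurable_scoreDiff hT φ).norm.add (measurable_growth.const_mul _)

lemma LayerAssumption.localBound_nonneg (hA : S.LayerAssumption G L) (φ : Euc m)
    (u : Euc dz × Euc d) : 0 ≤ S.localBound G L φ u := by
  have := hA.L_pos
  have := growth_nonneg hA.one_le u
  unfold localBound
  positivity

variable {H₀ : Type v} [NormedAddCommGroup H₀] [InnerProductSpace ℝ H₀]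
  [CompleteSpace H₀] [RKHS ℝ H₀ (Euc d) ℝ]

/-- The gradient of `pairLoss`. -/
def pairGrad (S : Model m dz d) (φ : Euc m) (p : (Euc dz × Euc d) × (Euc dz × Euc d)) : Euc m :=
  gradient (fun ψ => S.pairLoss ψ p.1 p.2) φ

lemma norm_pairGrad (φ : Euc m) (p : (Euc dz × Euc d) × (Euc dz × Euc d)) :
    ‖S.pairGrad φ p‖ = ‖fderiv ℝ (fun ψ => S.pairLoss ψ p.1 p.2) φ‖ :=
  LinearIsometryEquiv.norm_map _ _

lemma LayerAssumption.measurable_pairLoss (hA : S.LayerAssumption G L)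
    (hT : S.TargetAssumption L M) (hK : S.KernelAssumption B) (φ : Euc m) :
    Measurable fun p : (Euc dz × Euc d) × (Euc dz × Euc d) => S.pairLoss φ p.1 p.2 := by
  have hr := hA.measurable_reparam φ
  have hf := hA.measurable_scoreDiff hT φ
  exact (hK.contDiff.continuous.measurable.comp
    ((hr.comp measurable_fst).prodMk (hr.comp measurable_snd))).mul
    ((hf.comp measurable_fst).inner (hf.comp measurable_snd))

lemma LayerAssumption.measurable_pairGrad (hA : S.LayerAssumption G L)
    (hT : S.TargetAssumption L M) (hK : S.KernelAssumption B) (hk : IsRKHSOf H₀ S.k) (φ : Euc m) :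
    Measurable (S.pairGrad φ) := by
  have h := stronglyMeasurable_fderiv_of_param
    (F := fun ψ (p : (Euc dz × Euc d) × (Euc dz × Euc d)) => S.pairLoss ψ p.1 p.2)
    (fun ψ => (hA.measurable_pairLoss hT hK ψ).stronglyMeasurable) (φ := φ)
    (fun p => (hA.c2BoundAt_pairLoss hT hK hk φ p.1 p.2).contDiff.differentiable (by norm_num) φ)
  exact ((InnerProductSpace.toDual ℝ (Euc m)).symm.continuous.comp_stronglyMeasurable h).measurable

lemma LayerAssumption.continuous_pairGrad (hA : S.LayerAssumption G L)
    (hT : S.TargetAssumption L M) (hK : S.KernelAssumption B) (hk : IsRKHSOf H₀ S.k)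
    (p : (Euc dz × Euc d) × (Euc dz × Euc d)) : Continuous fun φ => S.pairGrad φ p :=
  (InnerProductSpace.toDual ℝ (Euc m)).symm.continuous.comp
    ((hA.c2BoundAt_pairLoss hT hK hk 0 p.1 p.2).contDiff.continuous_fderiv (by norm_num))

/-- A Carathéodory function is jointly measurable. Joint measurability is needed because SGD
evaluates the estimator at a random parameter. -/
lemma LayerAssumption.measurable_uncurry_pairGrad (hA : S.LayerAssumption G L)
    (hT : S.TargetAssumption L M) (hK : S.KernelAssumption B) (hk : IsRKHSOf H₀ S.k) :
    Measurable (Function.uncurry S.pairGrad) :=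
  measurable_uncurry_of_continuous_of_measurable (u := S.pairGrad)
    (hA.continuous_pairGrad hT hK hk) (hA.measurable_pairGrad hT hK hk)

/-- The loss is smooth, and the gradient of `pairLoss` on two independent samples is a square
integrable unbiased estimator of its gradient. -/
theorem LayerAssumption.smooth_loss (hA : S.LayerAssumption G L)
    (hT : S.TargetAssumption L M) (hK : S.KernelAssumption B) (hk : IsRKHSOf H₀ S.k)
    (hS : S.MomentAssumption K s) {xstar : Euc d} (hx : S.score xstar = 0)
    (hdz : 1 ≤ dz) (hd : 2 ≤ d) :
    Smooth (S.loss H₀) (B ^ 2 * (24 * (growthMoment K G dz d * scoreMoment L s xstar)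
        + 4 * (16 * L + hessCoeff L M) * (growthMoment K G dz d * √(scoreMoment L s xstar))
        + 8 * L ^ 2 * growthMoment K G dz d)) ∧
      ∀ φ, MemLp (S.pairGrad φ) 2 (S.noise.prod S.noise) ∧
        ∫ p, S.pairGrad φ p ∂S.noise.prod S.noise = gradient (S.loss H₀) φ ∧
        ∫ p, ‖S.pairGrad φ p‖ ^ 2 ∂S.noise.prod S.noise
          ≤ 32 * B ^ 4 * (growthMoment K G dz d * scoreMoment L s xstar
            * (scoreMoment L s xstar + L ^ 2)) := by
  have := hS.isProb
  have hL := hA.L_pos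
  have hQ := hessCoeff_nonneg hL.le hT.nonneg_third
  have hX0 := growth_nonneg (dz := dz) (d := d) hA.one_le
  obtain ⟨iX, mX⟩ := hS.integral_growth_pow_four_le hA.one_le hdz hd
  have hF := fun φ => hA.integral_norm_scoreDiff_pow_four_le hT hS hx φ
  have hmF := fun φ => (hA.measurable_scoreDiff hT φ).norm
  have ha := growthMoment_pos (K := K) hA.one_le hdz hd
  have hb := scoreMoment_pos (s := s) hL hd xstar
  have iF2 : ∀ φ, MemLp (S.scoreDiff φ) 2 S.noise := fun φ => by
    rw [memLp_two_iff_integrable_sq_norm (hA.measurable_scoreDiff hT φ).aestronglyMeasurable]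
    exact (second_moment (hmF φ) (hF φ).1 hb (hF φ).2).1
  have iF1 : ∀ φ, Integrable (S.scoreDiff φ) S.noise := fun φ =>
    (iF2 φ).integrable (by norm_num)
  have eloss : S.loss H₀ = fun φ => ∫ p, S.pairLoss φ p.1 p.2 ∂S.noise.prod S.noise :=
    funext fun φ => hA.loss_eq hT hK hk φ (iF1 φ)
  have hmB := fun φ => hA.measurable_localBound hT φ
  have hB0 := fun φ => hA.localBound_nonneg (S := S) φ
  have iB : ∀ φ, Integrable (fun u => S.localBound G L φ u ^ 4) S.noise := by
    intro φ
    refine (((hF φ).1.add ((iX.const_mul ((2 * L) ^ 4)))).const_mul 8).mono'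
      ((hmB φ).pow_const 4).aestronglyMeasurable (.of_forall fun u => ?_)
    rw [Real.norm_of_nonneg (pow_nonneg (hB0 φ u) 4)]
    refine (add_pow_four_le _ _).trans (le_of_eq ?_)
    rw [Pi.add_apply, mul_pow]
  -- For the envelopes only finiteness matters; the added 1 ensures the positivity that the moment
  -- lemmas ask for.
  have mB : ∀ φ, ∫ u, S.localBound G L φ u ^ 4 ∂S.noise
      ≤ (√(∫ u, S.localBound G L φ u ^ 4 ∂S.noise) + 1) ^ 2 := by
    intro φ
    have h0 : 0 ≤ ∫ u, S.localBound G L φ u ^ 4 ∂S.noise :=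
      integral_nonneg fun u => pow_nonneg (hB0 φ u) 4
    nlinarith [Real.sq_sqrt h0, Real.sqrt_nonneg (∫ u, S.localBound G L φ u ^ 4 ∂S.noise)]
  have hb' : ∀ φ, 0 < √(∫ u, S.localBound G L φ u ^ 4 ∂S.noise) + 1 := fun φ => by positivity
  have hkey := smooth_integral (μ := S.noise.prod S.noise)
    (F := fun φ (p : (Euc dz × Euc d) × (Euc dz × Euc d)) => S.pairLoss φ p.1 p.2)
    (fun φ => (hA.measurable_pairLoss hT hK φ).stronglyMeasurable)
    (fun p => (hA.c2BoundAt_pairLoss hT hK hk 0 p.1 p.2).contDiff)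
    (fun φ => by
      refine (((iF1 φ).norm.mul_prod (iF1 φ).norm).const_mul (B ^ 2)).mono'
        (hA.measurable_pairLoss hT hK φ).aestronglyMeasurable (.of_forall fun p => ?_)
      rw [pairLoss, norm_mul]
      exact mul_le_mul (hk.abs_le hK.pos.le hK.le _ _) (norm_inner_le_norm _ _) (norm_nonneg _)
        (sq_nonneg B))
    (b₁ := fun φ p => pairGradBound B L (growth G p.1) (growth G p.2)
      (S.localBound G L φ p.1) (S.localBound G L φ p.2))
    (b₂ := fun φ p => pairHessBound B L (hessCoeff L M) (growth G p.1) (growth G p.2)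
      (S.localBound G L φ p.1) (S.localBound G L φ p.2))
    (c := fun φ p => pairHessBound B L (hessCoeff L M) (growth G p.1) (growth G p.2)
      ‖S.scoreDiff φ p.1‖ ‖S.scoreDiff φ p.2‖)
    (fun φ => (integral_pairGradBound_sq_le measurable_growth (hmB φ) iX (iB φ) ha (hb' φ) mX
      (mB φ)).1.integrable (by norm_num))
    (fun φ => (integral_pairHessBound_le hL.le hQ measurable_growth (hmB φ) hX0 (hB0 φ) iX (iB φ)
      ha (hb' φ) mX (mB φ)).1)
    (fun φ ψ hψ p => (hA.c2BoundAt_pairLoss hT hK hk ψ p.1 p.2).fderiv_le.trans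
      (pairGradBound_mono hL.le (hX0 _) (hX0 _) (norm_nonneg _) (norm_nonneg _)
        (hA.norm_scoreDiff_le_localBound hT hψ _) (hA.norm_scoreDiff_le_localBound hT hψ _)))
    (fun φ ψ hψ p => (hA.c2BoundAt_pairLoss hT hK hk ψ p.1 p.2).hess_le.trans
      (pairHessBound_mono hL.le hQ (hX0 _) (hX0 _) (norm_nonneg _) (norm_nonneg _)
        (hA.norm_scoreDiff_le_localBound hT hψ _) (hA.norm_scoreDiff_le_localBound hT hψ _)))
    (fun φ p => (hA.c2BoundAt_pairLoss hT hK hk φ p.1 p.2).hess_le)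
    (fun φ => (integral_pairHessBound_le hL.le hQ measurable_growth (hmF φ) hX0
      (fun u => norm_nonneg _) iX (hF φ).1 ha hb mX (hF φ).2).1)
    (fun φ => (integral_pairHessBound_le hL.le hQ measurable_growth (hmF φ) hX0
      (fun u => norm_nonneg _) iX (hF φ).1 ha hb mX (hF φ).2).2)
  rw [eloss]
  refine ⟨hkey.1, fun φ => ?_⟩
  obtain ⟨hLp, hint⟩ := integral_pairGradBound_sq_le (B := B) (L := L) measurable_growth (hmF φ)
    iX (hF φ).1 ha hb mX (hF φ).2
  have hle : ∀ p, ‖S.pairGrad φ p‖ ≤ pairGradBound B L (growth G p.1) (growth G p.2)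
      ‖S.scoreDiff φ p.1‖ ‖S.scoreDiff φ p.2‖ := fun p => by
    rw [norm_pairGrad]
    exact (hA.c2BoundAt_pairLoss hT hK hk φ p.1 p.2).fderiv_le
  have hm := (hA.measurable_pairGrad hT hK hk φ).aestronglyMeasurable
    (μ := S.noise.prod S.noise)
  have hY : MemLp (S.pairGrad φ) 2 (S.noise.prod S.noise) := hLp.mono' hm (.of_forall hle)
  refine ⟨hY, (hkey.2 φ).2, (integral_mono ((memLp_two_iff_integrable_sq_norm hm).1 hY)
    hLp.integrable_sq fun p => ?_).trans hint⟩
  exact pow_le_pow_left₀ (norm_nonneg _) (hle p) 2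

end Model

/-! ### The two estimators as pair statistics, and SGD driven by them. -/

namespace Model

variable {m dz d : ℕ} {S : Model m dz d} {B G L M K s : ℝ}

lemma Smooth.mono {f : Euc m → ℝ} {ℓ ℓ' : ℝ} (hf : Smooth f ℓ) (h : ℓ ≤ ℓ') : Smooth f ℓ' :=
  ⟨hf.1, fun φ ψ => (hf.2 φ ψ).trans (mul_le_mul_of_nonneg_right h (norm_nonneg _))⟩

lemma VarianceLE.mono {ι : Type} [Fintype ι] {g : Euc m → (ι → Euc dz × Euc d) → Euc m} {V V' : ℝ}
    (hg : S.VarianceLE g V) (h : V ≤ V') : S.VarianceLE g V' := fun φ =>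
  (hg φ).trans (ENNReal.ofReal_le_ofReal h)

/-- The normalized sum of the pair gradients over a set of pairs of samples. -/
def pairEstimator (S : Model m dz d) {ι : Type} (A : Finset (ι × ι)) (w : ℝ) (φ : Euc m)
    (u : ι → Euc dz × Euc d) : Euc m :=
  w • ∑ e ∈ A, S.pairGrad φ (u e.1, u e.2)

/-- The pairs of indices in the vanilla estimator. -/
def vanillaPairs (N : ℕ) : Finset ((Fin 2 × Fin N) × (Fin 2 × Fin N)) :=
  Finset.univ.map ⟨fun e : Fin N × Fin N => ((0, e.1), (1, e.2)), fun e e' h => by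
    simpa [Prod.ext_iff] using h⟩

/-- The pairs of indices in the U-statistic estimator. -/
def uStatPairs (N : ℕ) : Finset (Fin N × Fin N) := Finset.univ.filter fun e => e.1 < e.2

lemma gradVanilla_eq (N : ℕ) :
    S.gradVanilla N = S.pairEstimator (vanillaPairs N) (1 / (N : ℝ) ^ 2) := by
  ext1 φ
  ext1 u
  rw [gradVanilla, pairEstimator, vanillaPairs, Finset.sum_map, Fintype.sum_prod_type]
  rfl

lemma gradUStat_eq (N : ℕ) :
    S.gradUStat N = S.pairEstimator (uStatPairs N) (2 / ((N : ℝ) * ((N : ℝ) - 1))) := rfl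

lemma vanillaPairs_ne {N : ℕ} : ∀ e ∈ vanillaPairs N, e.1 ≠ e.2 := by
  intro e he
  obtain ⟨x, -, rfl⟩ := Finset.mem_map.1 he
  change ((0, x.1) : Fin 2 × Fin N) ≠ (1, x.2)
  simp

lemma card_vanillaPairs (N : ℕ) : (vanillaPairs N).card = N ^ 2 := by
  simp [vanillaPairs, sq]

lemma uStatPairs_ne {N : ℕ} : ∀ e ∈ uStatPairs N, e.1 ≠ e.2 := fun _ he =>
  (Finset.mem_filter.1 he).2.ne

lemma two_mul_card_uStatPairs (N : ℕ) : 2 * (uStatPairs N).card = N * (N - 1) := by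
  have h1 : (Finset.univ.filter fun e : Fin N × Fin N => e.2 < e.1).card = (uStatPairs N).card :=
    Finset.card_equiv (Equiv.prodComm _ _) fun _ => by simp [uStatPairs]
  have h2 : (Finset.univ : Finset (Fin N)).offDiag
      = uStatPairs N ∪ Finset.univ.filter fun e : Fin N × Fin N => e.2 < e.1 := by
    ext e
    simp [uStatPairs, lt_or_lt_iff_ne]
  have h3 : Disjoint (uStatPairs N) (Finset.univ.filter fun e : Fin N × Fin N => e.2 < e.1) := by
    rw [uStatPairs, Finset.disjoint_filter]
    exact fun e _ h => h.not_gt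
  have h4 := congrArg Finset.card h2
  rw [Finset.offDiag_card, Finset.card_union_of_disjoint h3, h1, Finset.card_univ,
    Fintype.card_fin, ← Nat.mul_sub_one] at h4
  omega

variable {H₀ : Type v} [NormedAddCommGroup H₀] [InnerProductSpace ℝ H₀]
  [CompleteSpace H₀] [RKHS ℝ H₀ (Euc d) ℝ]

lemma LayerAssumption.measurable_pairEstimator (hA : S.LayerAssumption G L)
    (hT : S.TargetAssumption L M) (hK : S.KernelAssumption B) (hk : IsRKHSOf H₀ S.k)
    {ι : Type} (A : Finset (ι × ι)) (w : ℝ) :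
    Measurable (Function.uncurry (S.pairEstimator A w)) := by
  have h : ∀ e ∈ A, Measurable fun p : Euc m × (ι → Euc dz × Euc d) =>
      Function.uncurry S.pairGrad (p.1, (p.2 e.1, p.2 e.2)) := fun e _ =>
    (hA.measurable_uncurry_pairGrad hT hK hk).comp (by fun_prop)
  exact (Finset.measurable_fun_sum A h).const_smul w

lemma pairEstimator_unbiased_varianceLE [IsProbabilityMeasure S.mix] {f : Euc m → ℝ} {V : ℝ}
    (hY : ∀ φ, MemLp (S.pairGrad φ) 2 (S.noise.prod S.noise) ∧
      ∫ p, S.pairGrad φ p ∂S.noise.prod S.noise = gradient f φ ∧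
      ∫ p, ‖S.pairGrad φ p‖ ^ 2 ∂S.noise.prod S.noise ≤ V)
    {ι : Type} [Fintype ι] {A : Finset (ι × ι)} (hA : ∀ e ∈ A, e.1 ≠ e.2) {w : ℝ}
    (hw : w * A.card = 1) :
    S.Unbiased f (S.pairEstimator A w) ∧
      S.VarianceLE (S.pairEstimator A w) (w * (4 * Fintype.card ι) * V) := by
  have h := fun φ => pairStatistic_mean_variance (hY φ).1 hA hw (hY φ).2.2
  exact ⟨fun φ => ⟨(h φ).1, (h φ).2.1.trans (hY φ).2.1⟩, fun φ => (h φ).2.2⟩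

lemma gradVanilla_unbiased_varianceLE [IsProbabilityMeasure S.mix] {f : Euc m → ℝ} {V : ℝ}
    (hV : 0 ≤ V)
    (hY : ∀ φ, MemLp (S.pairGrad φ) 2 (S.noise.prod S.noise) ∧
      ∫ p, S.pairGrad φ p ∂S.noise.prod S.noise = gradient f φ ∧
      ∫ p, ‖S.pairGrad φ p‖ ^ 2 ∂S.noise.prod S.noise ≤ V) {N : ℕ} (hN : 1 ≤ N) :
    S.Unbiased f (S.gradVanilla N) ∧ S.VarianceLE (S.gradVanilla N) (16 * V / N) := by
  have hN0 : (0 : ℝ) < N := by exact_mod_cast hN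
  have h := pairEstimator_unbiased_varianceLE hY (vanillaPairs_ne (N := N))
    (w := 1 / (N : ℝ) ^ 2) (by rw [card_vanillaPairs]; push_cast; field_simp)
  rw [gradVanilla_eq]
  refine ⟨h.1, h.2.mono ?_⟩
  -- There are 2N samples here, which gives 8V/N. The weaker 16 is shared with the U-statistic.
  have e : 1 / (N : ℝ) ^ 2 * (4 * (Fintype.card (Fin 2 × Fin N) : ℝ)) * V = 8 * V / N := by
    simp only [Fintype.card_prod, Fintype.card_fin]
    push_cast
    field_simp
    ring
  rw [e]
  gcongr
  norm_num

lemma gradUStat_unbiased_varianceLE [IsProbabilityMeasure S.mix] {f : Euc m → ℝ} {V : ℝ}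
    (hV : 0 ≤ V)
    (hY : ∀ φ, MemLp (S.pairGrad φ) 2 (S.noise.prod S.noise) ∧
      ∫ p, S.pairGrad φ p ∂S.noise.prod S.noise = gradient f φ ∧
      ∫ p, ‖S.pairGrad φ p‖ ^ 2 ∂S.noise.prod S.noise ≤ V) {N : ℕ} (hN : 2 ≤ N) :
    S.Unbiased f (S.gradUStat N) ∧ S.VarianceLE (S.gradUStat N) (16 * V / N) := by
  have hN2 : (2 : ℝ) ≤ N := by exact_mod_cast hN
  have hN0 : (0 : ℝ) < N := by linarith
  have hN1 : (0 : ℝ) < (N : ℝ) - 1 := by linarith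
  have hc : 2 * ((uStatPairs N).card : ℝ) = N * (N - 1) := by
    have := congrArg (Nat.cast (R := ℝ)) (two_mul_card_uStatPairs N)
    rwa [Nat.cast_mul, Nat.cast_mul, Nat.cast_sub (by omega), Nat.cast_one, Nat.cast_ofNat] at this
  have h := pairEstimator_unbiased_varianceLE hY (uStatPairs_ne (N := N))
    (w := 2 / ((N : ℝ) * ((N : ℝ) - 1))) (by
      rw [div_mul_eq_mul_div, hc]
      exact div_self (by positivity))
  rw [gradUStat_eq]
  refine ⟨h.1, h.2.mono ?_⟩
  rw [Fintype.card_fin]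
  -- The bound 8V/(N-1) becomes 16V/N because N ≥ 2.
  have e : 2 / ((N : ℝ) * ((N : ℝ) - 1)) * (4 * (N : ℝ)) * V = 8 * V / (N - 1) := by
    field_simp
    ring
  rw [e, div_le_div_iff₀ hN1 hN0]
  nlinarith

lemma loss_nonneg (φ : Euc m) : 0 ≤ S.loss H₀ φ := sq_nonneg _

lemma bddBelow_range_loss : BddBelow (Set.range (S.loss H₀)) :=
  ⟨0, by rintro _ ⟨φ, rfl⟩; exact loss_nonneg φ⟩

/-- Convergence of SGD for a smooth function and an unbiased estimator of bounded variance. -/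
lemma sgdConverges_of_smooth [IsProbabilityMeasure S.mix] {f : Euc m → ℝ} {ι : Type} [Fintype ι]
    {g : Euc m → (ι → Euc dz × Euc d) → Euc m} {N : ℕ} {ℓ V c ℓ' V' : ℝ} (hf : Smooth f ℓ)
    (hℓ : 0 ≤ ℓ) (hV : 0 ≤ V) (hb : BddBelow (Set.range f)) (hg : Measurable (Function.uncurry g))
    (hu : S.Unbiased f g) (hv : S.VarianceLE g (V / N)) (h₁ : 16 * ℓ ≤ c * ℓ')
    (h₂ : 16 * (ℓ * V) ≤ c * (ℓ' * V')) : SGDConverges.{u} S f g N c ℓ' V' := by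
  intro φ₀ ε T hε hT h
  have : IsProbabilityMeasure (S.batch ι) := by
    unfold batch
    infer_instance
  refine exists_sgd_gradient_le hf hℓ (by positivity) hb hg (fun φ => (hu φ).1)
    (fun φ => (hu φ).2) hv φ₀ hε hT (le_trans ?_ h)
  have hΔ : 0 ≤ f φ₀ - ⨅ φ, f φ := sub_nonneg.2 (ciInf_le hb φ₀)
  set Δ := f φ₀ - ⨅ φ, f φ
  -- The required number of iterations is linear in ℓ and in ℓV, so only these two quantities need
  -- comparison; V need not be at most a multiple of V'.
  have e₁ : 16 * (ℓ * Δ / ε ^ 2) * (1 + V / N / ε ^ 2)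
      = Δ / ε ^ 2 * (16 * ℓ) + Δ / ε ^ 2 / (N * ε ^ 2) * (16 * (ℓ * V)) := by
    rw [div_div]
    ring
  have e₂ : c * (ℓ' * Δ / ε ^ 2) * (1 + V' / (N * ε ^ 2))
      = Δ / ε ^ 2 * (c * ℓ') + Δ / ε ^ 2 / (N * ε ^ 2) * (c * (ℓ' * V')) := by
    ring
  rw [e₁, e₂]
  gcongr

end Model

/-! ### Algebraic comparison of the constants. -/

section Constants

variable {L M D C : ℝ} {d : ℕ}

/-- Each product with √D is split by 2xy ≤ x² + y², and both L² and L³ are at most (1 ∨ L)³. -/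
lemma smoothness_factor_le (hL : 0 ≤ L) (hD : 0 ≤ D) :
    D + (L + L * √L + M) * √D + L ^ 2 ≤ 3 * (max 1 L ^ 3 + D + M ^ 2) := by
  have hq := Real.sq_sqrt hL
  have hr := Real.sq_sqrt hD
  set q := √L
  set r := √D
  have h1 : L ^ 2 ≤ max 1 L ^ 3 := by
    rcases le_total 1 L with h | h
    · rw [max_eq_right h]
      nlinarith [sq_nonneg L]
    · rw [max_eq_left h]
      nlinarith
  have h2 : L ^ 3 ≤ max 1 L ^ 3 := pow_le_pow_left₀ hL (le_max_right _ _) 3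
  have h3 : (L * q) ^ 2 = L ^ 3 := by rw [mul_pow, hq]; ring
  nlinarith [sq_nonneg (L - r), sq_nonneg (L * q - r), sq_nonneg (M - r), sq_nonneg M]

/-- The variance factor D(D+L²) contains L²C, which no multiple of `W` dominates: take d fixed, C =
L^{3/2} and L large. In such a regime the left smoothness factor is smaller than the right one, and
the product inequality survives. -/
lemma smoothness_mul_variance_factor_le (hL : 0 ≤ L) (hM : 0 ≤ M) (hC : 0 ≤ C) (hd : 1 ≤ d)
    (hD : D = L * d + C) :
    (D + (L + L * √L + M) * √D + L ^ 2) * (D * (D + L ^ 2))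
      ≤ 20 * ((max 1 L ^ 3 + D + M ^ 2) * (L ^ 3 * d + L ^ 2 * (d : ℝ) ^ 2 + C ^ 2)) := by
  have hd' : (1 : ℝ) ≤ d := by exact_mod_cast hd
  have hLD : L ≤ D := by nlinarith
  have hD0 : 0 ≤ D := hL.trans hLD
  have hA := smoothness_factor_le (M := M) hL hD0
  have hA0 : 0 ≤ max 1 L ^ 3 + D + M ^ 2 := by positivity
  set W := L ^ 3 * d + L ^ 2 * (d : ℝ) ^ 2 + C ^ 2 with hW
  have hDW : D ^ 2 ≤ 2 * W := by
    have : 0 ≤ L ^ 3 * d := by positivity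
    rw [hD, hW]
    nlinarith [sq_nonneg (L * d - C)]
  have hW0 : 0 ≤ W := by nlinarith [sq_nonneg D]
  have hℓ0 : 0 ≤ D + (L + L * √L + M) * √D + L ^ 2 := by positivity
  rcases le_total L 1 with h | h
  -- For L ≤ 1 one has L² ≤ L ≤ D, so the variance factor alone is at most 2D².
  · have hV : D * (D + L ^ 2) ≤ 4 * W := by
      have : L ^ 2 ≤ D := by nlinarith
      nlinarith
    calc _ ≤ 3 * (max 1 L ^ 3 + D + M ^ 2) * (4 * W) :=
          mul_le_mul hA hV (by positivity) (by positivity)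
      _ ≤ _ := by nlinarith [mul_nonneg hA0 hW0]
  · have hq := Real.sq_sqrt hL
    have hr := Real.sq_sqrt hD0
    have hqr : √L ≤ √D := Real.sqrt_le_sqrt hLD
    have hq0 := Real.sqrt_nonneg L
    have hr1 : 1 ≤ √D := Real.one_le_sqrt.2 (h.trans hLD)
    rw [max_eq_right h] at hA hA0 ⊢
    set q := √L
    set r := √D
    have t1 : (D + (L + L * q + M) * r + L ^ 2) * D ^ 2 ≤ 3 * (L ^ 3 + D + M ^ 2) * (2 * W) :=
      mul_le_mul hA hDW (by positivity) (by positivity)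
    have hL3 : L ^ 2 ≤ L ^ 3 := by nlinarith [sq_nonneg L]
    have hrD : r ≤ D := by nlinarith
    have s1 : D * L ^ 2 ≤ D * L ^ 3 := by gcongr
    have s2 : L * r * L ^ 2 ≤ D * L ^ 3 := by
      calc L * r * L ^ 2 = r * L ^ 3 := by ring
        _ ≤ _ := by gcongr
    have s3 : L * q * r * L ^ 2 ≤ D * L ^ 3 := by
      calc L * q * r * L ^ 2 = q * r * L ^ 3 := by ring
        _ ≤ r * r * L ^ 3 := by gcongr
        _ = _ := by rw [← hr]; ring
    have s4 : M * r * L ^ 2 ≤ D * ((L ^ 3 + M ^ 2) / 2) := by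
      have hLq : L ^ 3 = (L * q) ^ 2 := by rw [mul_pow, hq]; ring
      calc M * r * L ^ 2 = q * r * (M * (L * q)) := by rw [← hq]; ring
        _ ≤ r * r * ((L ^ 3 + M ^ 2) / 2) := by
            refine mul_le_mul (by gcongr) ?_ (by positivity) (by positivity)
            rw [hLq]
            nlinarith [sq_nonneg (M - L * q)]
        _ = _ := by rw [← hr]; ring
    have s5 : L ^ 2 * L ^ 2 ≤ D * L ^ 3 := by
      calc L ^ 2 * L ^ 2 = L * L ^ 3 := by ring
        _ ≤ _ := by gcongr
    -- The factor L² is moved onto the smoothness factor, where each summand times L² is at most D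
    -- times L³ or (L³+M²)/2; the collected D² is then at most 2W.
    have t2 : (D + (L + L * q + M) * r + L ^ 2) * (D * L ^ 2)
        ≤ 5 * (L ^ 3 + D + M ^ 2) * (2 * W) := by
      calc _ = D * (D * L ^ 2 + L * r * L ^ 2 + L * q * r * L ^ 2 + M * r * L ^ 2
            + L ^ 2 * L ^ 2) := by ring
        _ ≤ D * (D * L ^ 3 + D * L ^ 3 + D * L ^ 3 + D * ((L ^ 3 + M ^ 2) / 2)
            + D * L ^ 3) := by gcongr
        _ = (9 / 2 * L ^ 3 + M ^ 2 / 2) * D ^ 2 := by ring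
        _ ≤ 5 * (L ^ 3 + D + M ^ 2) * (2 * W) := by
            refine mul_le_mul ?_ hDW (sq_nonneg D) (by positivity)
            have : 0 ≤ L ^ 3 := by positivity
            nlinarith [sq_nonneg M]
    have := mul_nonneg hA0 hW0
    nlinarith

end Constants

/-! ### Explicit constants and the main theorem. -/

namespace Model

variable {m dz d : ℕ} {S : Model m dz d} {B G L M K s : ℝ}
  {H₀ : Type v} [NormedAddCommGroup H₀] [InnerProductSpace ℝ H₀]
  [CompleteSpace H₀] [RKHS ℝ H₀ (Euc d) ℝ]

/-- The smoothness of the loss and the variance of the pair gradients, up to a constant. -/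
theorem LayerAssumption.smooth_loss_explicit (hA : S.LayerAssumption G L)
    (hT : S.TargetAssumption L M) (hK : S.KernelAssumption B) (hk : IsRKHSOf H₀ S.k)
    (hS : S.MomentAssumption K s) {xstar : Euc d} (hx : S.score xstar = 0)
    (hdz : 1 ≤ dz) (hd : 2 ≤ d) {c₁ D : ℝ} (hc₁ : c₁ = 200000000 * (1 + max K 0))
    (hD : D = L * d + scoreConst L s xstar) :
    Smooth (S.loss H₀) (c₁ * (B ^ 2 * (G ^ 2 * dz * Real.log d)
      * (D + (L + L * √L + M) * √D + L ^ 2))) ∧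
      ∃ V, 0 ≤ V ∧ 16 * V ≤ c₁ * (B ^ 4 * (G ^ 2 * dz * Real.log d) * (D * (D + L ^ 2))) ∧
      ∀ φ, MemLp (S.pairGrad φ) 2 (S.noise.prod S.noise) ∧
        ∫ p, S.pairGrad φ p ∂S.noise.prod S.noise = gradient (S.loss H₀) φ ∧
        ∫ p, ‖S.pairGrad φ p‖ ^ 2 ∂S.noise.prod S.noise ≤ V := by
  obtain ⟨h1, h2⟩ := hA.smooth_loss hT hK hk hS hx hdz hd
  have hL := hA.L_pos
  have hM := hT.nonneg_third
  have ha := growthMoment_pos (K := K) hA.one_le hdz hd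
  have hb := scoreMoment_pos (s := s) hL hd xstar
  have eb : scoreMoment L s xstar = 42 * D := by rw [hD]; rfl
  have ea : c₁ = 200000000 * (1 + max K 0) := hc₁
  have hD0 : 0 < D := by linarith
  set γ := G ^ 2 * dz * Real.log d with hγ
  have eγ : growthMoment K G dz d = 200 * (1 + max K 0) * γ := rfl
  set a := growthMoment K G dz d
  rw [eb] at h1 h2
  have hr : √(42 * D) ≤ 7 * √D := by
    rw [Real.sqrt_mul (by norm_num)]
    gcongr
    exact Real.sqrt_le_iff.2 ⟨by norm_num, by norm_num⟩
  have hLL : 0 ≤ L * √L := by positivity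
  refine ⟨h1.mono ?_, 32 * B ^ 4 * (a * (42 * D) * (42 * D + L ^ 2)), by positivity, ?_, h2⟩
  · calc _ ≤ B ^ 2 * (24 * (a * (42 * D)) + 4 * (18 * (L + L * √L + M)) * (a * (7 * √D))
          + 8 * L ^ 2 * a) := by
          have : 16 * L + hessCoeff L M ≤ 18 * (L + L * √L + M) := by
            unfold hessCoeff
            linarith
          have h0 := hessCoeff_nonneg hL.le hM
          gcongr
      _ = a * B ^ 2 * (1008 * D + 504 * ((L + L * √L + M) * √D) + 8 * L ^ 2) := by ring
      _ ≤ a * B ^ 2 * (1000000 * (D + (L + L * √L + M) * √D + L ^ 2)) := by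
          refine mul_le_mul_of_nonneg_left ?_ (by positivity)
          have : 0 ≤ (L + L * √L + M) * √D := by positivity
          nlinarith [sq_nonneg L]
      _ = _ := by rw [eγ, ea]; ring
  · calc _ = a * B ^ 4 * (16 * 32 * 42 * (D * (42 * D + L ^ 2))) := by ring
      _ ≤ a * B ^ 4 * (1000000 * (D * (D + L ^ 2))) := by
          refine mul_le_mul_of_nonneg_left ?_ (by positivity)
          nlinarith [mul_nonneg hD0.le (sq_nonneg L), sq_nonneg D]
      _ = _ := by rw [eγ, ea]; ring

end Model

end

end KSIVI

theorem theorem5 (K : ℝ) : ∃ c : ℝ, 0 < c ∧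
    ∀ (m dz d : ℕ) (_ : 1 ≤ dz) (_ : 2 ≤ d) (S : KSIVI.Model m dz d)
      (H₀ : Type v) [NormedAddCommGroup H₀] [InnerProductSpace ℝ H₀] [CompleteSpace H₀]
      [RKHS ℝ H₀ (KSIVI.Euc d) ℝ] (B G L M s : ℝ) (xstar : KSIVI.Euc d)
      (_ : KSIVI.IsRKHSOf H₀ S.k) (_ : S.KernelAssumption B) (_ : S.TargetAssumption L M)
      (_ : S.LayerAssumption G L) (_ : S.MomentAssumption K s) (_ : S.score xstar = 0),
      -- the loss is smooth, with an explicit constant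
      KSIVI.Model.Smooth (S.loss H₀)
          (c * KSIVI.smoothConst dz d B G L M (KSIVI.scoreConst L s xstar)) ∧
      -- both estimators are unbiased with variance of order `1 / N`, with an explicit constant
      (∀ N : ℕ, 1 ≤ N → S.Unbiased (S.loss H₀) (S.gradVanilla N) ∧
        S.VarianceLE (S.gradVanilla N)
          (c * KSIVI.varConstFull dz d B G L (KSIVI.scoreConst L s xstar) / N)) ∧
      (∀ N : ℕ, 2 ≤ N → S.Unbiased (S.loss H₀) (S.gradUStat N) ∧
        S.VarianceLE (S.gradUStat N)
          (c * KSIVI.varConstFull dz d B G L (KSIVI.scoreConst L s xstar) / N)) ∧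
      -- convergence, with `Lφ` and `Sig0` any smoothness and variance constants
      (∀ Lφ Sig0 : ℝ, 0 ≤ Lφ → 0 ≤ Sig0 → KSIVI.Model.Smooth (S.loss H₀) Lφ →
        (∀ N : ℕ, 1 ≤ N → S.VarianceLE (S.gradVanilla N) (Sig0 / N) →
          KSIVI.Model.SGDConverges.{u} S (S.loss H₀) (S.gradVanilla N) N c Lφ Sig0) ∧
        (∀ N : ℕ, 2 ≤ N → S.VarianceLE (S.gradUStat N) (Sig0 / N) →
          KSIVI.Model.SGDConverges.{u} S (S.loss H₀) (S.gradUStat N) N c Lφ Sig0)) ∧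
      -- convergence, with explicit expressions in place of the smoothness and variance constants
      (∀ N : ℕ, 1 ≤ N →
        KSIVI.Model.SGDConverges.{u} S (S.loss H₀) (S.gradVanilla N) N c
          (KSIVI.smoothConst dz d B G L M (KSIVI.scoreConst L s xstar))
          (KSIVI.varConst dz d B G L (KSIVI.scoreConst L s xstar))) ∧
      (∀ N : ℕ, 2 ≤ N →
        KSIVI.Model.SGDConverges.{u} S (S.loss H₀) (S.gradUStat N) N c
          (KSIVI.smoothConst dz d B G L M (KSIVI.scoreConst L s xstar))
          (KSIVI.varConst dz d B G L (KSIVI.scoreConst L s xstar))) := by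
  have hK0 : 0 ≤ max K 0 := le_max_right _ _
  obtain ⟨c₁, hc₁⟩ : ∃ c₁ : ℝ, c₁ = 200000000 * (1 + max K 0) := ⟨_, rfl⟩
  have hc1 : 1 ≤ c₁ := by rw [hc₁]; linarith
  have hc2 : c₁ ≤ c₁ ^ 2 := by nlinarith
  -- The square arises because smoothness and variance each carry a factor c₁ and SGD multiplies
  -- them; 320 is 16 from SGD times 20 from `smoothness_mul_variance_factor_le`.
  refine ⟨320 * c₁ ^ 2, by positivity, ?_⟩
  intro m dz d hdz hd S H₀ _ _ _ _ B G L M s xstar hk hK hT hA hS hx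
  have := hS.isProb
  obtain ⟨D, hD⟩ : ∃ D, D = L * d + KSIVI.scoreConst L s xstar := ⟨_, rfl⟩
  obtain ⟨hsm, V, hV0, hV, hY⟩ := hA.smooth_loss_explicit hT hK hk hS hx hdz hd hc₁ hD
  have hL := hA.L_pos
  have hM := hT.nonneg_third
  have hC := KSIVI.scoreConst_nonneg L s xstar
  have hlog : 0 < Real.log d := Real.log_pos (by exact_mod_cast hd)
  have hD0 : 0 ≤ D := by rw [hD]; positivity
  have hfac := KSIVI.smoothness_factor_le (M := M) hL.le hD0
  have hmul := KSIVI.smoothness_mul_variance_factor_le hL.le hM hC (by omega) hD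
  have es : KSIVI.smoothConst dz d B G L M (KSIVI.scoreConst L s xstar)
      = B ^ 2 * (G ^ 2 * dz * Real.log d) * (max 1 L ^ 3 + D + M ^ 2) := by
    rw [hD, KSIVI.smoothConst]
    ring
  have ef : KSIVI.varConstFull dz d B G L (KSIVI.scoreConst L s xstar)
      = B ^ 4 * (G ^ 2 * dz * Real.log d) * (D * (D + L ^ 2)) := by
    rw [hD, KSIVI.varConstFull]
    ring
  have ev : KSIVI.varConst dz d B G L (KSIVI.scoreConst L s xstar)
      = B ^ 4 * (G ^ 2 * dz * Real.log d)
        * (L ^ 3 * d + L ^ 2 * (d : ℝ) ^ 2 + KSIVI.scoreConst L s xstar ^ 2) := by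
    rw [KSIVI.varConst]
    ring
  rw [es, ef, ev]
  clear es ef ev hx hc₁
  generalize KSIVI.scoreConst L s xstar = C at *
  have hγ0 : 0 ≤ G ^ 2 * dz * Real.log d := by positivity
  generalize G ^ 2 * dz * Real.log d = γ at *
  have hℓ0 : 0 ≤ D + (L + L * √L + M) * √D + L ^ 2 := by positivity
  generalize D + (L + L * √L + M) * √D + L ^ 2 = ℓ at *
  have hA0 : 0 ≤ max 1 L ^ 3 + D + M ^ 2 := by positivity
  have hW0 : 0 ≤ L ^ 3 * d + L ^ 2 * (d : ℝ) ^ 2 + C ^ 2 := by positivity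
  generalize max 1 L ^ 3 + D + M ^ 2 = A at *
  generalize L ^ 3 * d + L ^ 2 * (d : ℝ) ^ 2 + C ^ 2 = W at *
  have hU0 : 0 ≤ D * (D + L ^ 2) := by positivity
  generalize D * (D + L ^ 2) = U at *
  have hsm0 : 0 ≤ c₁ * (B ^ 2 * γ * ℓ) := by positivity
  have hle : c₁ * (B ^ 2 * γ * ℓ) ≤ 3 * c₁ ^ 2 * (B ^ 2 * γ * A) := by
    calc _ ≤ c₁ ^ 2 * (B ^ 2 * γ * (3 * A)) := by gcongr
      _ = _ := by ring
  have hBA : 0 ≤ c₁ ^ 2 * (B ^ 2 * γ * A) := by positivity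
  have hBU : 16 * V ≤ 320 * c₁ ^ 2 * (B ^ 4 * γ * U) := by
    refine hV.trans ?_
    gcongr
    linarith
  have hsm' : 16 * (c₁ * (B ^ 2 * γ * ℓ)) ≤ 320 * c₁ ^ 2 * (B ^ 2 * γ * A) := by linarith
  -- This is where part (c) uses the bound on the product ℓU; separate bounds on ℓ and U would not
  -- suffice.
  have hmul' : 16 * (c₁ * (B ^ 2 * γ * ℓ) * (16 * V))
      ≤ 320 * c₁ ^ 2 * (B ^ 2 * γ * A * (B ^ 4 * γ * W)) := by
    calc _ ≤ 16 * (c₁ * (B ^ 2 * γ * ℓ) * (c₁ * (B ^ 4 * γ * U))) := by gcongr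
      _ = 16 * c₁ ^ 2 * (B ^ 2 * γ * (B ^ 4 * γ)) * (ℓ * U) := by ring
      _ ≤ 16 * c₁ ^ 2 * (B ^ 2 * γ * (B ^ 4 * γ)) * (20 * (A * W)) := by gcongr
      _ = _ := by ring
  have hvan := fun (N : ℕ) (hN : 1 ≤ N) =>
    KSIVI.Model.gradVanilla_unbiased_varianceLE hV0 hY hN
  have hust := fun (N : ℕ) (hN : 2 ≤ N) =>
    KSIVI.Model.gradUStat_unbiased_varianceLE hV0 hY hN
  have mvan : ∀ N, Measurable (Function.uncurry (S.gradVanilla N)) := fun N => by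
    rw [KSIVI.Model.gradVanilla_eq]
    exact hA.measurable_pairEstimator hT hK hk _ _
  have must : ∀ N, Measurable (Function.uncurry (S.gradUStat N)) := fun N => by
    rw [KSIVI.Model.gradUStat_eq]
    exact hA.measurable_pairEstimator hT hK hk _ _
  have hb := KSIVI.Model.bddBelow_range_loss (S := S) (H₀ := H₀)
  have hV16 : 0 ≤ 16 * V := by positivity
  refine ⟨hsm.mono (by linarith), fun N hN => ⟨(hvan N hN).1, (hvan N hN).2.mono (by gcongr)⟩,
    fun N hN => ⟨(hust N hN).1, (hust N hN).2.mono (by gcongr)⟩,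
    fun ℓ' V' hℓ' hV' hf => ⟨fun N hN hv => ?_, fun N hN hv => ?_⟩,
    fun N hN => KSIVI.Model.sgdConverges_of_smooth hsm hsm0 hV16 hb (mvan N) (hvan N hN).1
      (hvan N hN).2 hsm' hmul',
    fun N hN => KSIVI.Model.sgdConverges_of_smooth hsm hsm0 hV16 hb (must N) (hust N hN).1
      (hust N hN).2 hsm' hmul'⟩
  · refine KSIVI.Model.sgdConverges_of_smooth hf hℓ' hV' hb (mvan N) (hvan N hN).1 hv ?_ ?_
    · gcongr
      linarith
    · gcongr
      linarith
  · refine KSIVI.Model.sgdConverges_of_smooth hf hℓ' hV' hb (must N) (hust N hN).1 hv ?_ ?_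
    · gcongr
      linarith
    · gcongr
      linarith
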